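/- Let $n\ge 1$. Let $\mathbf L=(L_t)_{t\ge 0}$ be a (real-valued) Lévy subordinator with $L_0=0$, not almost surely identically zero, and let $\varepsilon_1,\dots,\varepsilon_n$ be i.i.d. standard exponential random variables independent of $\mathbf L$. Let $\Psi(x)=-\log \mathbb E[e^{-xL_1}]$, let $T_i=\inf\{t\ge 0: L_t>\varepsilon_i\}$ (a Lévy-frailty Marshall–Olkin vector of lifetimes), and let $T_{1:n}\le\dots\le T_{n:n}$ be the ordered values of $T_1,\dots,T_n$. Let $N(t)=\#\{i: L_t\ge\varepsilon_i\}$ be the number of failed components at time $t$, and $N(\infty)=\lim_{t\to\infty}N(t)$. Let $\tau_0=0$, $\tau_{m+1}=\inf\{t>\tau_m: N(t)-N(t^-)>0\}$ (with $\inf\emptyset=+\infty$) and $N^{disc}_m=N(\tau_m)$ for $m\ge0$. For $1\le v\le l$ put $$\lambda^{(l)}_v=\sum_{a=0}^{v-1}\binom{v-1}{a}(-1)^a\bigl(\Psi(l-v+a+1)-\Psi(l-v+a)\bigr).$$ 1. $\lambda^{(l)}_v\ge 0$ for $1\le v\le l\le n$, and $(N(t))_{t\ge0}$ is a continuous-time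 Markov chain on $\{0,\dots,n\}$ whose rate of transition from $i$ to $j\ne i$ is $$\binom{n-i}{j-i}\lambda^{(n-i)}_{j-i}=\sum_{k=i}^{j}(-1)^{j-k+1}\frac{\binom nj\binom jk\binom ki}{\binom ni}\Psi(n-k)\qquad\text{for }0\le i<j\le n,$$ and zero if $i>j$. Moreover, for every $t\ge0$ and every set $A$ of components, conditionally on the set of failed components at time $t$ being $A$ (if this has positive probability), and with $i=|A|$, the vector $(T_a-t)_{a\notin A}$ has the law of $(\min_{V\ni a}E_V)_{a\notin A}$, where the shock arrival times $E_V$, indexed by the nonempty sets $V$ of working components, are independent and $E_V$ is exponential with rate $\lambda^{(n-i)}_{|V|}$ ($E_V=\infty$ if the rate is zero); and for $i<j\le n$ the time $\min_{|V|=j-i}E_V$ of the first shock that hits exactly $j-i$ of the $n-i$ working components is exponential with rate $\binom{n-i}{j-i}\lambda^{(n-i)}_{j-i}$. 2. $\Psi(n-i)>0$ for $i<n$. Put $$P_{i,j}=\binom{n-i}{j-i}\frac{\lambda^{(n-i)}_{j-i}}{\Psi(n-i)}=\sum_{k=i}^{j}(-1)^{j-k+1}\frac{\binom nj\binom jk\binom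 ki}{\binom ni}\frac{\Psi(n-k)}{\Psi(n-i)}$$ for $0\le i<j\le n$, and $P_{i,j}=0$ for all other $i,j\in\{0,\dots,n\}$. Then $N^{disc}$ is a discrete-time Markov chain started at $0$; its probability of a transition from $i$ to $j$ is $P_{i,j}$ for $0\le i<n$ and $0\le j\le n$, and the state $n$ is absorbing. 3. For $0\le i<j\le k\le n$ let $\overline Q_{i,j}$ (respectively $\overline Q_{i,\{j,\dots,k\}}$) be the probability that $N^{disc}$ at some step jumps, in one step, from the set $\{0,\dots,i\}$ into the state $j$ (respectively, into the set $\{j,\dots,k\}$), and let $\overline Q_{i,j}=0$ for $j\le i$. Then $\overline Q_{0,j}=P_{0,j}$ for $j>0$, $\overline Q_{i,j}=\overline Q_{i-1,j}+\overline Q_{i-1,i}P_{i,j}$ for $1\le i<j\le n$, and $\overline Q_{i,\{j,\dots,k\}}=\sum_{l=j}^k\overline Q_{i,l}$ for $0\le i<j\le k\le n$. 4. For $0\le i<j\le n$ let $Q_{i,j}$ be the probability that $N^{disc}$ goes from $0$ to $i$ in zero or more steps and then jumps, in one step, from $i$ to $j$; let $Q_{i,j}=0$ for $j\le i$. With the matrix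 $P=(P_{i,j})_{i,j=0}^n$, for $0\le i<j\le n$, $Q_{i,j}=\sum_{l=0}^{i}(P^l)_{0,i}P_{i,j}$ and $\overline Q_{i,j}=\sum_{l=0}^{i}Q_{l,j}$; and, for $0\le i<j\le k\le n$, $\overline Q_{i,\{j,\dots,k\}}=\sum_{l_1=0}^{i}\sum_{l_2=j}^{k}Q_{l_1,l_2}$. 5. For $1\le r,k\le n$: $\mathbb P(T_{r:n}<T_{k:n})$ equals $\overline Q_{r-1,\{r,\dots,k-1\}}$ if $r<k$ and $0$ if $r\ge k$; $\mathbb P(T_{r:n}=T_{k:n})$ equals $\overline Q_{r-1,\{k,\dots,n\}}$ if $r<k$ and $1$ if $r=k$; and $\mathbb P(N(T_{r:n})=k)$ equals $\overline Q_{r-1,k}$ if $r\le k$ and $0$ if $r>k$. -/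

import Mathlib

open MeasureTheory ProbabilityTheory Filter Topology
open scoped NNReal ENNReal

noncomputable section

namespace LFMO

/-! ### Lévy subordinators and the model -/

/-- A Lévy subordinator (real valued, started at `0`): independent and stationary increments,
almost surely nondecreasing and right-continuous paths (a nondecreasing path has left limits). -/
structure IsSubordinator {Ω : Type*} [MeasurableSpace Ω] (μ : Measure Ω)
    (L : ℝ≥0 → Ω → ℝ) : Prop where
  measurable : ∀ t, Measurable (L t)
  zero : ∀ᵐ ω ∂μ, L 0 ω = 0
  monotone : ∀ᵐ ω ∂μ, Monotone fun t => L t ω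
  rightCts : ∀ᵐ ω ∂μ, ∀ t, ContinuousWithinAt (fun s => L s ω) (Set.Ici t) t
  indep : HasIndepIncrements L μ
  stationary : ∀ s t, IdentDistrib (fun ω => L (s + t) ω - L s ω) (L t) μ μ

/-- The data behind a Lévy-frailty Marshall-Olkin vector with `n` components: a Lévy subordinator
`L`, not identically zero, and `n` i.i.d. standard exponential triggers `ε`, independent of `L`. -/
structure IsModel {Ω : Type*} [MeasurableSpace Ω] {n : ℕ} (μ : Measure Ω)
    (L : ℝ≥0 → Ω → ℝ) (ε : Fin n → Ω → ℝ) : Prop where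
  subordinator : IsSubordinator μ L
  nontrivial : ¬ ∀ᵐ ω ∂μ, L 1 ω = 0
  trigger_measurable : ∀ i, Measurable (ε i)
  trigger_law : ∀ i, HasLaw (ε i) (expMeasure 1) μ
  trigger_indep : iIndepFun ε μ
  indep : IndepFun (fun ω t => L t ω) (fun ω i => ε i ω) μ

/-- The Laplace exponent `Ψ(x) = -log E[exp(-x L₁)]`. -/
def laplaceExponent {Ω : Type*} [MeasurableSpace Ω] (μ : Measure Ω) (L : ℝ≥0 → Ω → ℝ)
    (x : ℝ) : ℝ :=
  -Real.log (∫ ω, Real.exp (-x * L 1 ω) ∂μ)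

/-- The lifetime `T i = inf {t ≥ 0 : L t > ε i}`, with `inf ∅ = ∞`. -/
def lifetime {Ω : Type*} {n : ℕ} (L : ℝ≥0 → Ω → ℝ) (ε : Fin n → Ω → ℝ) (i : Fin n) (ω : Ω) :
    ℝ≥0∞ :=
  ⨅ (t : ℝ≥0) (_ : ε i ω < L t ω), (t : ℝ≥0∞)

/-- The `k`-th smallest entry `x_{k:n}` (`1 ≤ k ≤ n`) of `x`; it is `∞` for other `k`. -/
def orderStat {n : ℕ} (x : Fin n → ℝ≥0∞) (k : ℕ) : ℝ≥0∞ :=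
  if h : 1 ≤ k ∧ k ≤ n then x (Tuple.sort x ⟨k - 1, by omega⟩) else ⊤

/-! ### The process of the number of failed components and its jump chain -/

/-- The set of components that have failed at time `t`. -/
def failedSet {Ω : Type*} {n : ℕ} (L : ℝ≥0 → Ω → ℝ) (ε : Fin n → Ω → ℝ) (t : ℝ≥0) (ω : Ω) :
    Finset (Fin n) :=
  Finset.univ.filter fun i => ε i ω ≤ L t ω

/-- The number `N(t)` of components that have failed at time `t`, as an element of
`{0, ..., n}`. -/
def failures {Ω : Type*} {n : ℕ} (L : ℝ≥0 → Ω → ℝ) (ε : Fin n → Ω → ℝ) (t : ℝ≥0) (ω : Ω) :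
    Fin (n + 1) :=
  ⟨(failedSet L ε t ω).card,
    Nat.lt_succ_of_le (by simpa using Finset.card_le_univ (failedSet L ε t ω))⟩

/-- `N` at a time in `[0, ∞]`, with `N(∞) = lim_{t → ∞} N(t)`. -/
def failuresAt {Ω : Type*} {n : ℕ} (L : ℝ≥0 → Ω → ℝ) (ε : Fin n → Ω → ℝ) (s : ℝ≥0∞) (ω : Ω) :
    Fin (n + 1) :=
  if s = ⊤ then limUnder atTop (fun t => failures L ε t ω) else failures L ε s.toNNReal ω

/-- The successive failure times: `τ 0 = 0` and `τ (m + 1) = inf {t > τ m : N(t) - N(t⁻) > 0}`,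
with `inf ∅ = ∞`. -/
def jumpTime {Ω : Type*} {n : ℕ} (L : ℝ≥0 → Ω → ℝ) (ε : Fin n → Ω → ℝ) :
    ℕ → Ω → ℝ≥0∞
  | 0, _ => 0
  | m + 1, ω => ⨅ (t : ℝ≥0) (_ : jumpTime L ε m ω < (t : ℝ≥0∞) ∧
      Function.leftLim (fun s => failures L ε s ω) t < failures L ε t ω), (t : ℝ≥0∞)

/-- The embedded chain `N^disc_m = N(τ m)`. -/
def jumpChain {Ω : Type*} {n : ℕ} (L : ℝ≥0 → Ω → ℝ) (ε : Fin n → Ω → ℝ) (m : ℕ) (ω : Ω) :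
    Fin (n + 1) :=
  failuresAt L ε (jumpTime L ε m ω) ω

/-! ### Markov chains on a finite state space -/

/-- `X` is a time-homogeneous continuous-time Markov chain with generator `G`: it has
right-continuous step paths, and its transition function `p` is a semigroup of stochastic matrices
whose derivative at `0` is `G`. So, for `i ≠ j`, the transition rate from `i` to `j` is `G i j`. -/
structure IsCTMC {Ω S : Type*} [MeasurableSpace Ω] [Fintype S] [DecidableEq S] (μ : Measure Ω)
    (X : ℝ≥0 → Ω → S) (G : Matrix S S ℝ) : Prop where
  measurable : ∀ t i, MeasurableSet {ω | X t ω = i}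
  rightCts : ∀ᵐ ω ∂μ, ∀ t, ∀ᶠ s in 𝓝[>] t, X s ω = X t ω
  markov : ∃ p : ℝ≥0 → Matrix S S ℝ,
    p 0 = 1 ∧
    (∀ t i j, 0 ≤ p t i j) ∧
    (∀ t i, ∑ j, p t i j = 1) ∧
    (∀ s t, p (s + t) = p s * p t) ∧
    (∀ i j, Tendsto (fun h : ℝ≥0 => (p h i j - (1 : Matrix S S ℝ) i j) / (h : ℝ))
      (𝓝[>] 0) (𝓝 (G i j))) ∧
    ∀ (m : ℕ) (t : ℕ → ℝ≥0), Monotone t → ∀ x : ℕ → S,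
      μ.real {ω | ∀ l ≤ m + 1, X (t l) ω = x l} =
        μ.real {ω | ∀ l ≤ m, X (t l) ω = x l} * p (t (m + 1) - t m) (x m) (x (m + 1))

/-- `X` is a time-homogeneous discrete-time Markov chain with transition matrix `p`. -/
structure IsDTMC {Ω S : Type*} [MeasurableSpace Ω] [Fintype S] (μ : Measure Ω)
    (X : ℕ → Ω → S) (p : Matrix S S ℝ) : Prop where
  nonneg : ∀ i j, 0 ≤ p i j
  row_sum : ∀ i, ∑ j, p i j = 1
  markov : ∀ (m : ℕ) (x : ℕ → S),
    μ.real {ω | ∀ l ≤ m + 1, X l ω = x l} =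
      μ.real {ω | ∀ l ≤ m, X l ω = x l} * p (x m) (x (m + 1))

/-! ### Rates and transition probabilities, as functions of `Ψ` -/

/-- `λ^{(l)}_v = ∑_{a=0}^{v-1} C(v-1,a) (-1)^a (Ψ(l-v+a+1) - Ψ(l-v+a))`, for `1 ≤ v ≤ l`. -/
def lam (Ψ : ℝ → ℝ) (l v : ℕ) : ℝ :=
  ∑ a ∈ Finset.range v, ((v - 1).choose a : ℝ) * (-1) ^ a *
    (Ψ ((l - v + a + 1 : ℕ) : ℝ) - Ψ ((l - v + a : ℕ) : ℝ))

/-- The rate of the transition from `i` to `j` failed components: `C(n-i,j-i) λ^{(n-i)}_{j-i}` for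
`i < j ≤ n` and zero otherwise. -/
def rate (Ψ : ℝ → ℝ) (n i j : ℕ) : ℝ :=
  if i < j ∧ j ≤ n then ((n - i).choose (j - i) : ℝ) * lam Ψ (n - i) (j - i) else 0

/-- The generator: the transition rates off the diagonal, minus the total outgoing rate on it. -/
def generator (Ψ : ℝ → ℝ) (n : ℕ) : Matrix (Fin (n + 1)) (Fin (n + 1)) ℝ :=
  fun i j => if i = j then -∑ l : Fin (n + 1), rate Ψ n i l else rate Ψ n i j

/-- `P_{i,j} = C(n-i,j-i) λ^{(n-i)}_{j-i} / Ψ(n-i)` for `i < j ≤ n` and zero otherwise. -/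
def transProb (Ψ : ℝ → ℝ) (n i j : ℕ) : ℝ :=
  if i < j ∧ j ≤ n then
    ((n - i).choose (j - i) : ℝ) * (lam Ψ (n - i) (j - i) / Ψ ((n - i : ℕ) : ℝ))
  else 0

/-- The matrix `P = (P_{i,j} : i, j = 0, ..., n)`. Its last row is zero. -/
def transMatrix (Ψ : ℝ → ℝ) (n : ℕ) : Matrix (Fin (n + 1)) (Fin (n + 1)) ℝ :=
  fun i j => transProb Ψ n i j

/-- The transition matrix of the embedded chain: `P` outside the last row, state `n` absorbing. -/
def absorbedMatrix (Ψ : ℝ → ℝ) (n : ℕ) : Matrix (Fin (n + 1)) (Fin (n + 1)) ℝ :=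
  fun i j => if i = Fin.last n then (if j = Fin.last n then 1 else 0) else transProb Ψ n i j

/-! ### Probabilities of jumps of the embedded chain -/

/-- The probability that the chain `X` visits `i` and then jumps in one step from `i` to `j`;
a jump of the chain is an increase, so this is zero unless `i < j`. -/
def jumpFrom {Ω : Type*} [MeasurableSpace Ω] {n : ℕ} (μ : Measure Ω)
    (X : ℕ → Ω → Fin (n + 1)) (i j : ℕ) : ℝ :=
  μ.real {ω | ∃ m, (X m ω : ℕ) = i ∧ (X (m + 1) ω : ℕ) = j ∧ i < j}

/-- The probability that the chain `X` jumps in one step out of `{0, ..., i}` into the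
state `j`; zero unless `i < j`. -/
def jumpInto {Ω : Type*} [MeasurableSpace Ω] {n : ℕ} (μ : Measure Ω)
    (X : ℕ → Ω → Fin (n + 1)) (i j : ℕ) : ℝ :=
  μ.real {ω | ∃ m, (X m ω : ℕ) ≤ i ∧ (X (m + 1) ω : ℕ) = j ∧ i < j}

/-- For `i < j ≤ k`, the probability that the chain `X` jumps in one step from `{0, ..., i}` into
`{j, ..., k}`. -/
def jumpIntoSet {Ω : Type*} [MeasurableSpace Ω] {n : ℕ} (μ : Measure Ω)
    (X : ℕ → Ω → Fin (n + 1)) (i j k : ℕ) : ℝ :=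
  μ.real {ω | ∃ m, (X m ω : ℕ) ≤ i ∧ j ≤ (X (m + 1) ω : ℕ) ∧ (X (m + 1) ω : ℕ) ≤ k}

/-! ### Shocks -/

/-- The exponential law of rate `r ≥ 0` on `[0, ∞]`; for rate `0` it is the unit mass at `∞`. -/
def expLaw (r : ℝ) : Measure ℝ≥0∞ :=
  if 0 < r then (expMeasure r).map ENNReal.ofReal else Measure.dirac ⊤

instance (r : ℝ) : IsProbabilityMeasure (expLaw r) := by
  unfold expLaw
  split_ifs with h
  · have := isProbabilityMeasure_expMeasure h
    exact Measure.isProbabilityMeasure_map ENNReal.measurable_ofReal.aemeasurable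
  · infer_instance

/-- The possible shocks when the set of failed components is `A`: the nonempty sets of
working components. -/
abbrev Shock {n : ℕ} (A : Finset (Fin n)) : Type :=
  {V : Finset (Fin n) // V.Nonempty ∧ Disjoint V A}

/-- The joint law of independent arrival times of the shocks when the failed set is `A`: the shock
that hits exactly the working components in `V` is exponential of rate `λ^{(n-|A|)}_{|V|}`. -/
def shockLaw (Ψ : ℝ → ℝ) {n : ℕ} (A : Finset (Fin n)) : Measure (Shock A → ℝ≥0∞) :=
  Measure.pi fun V => expLaw (lam Ψ (n - A.card) V.1.card)

end LFMO

end

noncomputable section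

namespace LFMO

/-! ### Alternating differences -/

/-! Given the path of `L`, the triggers are i.i.d. exponential, so the probability of prescriptions
on them is a product of factors such as e^{-L_t}. The exponential law has no memory and the
increments of `L` are independent and stationary. Hence the excesses of the surviving triggers over
L_t and the future increments of `L` form a fresh copy of the model, independent of the past
(`exists_past_density`, `lintegral_past_mul`). In a time h the failed set passes from A to B ⊇ A
with probability E[(1 - e^{-L_h})^{|B|-|A|} e^{-(n-|B|) L_h}]. This depends only on cardinalities,
so the count N is itself Markov (`failures_markov`). Expanding the binomial writes its transition
matrix as U diag(e^{-hΨ(n-k)}) U⁻¹, with U a matrix of binomial coefficients (`binomConj`). The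
semigroup law and the generator are then read off the diagonal. The rates λ are nonnegative because
they are, up to a binomial coefficient, derivatives at 0 of transition probabilities.

For the shocks, the joint survival function of the residual lifetimes is computed by using up the
smallest positive threshold u: if m thresholds are positive, this costs a factor e^{-uΨ(m)}. The
Marshall-Olkin exponent ∑_V λ_{|V|} max_V s obeys the same recursion (`shockExponent_eq_add`), and a
survival function determines the law (`measure_ext_of_survival`).

The embedded chain is treated through the random set R of values taken by N, which avoids stopping
times. Along almost every path N is monotone with finitely many values, and N(τ_m) is the m-th
element of R in increasing order, stopped at n (`jumpChain_eq_chain`). For the law of R, N is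
sampled on the grid of mesh 1/k!. For a monotone chain in discrete time, the next new state after i
is j with probability p_ij / (1 - p_ii). The set visited on the grid eventually equals R, so
dividing by the mesh and letting k grow gives G_ij / (-G_ii) = P_ij
(`IsCTMC.measureReal_visited_mul`).

The remaining claims are set-theoretic. Let `succVal R i` be the least element of R above i. The
step of the chain that crosses i lands on it, and it is also the value of N at the order statistic
of index i + 1. Recursions, matrix powers and comparisons of order statistics then follow by
splitting events about R. -/

/-- The alternating difference `∑_{a ≤ v} (-1)^a C(v,a) g(k+a)`. -/
def altDiff (g : ℕ → ℝ) (v k : ℕ) : ℝ :=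
  ∑ a ∈ Finset.range (v + 1), (-1 : ℝ) ^ a * (v.choose a : ℝ) * g (k + a)

lemma altDiff_zero (g : ℕ → ℝ) (k : ℕ) : altDiff g 0 k = g k := by simp [altDiff]

lemma altDiff_succ (g : ℕ → ℝ) (v k : ℕ) :
    altDiff g (v + 1) k = altDiff g v k - altDiff g v (k + 1) := by
  unfold altDiff
  rw [Finset.sum_range_succ']
  have h : ∀ a ∈ Finset.range (v + 1),
      (-1 : ℝ) ^ (a + 1) * ((v + 1).choose (a + 1) : ℝ) * g (k + (a + 1)) =
        (-1 : ℝ) ^ (a + 1) * (v.choose (a + 1) : ℝ) * g (k + (a + 1)) -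
          (-1 : ℝ) ^ a * (v.choose a : ℝ) * g (k + 1 + a) := by
    intro a _
    rw [Nat.choose_succ_succ, show k + 1 + a = k + (a + 1) by ring]
    push_cast
    ring
  rw [Finset.sum_congr rfl h, Finset.sum_sub_distrib]
  have h2 := Finset.sum_range_succ' (fun a => (-1 : ℝ) ^ a * (v.choose a : ℝ) * g (k + a)) (v + 1)
  rw [Finset.sum_range_succ] at h2
  simp only [Nat.choose_succ_self, Nat.cast_zero, mul_zero, zero_mul, add_zero] at h2
  rw [h2]
  simp
  ring

lemma altDiff_const_mul (c : ℝ) (g : ℕ → ℝ) (v k : ℕ) :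
    altDiff (fun m => c * g m) v k = c * altDiff g v k := by
  unfold altDiff
  rw [Finset.mul_sum]
  exact Finset.sum_congr rfl fun a _ => by ring

lemma altDiff_pow (x : ℝ) (v k : ℕ) : altDiff (fun m => x ^ m) v k = (1 - x) ^ v * x ^ k := by
  induction v generalizing k with
  | zero => simp [altDiff_zero]
  | succ v ih => rw [altDiff_succ, ih, ih]; ring

/-- For g = x^· this is the binomial theorem for x^(m-r) ((1 - x) + x)^r. For general g, Pascal's
rule together with `altDiff_succ` reduces r + 1 at m to r at m - 1, and the remaining sums
telescope. -/
lemma sum_choose_mul_altDiff (g : ℕ → ℝ) (r m : ℕ) (h : r ≤ m) :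
    ∑ v ∈ Finset.range (r + 1), (r.choose v : ℝ) * altDiff g v (m - v) = g (m - r) := by
  induction r generalizing m with
  | zero => simp [altDiff_zero]
  | succ r ih =>
    rw [← Nat.sub_sub, show m - r - 1 = m - 1 - r by omega, ← ih (m - 1) (by omega),
      Finset.sum_range_succ']
    have h1 : ∀ v ∈ Finset.range (r + 1),
        ((r + 1).choose (v + 1) : ℝ) * altDiff g (v + 1) (m - (v + 1)) =
          (r.choose v : ℝ) * altDiff g v (m - 1 - v) - (r.choose v : ℝ) * altDiff g v (m - v) +
          (r.choose (v + 1) : ℝ) * altDiff g (v + 1) (m - (v + 1)) := by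
      intro v hv
      have hv := Finset.mem_range.1 hv
      have e : altDiff g (v + 1) (m - (v + 1)) = altDiff g v (m - 1 - v) - altDiff g v (m - v) := by
        rw [altDiff_succ, show m - (v + 1) = m - 1 - v by omega,
          show m - 1 - v + 1 = m - v by omega]
      rw [Nat.choose_succ_succ, Nat.cast_add, add_mul, ← mul_sub, ← e]
    rw [Finset.sum_congr rfl h1, Finset.sum_add_distrib, Finset.sum_sub_distrib]
    have h2 := Finset.sum_range_succ'
      (fun v => (r.choose v : ℝ) * altDiff g v (m - v)) (r + 1)
    rw [Finset.sum_range_succ] at h2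
    simp only [Nat.choose_succ_self, Nat.cast_zero, zero_mul, add_zero, Nat.choose_zero_right]
      at h2 ⊢
    rw [h2]
    ring

/-! ### The rates -/

lemma lam_zero_right (Ψ : ℝ → ℝ) (l : ℕ) : lam Ψ l 0 = 0 := by simp [lam]

lemma lam_eq_neg_altDiff (Ψ : ℝ → ℝ) (l : ℕ) {v : ℕ} (hv : 1 ≤ v) :
    lam Ψ l v = -altDiff (fun k => Ψ (k : ℝ)) v (l - v) := by
  obtain ⟨w, rfl⟩ : ∃ w, v = w + 1 := ⟨v - 1, by omega⟩
  rw [altDiff_succ, neg_sub]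
  unfold lam altDiff
  rw [← Finset.sum_sub_distrib]
  refine Finset.sum_congr rfl fun a _ => ?_
  rw [show l - (w + 1) + a + 1 = l - (w + 1) + 1 + a by ring]
  simp only [Nat.add_sub_cancel]
  ring

/-- Among m working components, this is the total rate of the shocks contained in a fixed set of r
of them. With r = m it is the total rate of all shocks. The term v = 0 is harmless because `lam Ψ m
0` is an empty sum. -/
lemma sum_choose_mul_lam (Ψ : ℝ → ℝ) {r m : ℕ} (h : r ≤ m) :
    ∑ v ∈ Finset.range (r + 1), (r.choose v : ℝ) * lam Ψ m v =
      Ψ (m : ℝ) - Ψ ((m - r : ℕ) : ℝ) := by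
  have := sum_choose_mul_altDiff (fun k => Ψ (k : ℝ)) r m h
  rw [Finset.sum_range_succ'] at this ⊢
  rw [lam_zero_right, ← this]
  simp only [altDiff_zero, Nat.choose_zero_right, Nat.sub_zero, Nat.cast_one, one_mul, mul_zero,
    add_zero]
  rw [Finset.sum_congr rfl fun v _ => by rw [lam_eq_neg_altDiff Ψ m (Nat.succ_pos v)]]
  simp only [mul_neg, Finset.sum_neg_distrib]
  ring

/-- Substitute a = j - k in the alternating difference. Applying `Nat.choose_mul` twice turns the
quotient of binomial coefficients into C(n-i,j-i) C(j-i,j-k). -/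
lemma choose_mul_lam_eq_sum (Ψ : ℝ → ℝ) {n i j : ℕ} (hij : i < j) (hjn : j ≤ n) :
    ((n - i).choose (j - i) : ℝ) * lam Ψ (n - i) (j - i) =
      ∑ k ∈ Finset.Icc i j, (-1 : ℝ) ^ (j - k + 1) *
        ((n.choose j : ℝ) * (j.choose k : ℝ) * (k.choose i : ℝ) / (n.choose i : ℝ)) *
        Ψ ((n - k : ℕ) : ℝ) := by
  rw [lam_eq_neg_altDiff Ψ _ (by omega), altDiff, ← Finset.sum_neg_distrib, Finset.mul_sum]
  symm
  refine Finset.sum_bij' (fun k _ => j - k) (fun a _ => j - a) ?_ ?_ ?_ ?_ ?_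
  · intro k hk; simp only [Finset.mem_Icc, Finset.mem_range] at *; omega
  · intro k hk; simp only [Finset.mem_Icc, Finset.mem_range] at *; omega
  · intro k hk; simp only [Finset.mem_Icc] at *; omega
  · intro k hk; simp only [Finset.mem_range] at *; omega
  · intro k hk
    rw [Finset.mem_Icc] at hk
    have h1 := Nat.choose_mul (n := n) hij.le
    have h2 := Nat.choose_mul (n := j) hk.1
    have h3 : (j - i).choose (k - i) = (j - i).choose (j - k) := by
      rw [← Nat.choose_symm (by omega)]; congr 1; omega
    have h4 : (n.choose i : ℝ) ≠ 0 := by exact_mod_cast (Nat.choose_pos (by omega)).ne'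
    have e : (n.choose j : ℝ) * (j.choose k : ℝ) * (k.choose i : ℝ) / (n.choose i : ℝ) =
        ((n - i).choose (j - i) : ℝ) * ((j - i).choose (j - k) : ℝ) := by
      rw [div_eq_iff h4, mul_assoc, ← Nat.cast_mul, h2, h3, Nat.cast_mul, ← mul_assoc,
        ← Nat.cast_mul, h1]
      push_cast; ring
    rw [e, show n - i - (j - i) + (j - k) = n - k by omega, pow_succ]
    ring

lemma transProb_eq_rate_div (Ψ : ℝ → ℝ) (n i j : ℕ) :
    transProb Ψ n i j = rate Ψ n i j / Ψ ((n - i : ℕ) : ℝ) := by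
  unfold transProb rate
  split_ifs
  · ring
  · simp

lemma transProb_eq_sum (Ψ : ℝ → ℝ) {n i j : ℕ} (hij : i < j) (hjn : j ≤ n) :
    transProb Ψ n i j =
      ∑ k ∈ Finset.Icc i j, (-1 : ℝ) ^ (j - k + 1) *
        ((n.choose j : ℝ) * (j.choose k : ℝ) * (k.choose i : ℝ) / (n.choose i : ℝ)) *
        (Ψ ((n - k : ℕ) : ℝ) / Ψ ((n - i : ℕ) : ℝ)) := by
  rw [transProb_eq_rate_div, rate, if_pos ⟨hij, hjn⟩, choose_mul_lam_eq_sum Ψ hij hjn,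
    Finset.sum_div]
  exact Finset.sum_congr rfl fun k _ => by ring

/-- The chain leaves i as soon as any shock hits the n - i working components, so this is the case r
= m of `sum_choose_mul_lam`. -/
lemma sum_rate (Ψ : ℝ → ℝ) (h0 : Ψ 0 = 0) {n i : ℕ} (hi : i ≤ n) :
    ∑ j : Fin (n + 1), rate Ψ n i j = Ψ ((n - i : ℕ) : ℝ) := by
  have h := sum_choose_mul_lam Ψ (le_refl (n - i))
  simp only [Nat.sub_self, Nat.cast_zero, h0, sub_zero] at h
  rw [← h, Fin.sum_univ_eq_sum_range (fun j => rate Ψ n i j) (n + 1),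
    ← Finset.sum_range_add_sum_Ico _ (show i ≤ n + 1 by omega), Finset.sum_eq_zero, zero_add,
    Finset.sum_Ico_eq_sum_range, show n + 1 - i = n - i + 1 by omega]
  · refine Finset.sum_congr rfl fun v hv => ?_
    have hv := Finset.mem_range.1 hv
    rcases Nat.eq_zero_or_pos v with rfl | h0
    · simp [rate, lam_zero_right]
    · rw [rate, if_pos (by omega), Nat.add_sub_cancel_left]
  · intro j hj
    have hj := Finset.mem_range.1 hj
    rw [rate, if_neg (by omega)]

/-! ### The transition semigroup -/

/-- The binomial matrix `C(n-i, n-j)`. -/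
def binomMatrix (n : ℕ) : Matrix (Fin (n + 1)) (Fin (n + 1)) ℝ :=
  fun i j => ((n - i : ℕ).choose (n - j) : ℝ)

/-- The signed binomial matrix `(-1)^(i+j) C(n-i, n-j)`, inverse to `binomMatrix`. -/
def signedBinomMatrix (n : ℕ) : Matrix (Fin (n + 1)) (Fin (n + 1)) ℝ :=
  fun i j => (-1) ^ ((i : ℕ) + j) * ((n - i : ℕ).choose (n - j) : ℝ)

/-- The matrix with entries `C(n-i,j-i) ∑_a (-1)^a C(j-i,a) g(n-j+a)`, diagonal in the binomial
basis. -/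
def binomConj (n : ℕ) (g : ℕ → ℝ) : Matrix (Fin (n + 1)) (Fin (n + 1)) ℝ :=
  binomMatrix n * Matrix.diagonal (fun k : Fin (n + 1) => g (n - k)) * signedBinomMatrix n

/-- Only i ≤ k ≤ j contributes to the matrix product; there C(n-i,n-k) C(n-k,n-j) = C(n-i,j-i)
C(j-i,j-k), and the substitution a = j - k leaves an alternating difference. -/
lemma binomConj_apply (n : ℕ) (g : ℕ → ℝ) (i j : Fin (n + 1)) :
    binomConj n g i j =
      if i ≤ j then ((n - i : ℕ).choose (j - i) : ℝ) * altDiff g (j - i) (n - j) else 0 := by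
  have hi : (i : ℕ) ≤ n := by omega
  have hj : (j : ℕ) ≤ n := by omega
  have h0 : binomConj n g i j = ∑ k : Fin (n + 1), ((n - i : ℕ).choose (n - k) : ℝ) * g (n - k) *
      ((-1) ^ ((k : ℕ) + j) * ((n - k : ℕ).choose (n - j) : ℝ)) := by
    rw [binomConj, Matrix.mul_apply]
    refine Finset.sum_congr rfl fun k _ => ?_
    rw [Matrix.mul_diagonal, binomMatrix, signedBinomMatrix]
  rw [h0, Fin.sum_univ_eq_sum_range (fun k => ((n - i : ℕ).choose (n - k) : ℝ) * g (n - k) *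
      ((-1) ^ (k + (j : ℕ)) * ((n - k : ℕ).choose (n - j) : ℝ))) (n + 1)]
  split_ifs with hij
  · have hij' : (i : ℕ) ≤ j := hij
    have hsub : Finset.Icc (i : ℕ) j ⊆ Finset.range (n + 1) := by
      intro k hk; simp only [Finset.mem_Icc, Finset.mem_range] at *; omega
    rw [← Finset.sum_subset hsub, altDiff, Finset.mul_sum]
    · refine Finset.sum_bij' (fun k _ => (j : ℕ) - k) (fun a _ => (j : ℕ) - a) ?_ ?_ ?_ ?_ ?_
      · intro k hk; simp only [Finset.mem_Icc, Finset.mem_range] at *; omega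
      · intro k hk; simp only [Finset.mem_Icc, Finset.mem_range] at *; omega
      · intro k hk; simp only [Finset.mem_Icc] at *; omega
      · intro k hk; simp only [Finset.mem_range] at *; omega
      · intro k hk
        rw [Finset.mem_Icc] at hk
        have h1 := Nat.choose_mul (n := n - i) (k := n - k) (s := n - j) (by omega)
        rw [show n - i - (n - j) = (j : ℕ) - i by omega,
          show n - k - (n - (j : ℕ)) = (j : ℕ) - k by omega,
          show (n - i : ℕ).choose (n - j) = (n - i).choose (j - i) by
            rw [← Nat.choose_symm (by omega)]; congr 1; omega] at h1
        have h2 : (-1 : ℝ) ^ (k + (j : ℕ)) = (-1) ^ ((j : ℕ) - k) := by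
          rw [show k + (j : ℕ) = ((j : ℕ) - k) + 2 * k by omega, pow_add, pow_mul]; simp
        have h1' : ((n - i : ℕ).choose (n - k) : ℝ) * ((n - k : ℕ).choose (n - j) : ℝ) =
          ((n - i : ℕ).choose (j - i) : ℝ) * (((j : ℕ) - i).choose (j - k) : ℝ) := by
          exact_mod_cast h1
        rw [h2, show n - (j : ℕ) + (j - k) = n - k by omega]
        linear_combination (g (n - k) * (-1) ^ ((j : ℕ) - k)) * h1'
    · intro k hk hk'
      simp only [Finset.mem_Icc, Finset.mem_range] at *
      rcases lt_or_ge k i with h | h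
      · rw [Nat.choose_eq_zero_of_lt (show n - i < n - k by omega)]; simp
      · rw [Nat.choose_eq_zero_of_lt (show n - k < n - j by omega)]; simp
  · have hij' : ¬ (i : ℕ) ≤ j := hij
    refine Finset.sum_eq_zero fun k hk => ?_
    simp only [Finset.mem_range] at *
    rcases lt_or_ge k i with h | h
    · rw [Nat.choose_eq_zero_of_lt (show n - i < n - k by omega)]; simp
    · rw [Nat.choose_eq_zero_of_lt (show n - k < n - j by omega)]; simp

/-- Alternating differences of a constant vanish from order one on. So the two binomial matrices are
inverse to each other, and `binomConj n` is multiplicative in g. -/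
lemma binomConj_one (n : ℕ) : binomConj n (fun _ => 1) = 1 := by
  ext i j
  rw [binomConj_apply, Matrix.one_apply]
  have := altDiff_pow 1 ((j : ℕ) - i) (n - j)
  simp only [one_pow, sub_self, mul_one] at this
  rw [this]
  rcases lt_trichotomy i j with h | rfl | h
  · have h' : (i : ℕ) < j := h
    rw [if_pos h.le, if_neg h.ne, zero_pow (by omega), mul_zero]
  · simp
  · rw [if_neg h.not_ge, if_neg h.ne']

lemma signedBinomMatrix_mul_binomMatrix (n : ℕ) : signedBinomMatrix n * binomMatrix n = 1 := by
  rw [mul_eq_one_comm]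
  have h := binomConj_one n
  rwa [binomConj, Matrix.diagonal_one, mul_one] at h

lemma binomConj_mul (n : ℕ) (f g : ℕ → ℝ) :
    binomConj n f * binomConj n g = binomConj n (fun k => f k * g k) := by
  unfold binomConj
  calc _ = binomMatrix n * Matrix.diagonal (fun k : Fin (n + 1) => f (n - k)) *
        (signedBinomMatrix n * binomMatrix n) *
        Matrix.diagonal (fun k : Fin (n + 1) => g (n - k)) * signedBinomMatrix n := by
        simp only [Matrix.mul_assoc]
    _ = _ := by
        rw [signedBinomMatrix_mul_binomMatrix, Matrix.mul_one, Matrix.mul_assoc (binomMatrix n),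
          Matrix.diagonal_mul_diagonal]

lemma generator_eq_binomConj (Ψ : ℝ → ℝ) (h0 : Ψ 0 = 0) (n : ℕ) :
    generator Ψ n = binomConj n (fun k => -Ψ (k : ℝ)) := by
  ext i j
  rw [binomConj_apply, generator]
  have hneg : ∀ v k, altDiff (fun k : ℕ => -Ψ (k : ℝ)) v k =
      -altDiff (fun k : ℕ => Ψ (k : ℝ)) v k := fun v k => by
    rw [← neg_one_mul, ← altDiff_const_mul]; simp
  rw [hneg]
  rcases lt_trichotomy i j with h | rfl | h
  · have h' : (i : ℕ) < j := h
    rw [if_neg h.ne, if_pos h.le, rate, if_pos ⟨h', by omega⟩, lam_eq_neg_altDiff Ψ _ (by omega),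
      show n - (i : ℕ) - (j - i) = n - j by omega]
  · rw [if_pos rfl, if_pos le_rfl, sum_rate Ψ h0 (by omega), Nat.sub_self, altDiff_zero]
    simp
  · have h' : (j : ℕ) < i := h
    rw [if_neg h.ne', if_neg h.not_ge, rate, if_neg (by omega)]

/-- The transition function of the number of failed components. -/
def semigroup (Ψ : ℝ → ℝ) (n : ℕ) (t : ℝ≥0) : Matrix (Fin (n + 1)) (Fin (n + 1)) ℝ :=
  binomConj n fun k => Real.exp (-((t : ℝ) * Ψ (k : ℝ)))

lemma semigroup_zero (Ψ : ℝ → ℝ) (n : ℕ) : semigroup Ψ n 0 = 1 := by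
  rw [semigroup, ← binomConj_one]; simp

lemma semigroup_add (Ψ : ℝ → ℝ) (n : ℕ) (s t : ℝ≥0) :
    semigroup Ψ n (s + t) = semigroup Ψ n s * semigroup Ψ n t := by
  rw [semigroup, semigroup, semigroup, binomConj_mul]
  congr 1
  ext k
  rw [← Real.exp_add]; push_cast; ring_nf

/-- Each entry is a fixed linear combination of the scalars exp(-hΨ(k)), so it suffices to
differentiate these at 0. -/
lemma semigroup_hasDerivAt (Ψ : ℝ → ℝ) (h0 : Ψ 0 = 0) (n : ℕ) (i j : Fin (n + 1)) :
    Tendsto (fun h : ℝ≥0 => (semigroup Ψ n h i j - (1 : Matrix (Fin (n + 1)) (Fin (n + 1)) ℝ) i j) /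
      (h : ℝ)) (𝓝[>] 0) (𝓝 (generator Ψ n i j)) := by
  have key : ∀ c : ℝ, Tendsto (fun h : ℝ≥0 => (Real.exp (-((h : ℝ) * c)) - 1) / (h : ℝ))
      (𝓝[>] 0) (𝓝 (-c)) := by
    intro c
    have hd : HasDerivAt (fun x : ℝ => Real.exp (-(x * c))) (-c) 0 := by
      have := ((hasDerivAt_id (0 : ℝ)).mul_const c).neg.exp
      simpa using this
    have h1 := hd.tendsto_slope_zero
    have h2 : Tendsto (fun h : ℝ≥0 => (h : ℝ)) (𝓝[>] 0) (𝓝[≠] 0) := by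
      refine tendsto_nhdsWithin_iff.2 ⟨?_, ?_⟩
      · exact (NNReal.continuous_coe.tendsto 0).mono_left nhdsWithin_le_nhds
      · filter_upwards [self_mem_nhdsWithin] with h hh
        simpa using (ne_of_gt hh)
    refine (h1.comp h2).congr fun h => ?_
    simp [div_eq_inv_mul]
  rw [← binomConj_one, generator_eq_binomConj Ψ h0]
  simp only [semigroup, binomConj_apply]
  split_ifs with hij
  · simp only [altDiff, ← mul_sub, ← Finset.sum_sub_distrib, mul_div_assoc, Finset.sum_div]
    exact (tendsto_finsetSum _ fun a _ => (key _).const_mul _).const_mul _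
  · simp

/-! ### Analytic preliminaries -/

/-- Cauchy's functional equation for log f, with monotonicity in place of continuity. -/
lemma eq_exp_mul_log_of_antitone_of_map_add {f : ℝ≥0 → ℝ} (hpos : ∀ t, 0 < f t)
    (hadd : ∀ s t, f (s + t) = f s * f t) (hf : Antitone f) (t : ℝ≥0) :
    f t = Real.exp (t * Real.log (f 1)) := by
  have hlog : ∀ s t, Real.log (f (s + t)) = Real.log (f s) + Real.log (f t) := fun s t => by
    rw [hadd, Real.log_mul (hpos s).ne' (hpos t).ne']
  have h0 : Real.log (f 0) = 0 := by simpa using hlog 0 0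
  have hmul : ∀ (k : ℕ) (t : ℝ≥0), Real.log (f (k * t)) = k * Real.log (f t) := by
    intro k t
    induction k with
    | zero => simp [h0]
    | succ k ih => rw [Nat.cast_succ, add_mul, one_mul, hlog, ih]; push_cast; ring
  have hone : ∀ k : ℕ, Real.log (f k) = k * Real.log (f 1) := fun k => by
    simpa using hmul k 1
  have hmono : ∀ {s t : ℝ≥0}, s ≤ t → Real.log (f t) ≤ Real.log (f s) := fun h =>
    Real.log_le_log (hpos _) (hf h)
  have hl1 : Real.log (f 1) ≤ 0 := by simpa [h0] using hmono (zero_le_one (α := ℝ≥0))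
  -- N t lies between two consecutive integers, where log f is known. The resulting error is at most
  -- -log f(1), independently of N.
  have hbound : ∀ N : ℕ, (N : ℝ) * |Real.log (f t) - t * Real.log (f 1)| ≤ -Real.log (f 1) := by
    intro N
    have h1 : ((⌊(N : ℝ≥0) * t⌋₊ : ℕ) : ℝ≥0) ≤ N * t := Nat.floor_le (by positivity)
    have h2 : (N : ℝ≥0) * t ≤ ((⌊(N : ℝ≥0) * t⌋₊ + 1 : ℕ) : ℝ≥0) := by
      push_cast; exact (Nat.lt_floor_add_one _).le
    have h3 := hmono h1
    have h4 := hmono h2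
    rw [hmul, hone] at h3 h4
    have h1' : ((⌊(N : ℝ≥0) * t⌋₊ : ℕ) : ℝ) ≤ N * t := by exact_mod_cast h1
    have h2' : (N : ℝ) * t ≤ (⌊(N : ℝ≥0) * t⌋₊ : ℕ) + 1 := by exact_mod_cast h2
    push_cast at h4
    set k : ℝ := ((⌊(N : ℝ≥0) * t⌋₊ : ℕ) : ℝ)
    rw [← abs_of_nonneg (Nat.cast_nonneg' N : (0 : ℝ) ≤ N), ← abs_mul, abs_le]
    constructor <;> nlinarith
  have heq : Real.log (f t) - t * Real.log (f 1) = 0 := by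
    by_contra hne
    have hp := abs_pos.2 hne
    obtain ⟨N, hN⟩ := exists_nat_gt (-Real.log (f 1) / |Real.log (f t) - t * Real.log (f 1)|)
    rw [div_lt_iff₀ hp] at hN
    exact absurd (hbound N) hN.not_ge
  rw [← sub_eq_zero.1 heq, Real.exp_log (hpos t)]

lemma expMeasure_one_Ioi {x : ℝ} (hx : 0 ≤ x) :
    expMeasure 1 (Set.Ioi x) = ENNReal.ofReal (Real.exp (-x)) := by
  have := isProbabilityMeasure_expMeasure one_pos
  rw [← Set.compl_Iic, prob_compl_eq_one_sub measurableSet_Iic, ← ofReal_cdf,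
    cdf_expMeasure_eq one_pos, if_pos hx, one_mul, ← ENNReal.ofReal_one,
    ← ENNReal.ofReal_sub _ (by simpa using hx)]
  congr 1; ring

lemma expMeasure_one_Ioc {x y : ℝ} (hx : 0 ≤ x) (hxy : x ≤ y) :
    expMeasure 1 (Set.Ioc x y) =
      ENNReal.ofReal (Real.exp (-x)) * ENNReal.ofReal (1 - Real.exp (-(y - x))) := by
  have := isProbabilityMeasure_expMeasure one_pos
  rw [← Set.Ioi_sdiff_Ioi, measure_sdiff (Set.Ioi_subset_Ioi hxy) measurableSet_Ioi.nullMeasurableSet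
    (measure_ne_top _ _), expMeasure_one_Ioi hx, expMeasure_one_Ioi (hx.trans hxy),
    ← ENNReal.ofReal_sub _ (Real.exp_pos _).le, ← ENNReal.ofReal_mul (Real.exp_pos _).le]
  congr 1
  rw [mul_sub, ← Real.exp_add]; ring_nf

lemma expMeasure_one_singleton (x : ℝ) : expMeasure 1 {x} = 0 := by
  unfold expMeasure gammaMeasure
  exact (withDensity_absolutelyContinuous _ _) (Real.volume_singleton)

lemma expMeasure_one_Iic_zero : expMeasure 1 (Set.Iic 0) = 0 := by
  have := isProbabilityMeasure_expMeasure one_pos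
  rw [← ofReal_cdf, cdf_expMeasure_eq one_pos]
  simp

section Subordinator

variable {Ω : Type*} {L : ℝ≥0 → Ω → ℝ}

/-! ### The past of a process -/

/-- The `σ`-algebra generated by the process up to time `t`. -/
@[reducible]
def past (L : ℝ≥0 → Ω → ℝ) (t : ℝ≥0) : MeasurableSpace Ω :=
  MeasurableSpace.comap (fun ω (r : Set.Iic t) => L r ω) inferInstance

lemma measurable_past {r t : ℝ≥0} (h : r ≤ t) : Measurable[past L t] (L r) :=
  (measurable_pi_apply (⟨r, h⟩ : Set.Iic t)).comp
    (comap_measurable fun ω (r : Set.Iic t) => L r ω)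

lemma past_mono {s t : ℝ≥0} (h : s ≤ t) : past L s ≤ past L t := by
  have hm : Measurable[past L t] fun ω (r : Set.Iic s) => L r ω :=
    @measurable_pi_lambda _ _ _ (past L t) _ _ fun r => measurable_past (r.2.trans h)
  exact hm.comap_le

variable [MeasurableSpace Ω] {μ : Measure Ω}

lemma past_le (hL : ∀ t, Measurable (L t)) (t : ℝ≥0) : past L t ≤ ‹MeasurableSpace Ω› := by
  exact (measurable_pi_lambda _ fun r : Set.Iic t => hL r).comap_le

namespace IsSubordinator

/-- Independence of increments concerns finite increasing sequences of times. Independence from the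
whole past reduces to finitely many past times, and at those `L` is a partial sum of increments
because L_0 = 0 almost surely. -/
lemma indepFun_past [IsProbabilityMeasure μ] (hL : IsSubordinator μ L) (t u : ℝ≥0) :
    IndepFun (fun ω (r : Set.Iic t) => L r ω) (fun ω => L (t + u) ω - L t ω) μ := by
  refine IndepFun.process_indepFun (fun r => hL.measurable r)
    ((hL.measurable _).sub (hL.measurable _)) fun I => ?_
  classical
  let F : Finset ℝ≥0 := I.image Subtype.val
  -- The times are 0, then the chosen past times in increasing order, then t, then t + u forever.
  -- The increments of index at most `F.card` lie before t, and the one of index `F.card + 1` is L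
  -- (t + u) - L t.
  let τ : ℕ → ℝ≥0
    | 0 => 0
    | l + 1 => if h : l < F.card then F.orderEmbOfFin rfl ⟨l, h⟩ else
        if l = F.card then t else t + u
  have hFt : ∀ x ∈ F, x ≤ t := by
    intro x hx
    obtain ⟨y, -, rfl⟩ := Finset.mem_image.1 hx
    exact y.2
  have hτ : Monotone τ := by
    refine monotone_nat_of_le_succ fun l => ?_
    rcases l with _ | l
    · exact zero_le
    · simp only [τ]
      split_ifs with h1 h2 h3 h4 h5 h6 h7
      · exact (F.orderEmbOfFin rfl).monotone (by simp)
      · exact hFt _ (Finset.orderEmbOfFin_mem _ _ _)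
      · exact (hFt _ (Finset.orderEmbOfFin_mem _ _ _)).trans le_self_add
      all_goals first | omega | exact le_self_add | exact le_rfl
  have hind := hL.indep.nat hτ
  have hpair := hind.indepFun_finset (Finset.range (F.card + 1)) {F.card + 1} (by simp)
    (fun i => (hL.measurable _).sub (hL.measurable _))
  have hval : ∀ (l : ℕ), l ≤ F.card → ∀ᵐ ω ∂μ, L (τ (l + 1)) ω =
      ∑ k ∈ Finset.range (l + 1), (L (τ (k + 1)) ω - L (τ k) ω) := by
    intro l _
    filter_upwards [hL.zero] with ω hω
    rw [Finset.sum_range_sub (fun k => L (τ k) ω)]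
    simp [τ, hω]
  have hidx : ∀ r : I, ∃ l, l < F.card ∧ τ (l + 1) = r.1.1 := by
    intro r
    have hr : r.1.1 ∈ F := Finset.mem_image_of_mem _ r.2
    have : r.1.1 ∈ Set.range (F.orderEmbOfFin rfl) := by
      rw [Finset.range_orderEmbOfFin]; exact hr
    obtain ⟨i, hi⟩ := this
    exact ⟨i, i.2, by simp [τ, hi]⟩
  choose l hl hlr using hidx
  have hlast : Measurable fun y : ({F.card + 1} : Finset ℕ) → ℝ => y ⟨F.card + 1, by simp⟩ :=
    measurable_pi_apply _
  have hc := hpair.comp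
    (φ := fun (x : Finset.range (F.card + 1) → ℝ) (r : I) =>
      ∑ k : Finset.range (F.card + 1), if k.1 ≤ l r then x k else 0)
    (ψ := fun (y : ({F.card + 1} : Finset ℕ) → ℝ) => y ⟨F.card + 1, by simp⟩)
    (measurable_pi_iff.2 fun r => Finset.measurable_sum _ fun k _ => by
      split_ifs
      · exact measurable_pi_apply k
      · exact measurable_const)
    hlast
  refine hc.congr ?_ ?_
  · have : ∀ r : I, ∀ᵐ ω ∂μ, L (τ (l r + 1)) ω =
      ∑ k ∈ Finset.range (l r + 1), (L (τ (k + 1)) ω - L (τ k) ω) := fun r => hval _ (hl r).le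
    filter_upwards [ae_all_iff.2 this] with ω hω
    funext r
    simp only [Function.comp]
    rw [← hlr r, hω r, Finset.sum_coe_sort (Finset.range (F.card + 1))
      (fun k => if k ≤ l r then L (τ (k + 1)) ω - L (τ k) ω else 0), ← Finset.sum_filter]
    refine Finset.sum_congr ?_ fun _ _ => rfl
    ext k
    have := hl r
    simp only [Finset.mem_filter, Finset.mem_range]
    omega
  · refine Eventually.of_forall fun ω => ?_
    simp [τ]

/-- The Markov property in integrated form: the increment after t is independent of the past and has
the law of L_u. -/
lemma lintegral_past_mul [IsProbabilityMeasure μ] (hL : IsSubordinator μ L) {t u : ℝ≥0}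
    {H : Ω → ℝ≥0∞} (hH : Measurable[past L t] H) {g : ℝ → ℝ≥0∞} (hg : Measurable g) :
    ∫⁻ ω, H ω * g (L (t + u) ω - L t ω) ∂μ = (∫⁻ ω, H ω ∂μ) * ∫⁻ ω, g (L u ω) ∂μ := by
  have hΔ : Measurable fun ω => L (t + u) ω - L t ω := (hL.measurable _).sub (hL.measurable _)
  refine (lintegral_mul_eq_lintegral_mul_lintegral_of_independent_measurableSpace
    (past_le hL.measurable t) hΔ.comap_le (hL.indepFun_past t u) hH
    (hg.comp (comap_measurable fun ω => L (t + u) ω - L t ω))).trans ?_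
  congr 1
  exact ((hL.stationary t u).comp hg).lintegral_eq

/-! ### The Laplace exponent -/

lemma ae_nonneg (hL : IsSubordinator μ L) : ∀ᵐ ω ∂μ, ∀ t, 0 ≤ L t ω := by
  filter_upwards [hL.zero, hL.monotone] with ω h0 hm t
  rw [← h0]; exact hm zero_le

variable [IsProbabilityMeasure μ]

lemma integrable_exp (hL : IsSubordinator μ L) (k : ℕ) (t : ℝ≥0) :
    Integrable (fun ω => Real.exp (-(k : ℝ) * L t ω)) μ := by
  refine Integrable.of_bound
    ((hL.measurable t).const_mul _).exp.aestronglyMeasurable 1 ?_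
  filter_upwards [hL.ae_nonneg] with ω hω
  rw [Real.norm_eq_abs, abs_of_pos (Real.exp_pos _), Real.exp_le_one_iff]
  have := mul_nonneg (Nat.cast_nonneg' (α := ℝ) k) (hω t)
  linarith

lemma lintegral_exp_eq_integral (hL : IsSubordinator μ L) (k : ℕ) (t : ℝ≥0) :
    ∫⁻ ω, ENNReal.ofReal (Real.exp (-(k : ℝ) * L t ω)) ∂μ =
      ENNReal.ofReal (∫ ω, Real.exp (-(k : ℝ) * L t ω) ∂μ) :=
  (ofReal_integral_eq_lintegral_ofReal (hL.integrable_exp k t)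
    (Eventually.of_forall fun _ => (Real.exp_pos _).le)).symm

/-- The Laplace transform is multiplicative and nonincreasing in t, hence exponential in t; its rate
is read off at t = 1, where it is Ψ(k) by definition. -/
lemma integral_exp (hL : IsSubordinator μ L) (k : ℕ) (t : ℝ≥0) :
    ∫ ω, Real.exp (-(k : ℝ) * L t ω) ∂μ = Real.exp (-(t * laplaceExponent μ L k)) := by
  set f : ℝ≥0 → ℝ := fun t => ∫ ω, Real.exp (-(k : ℝ) * L t ω) ∂μ with hf
  have hpos : ∀ t, 0 < f t := fun t => integral_exp_pos (hL.integrable_exp k t)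
  have hanti : Antitone f := by
    intro s t hst
    refine integral_mono_ae (hL.integrable_exp k t) (hL.integrable_exp k s) ?_
    filter_upwards [hL.monotone] with ω hω
    refine Real.exp_le_exp.2 ?_
    have := mul_le_mul_of_nonneg_left (hω hst) (Nat.cast_nonneg' (α := ℝ) k)
    simp only at this
    linarith
  have hadd : ∀ s t, f (s + t) = f s * f t := by
    intro s t
    have h := hL.lintegral_past_mul (t := s) (u := t)
      (H := fun ω => ENNReal.ofReal (Real.exp (-(k : ℝ) * L s ω)))
      ((measurable_past le_rfl).const_mul _).exp.ennreal_ofReal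
      (g := fun x => ENNReal.ofReal (Real.exp (-(k : ℝ) * x))) (by fun_prop)
    rw [hL.lintegral_exp_eq_integral, hL.lintegral_exp_eq_integral] at h
    have h2 : ∀ ω, ENNReal.ofReal (Real.exp (-(k : ℝ) * L s ω)) *
        ENNReal.ofReal (Real.exp (-(k : ℝ) * (L (s + t) ω - L s ω))) =
        ENNReal.ofReal (Real.exp (-(k : ℝ) * L (s + t) ω)) := fun ω => by
      rw [← ENNReal.ofReal_mul (Real.exp_pos _).le, ← Real.exp_add]; ring_nf
    simp only [h2] at h
    rw [hL.lintegral_exp_eq_integral, ← ENNReal.ofReal_mul (hpos s).le,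
      ENNReal.ofReal_eq_ofReal_iff (hpos _).le (mul_pos (hpos s) (hpos t)).le] at h
    exact h
  have := eq_exp_mul_log_of_antitone_of_map_add hpos hadd hanti t
  rw [hf] at this
  simp only at this
  rw [this, laplaceExponent]
  ring_nf

lemma lintegral_exp (hL : IsSubordinator μ L) (k : ℕ) (t : ℝ≥0) :
    ∫⁻ ω, ENNReal.ofReal (Real.exp (-(k : ℝ) * L t ω)) ∂μ =
      ENNReal.ofReal (Real.exp (-(t * laplaceExponent μ L k))) := by
  rw [hL.lintegral_exp_eq_integral, hL.integral_exp]

end IsSubordinator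
end Subordinator

/-! ### Joint Laplace transforms of the subordinator and the shock exponent -/

/-- The exponent `∑_V λ_{|V|} max_{a ∈ V} s a` of the joint survival function. -/
def shockExponent {ι : Type*} (Ψ : ℝ → ℝ) (D : Finset ι) (s : ι → ℝ≥0) : ℝ :=
  ∑ V ∈ D.powerset, lam Ψ D.card V.card * (V.sup s : ℝ≥0)

lemma sum_powerset_lam {ι : Type*} (Ψ : ℝ → ℝ) {X : Finset ι} {m : ℕ} (h : X.card ≤ m) :
    ∑ V ∈ X.powerset, lam Ψ m V.card = Ψ (m : ℝ) - Ψ ((m - X.card : ℕ) : ℝ) := by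
  rw [Finset.sum_powerset_apply_card (fun v => lam Ψ m v), ← sum_choose_mul_lam Ψ h]
  simp only [nsmul_eq_mul]

/-- Lowering every positive argument by u lowers the maximum over V by exactly u if V meets the set
S of positive arguments, and leaves it at 0 otherwise. The total rate of the sets V that meet S is
Ψ(|D|) - (Ψ(|D|) - Ψ(|S|)) = Ψ(|S|). -/
lemma shockExponent_eq_add {ι : Type*} (Ψ : ℝ → ℝ) (h0 : Ψ 0 = 0) (D : Finset ι) (s : ι → ℝ≥0)
    (u : ℝ≥0) (hu : ∀ a ∈ D, 0 < s a → u ≤ s a) :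
    shockExponent Ψ D s = u * Ψ ((D.filter fun a => 0 < s a).card : ℝ) +
      shockExponent Ψ D (fun a => s a - u) := by
  classical
  set S := D.filter fun a => 0 < s a with hS
  have hsup : ∀ V ∈ D.powerset, ((V.sup s : ℝ≥0) : ℝ) =
      (u - if V ∈ (D \ S).powerset then (u : ℝ) else 0) + (V.sup fun a => s a - u : ℝ≥0) := by
    intro V hV
    rw [Finset.mem_powerset] at hV
    split_ifs with hVS
    · rw [Finset.mem_powerset] at hVS
      have hz : ∀ a ∈ V, s a = 0 := fun a ha => by
        have := hVS ha
        rw [hS, Finset.mem_sdiff, Finset.mem_filter] at this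
        by_contra h
        exact this.2 ⟨this.1, pos_iff_ne_zero.2 h⟩
      rw [(Finset.sup_eq_bot_iff s V).2 hz, (Finset.sup_eq_bot_iff _ V).2 fun a ha => by
        simp [hz a ha]]
      simp
    · have hex : ∃ a ∈ V, 0 < s a := by
        by_contra h
        push Not at h
        refine hVS (Finset.mem_powerset.2 fun a ha => ?_)
        rw [hS, Finset.mem_sdiff, Finset.mem_filter]
        exact ⟨hV ha, fun h' => absurd h'.2 (h a ha).not_gt⟩
      obtain ⟨a, ha, has⟩ := hex
      have hle : u ≤ V.sup s := (hu a (hV ha) has).trans (Finset.le_sup ha)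
      have : (V.sup fun a => s a - u) = V.sup s - u := by
        refine le_antisymm (Finset.sup_le fun b hb => tsub_le_tsub_right (Finset.le_sup hb) u) ?_
        obtain ⟨b, hb, hbs⟩ := Finset.exists_mem_eq_sup V ⟨a, ha⟩ s
        rw [hbs]
        exact Finset.le_sup (f := fun a => s a - u) hb
      rw [this, NNReal.coe_sub hle]
      ring
  unfold shockExponent
  rw [Finset.sum_congr rfl fun V hV => by rw [hsup V hV]]
  simp only [mul_add, mul_sub, Finset.sum_add_distrib, Finset.sum_sub_distrib, ← Finset.sum_mul]
  congr 1
  have hfil : D.powerset.filter (· ∈ (D \ S).powerset) = (D \ S).powerset := by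
    ext V
    simp only [Finset.mem_filter, Finset.mem_powerset, and_iff_right_iff_imp]
    exact fun h => h.trans Finset.sdiff_subset
  simp only [mul_ite, mul_zero]
  rw [← Finset.sum_filter, hfil, ← Finset.sum_mul, sum_powerset_lam Ψ le_rfl,
    sum_powerset_lam Ψ (Finset.card_le_card Finset.sdiff_subset)]
  have hSD : S ⊆ D := Finset.filter_subset _ _
  have hc : D.card - (D \ S).card = S.card := by
    rw [Finset.card_sdiff_of_subset hSD]
    have := Finset.card_le_card hSD
    omega
  rw [hc]
  simp only [Nat.sub_self, Nat.cast_zero, h0]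
  ring

lemma shockExponent_eq_zero {ι : Type*} (Ψ : ℝ → ℝ) (D : Finset ι) (s : ι → ℝ≥0)
    (h : ∀ a ∈ D, s a = 0) : shockExponent Ψ D s = 0 := by
  refine Finset.sum_eq_zero fun V hV => ?_
  rw [(Finset.sup_eq_bot_iff s V).2 fun a ha => h a (Finset.mem_powerset.1 hV ha)]
  simp

lemma laplaceExponent_zero {Ω : Type*} [MeasurableSpace Ω] (μ : Measure Ω) [IsProbabilityMeasure μ]
    (L : ℝ≥0 → Ω → ℝ) : laplaceExponent μ L 0 = 0 := by
  simp [laplaceExponent]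

section

variable {Ω : Type*} [MeasurableSpace Ω] {μ : Measure Ω} [IsProbabilityMeasure μ]
  {L : ℝ≥0 → Ω → ℝ}

namespace IsSubordinator

/-- Induction on the number of positive s a. Up to t + u, with u the least positive one, all
positive arguments share the same increment; its power |S| has mean exp(-uΨ(|S|)), and the shock
exponent drops by the same amount. -/
lemma lintegral_past_mul_prod_exp {ι : Type*} (hL : IsSubordinator μ L) (D : Finset ι)
    (s : ι → ℝ≥0) {t : ℝ≥0} {H : Ω → ℝ≥0∞} (hH : Measurable[past L t] H) :
    ∫⁻ ω, H ω * ∏ a ∈ D, ENNReal.ofReal (Real.exp (-(L (t + s a) ω - L t ω))) ∂μ =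
      (∫⁻ ω, H ω ∂μ) *
        ENNReal.ofReal (Real.exp (-shockExponent (laplaceExponent μ L) D s)) := by
  classical
  induction hN : (D.filter fun a => 0 < s a).card using Nat.strong_induction_on
    generalizing s t H with
  | _ N ih =>
  set S := D.filter fun a => 0 < s a with hS
  rcases S.eq_empty_or_nonempty with hE | hne
  · have hz : ∀ a ∈ D, s a = 0 := fun a ha => by
      by_contra h
      have : a ∈ S := Finset.mem_filter.2 ⟨ha, pos_iff_ne_zero.2 h⟩
      simp [hE] at this
    rw [shockExponent_eq_zero _ _ _ hz]
    simp only [neg_zero, Real.exp_zero, ENNReal.ofReal_one, mul_one]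
    refine lintegral_congr fun ω => ?_
    rw [Finset.prod_eq_one fun a ha => by rw [hz a ha]; simp, mul_one]
  · obtain ⟨b, hb, hmin⟩ := Finset.exists_min_image S s hne
    set u := s b with hu
    have hu0 : 0 < u := (Finset.mem_filter.1 hb).2
    have hle : ∀ a ∈ D, 0 < s a → u ≤ s a := fun a ha h0 =>
      hmin a (Finset.mem_filter.2 ⟨ha, h0⟩)
    rw [shockExponent_eq_add _ (laplaceExponent_zero μ L) D s u hle]
    set G : ℝ → ℝ≥0∞ := fun x => ENNReal.ofReal (Real.exp (-(S.card : ℝ) * x)) with hG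
    have hGm : Measurable G := by fun_prop
    -- The factor coming from (t, t + u] is absorbed into the functional of the past; this is why
    -- `H` and `t` vary in the induction.
    have hH' : Measurable[past L (t + u)] fun ω => H ω * G (L (t + u) ω - L t ω) :=
      (hH.mono (past_mono le_self_add) le_rfl).mul
        (hGm.comp ((measurable_past le_rfl).sub (measurable_past le_self_add)))
    have hcard : (D.filter fun a => 0 < s a - u).card < N := by
      rw [← hN]
      refine Finset.card_lt_card (Finset.ssubset_iff_subset_ne.2 ⟨fun a ha => ?_, fun h => ?_⟩)
      · rw [Finset.mem_filter] at ha ⊢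
        exact ⟨ha.1, ha.2.trans_le tsub_le_self⟩
      · have : b ∈ D.filter fun a => 0 < s a - u := h ▸ hb
        simp [hu] at this
    have hrec := ih _ hcard (fun a => s a - u) hH' rfl
    rw [hL.lintegral_past_mul hH hGm, hG, hL.lintegral_exp] at hrec
    rw [neg_add, Real.exp_add, ENNReal.ofReal_mul (Real.exp_pos _).le, ← mul_assoc, ← hrec]
    refine lintegral_congr fun ω => ?_
    rw [mul_assoc]
    congr 1
    have hfac : ∀ a ∈ D, ENNReal.ofReal (Real.exp (-(L (t + s a) ω - L t ω))) =
        (if 0 < s a then ENNReal.ofReal (Real.exp (-(L (t + u) ω - L t ω))) else 1) *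
          ENNReal.ofReal (Real.exp (-(L (t + u + (s a - u)) ω - L (t + u) ω))) := by
      intro a ha
      split_ifs with h
      · rw [add_assoc, add_tsub_cancel_of_le (hle a ha h), ← ENNReal.ofReal_mul (Real.exp_pos _).le,
          ← Real.exp_add]
        ring_nf
      · rw [not_lt.1 h |>.antisymm zero_le]
        simp
    rw [Finset.prod_congr rfl hfac, Finset.prod_mul_distrib, ← Finset.prod_filter,
      Finset.prod_const, ← ENNReal.ofReal_pow (Real.exp_pos _).le, ← Real.exp_nat_mul]
    simp only [hS, mul_neg, neg_mul]

/-! ### Transition probabilities as binomial mixtures, and signs of the rates -/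

lemma integral_pow_mul_exp (hL : IsSubordinator μ L) (v k : ℕ) (t : ℝ≥0) :
    ∫ ω, (1 - Real.exp (-L t ω)) ^ v * Real.exp (-L t ω) ^ k ∂μ =
      altDiff (fun m => Real.exp (-((t : ℝ) * laplaceExponent μ L m))) v k := by
  have h : ∀ ω, (1 - Real.exp (-L t ω)) ^ v * Real.exp (-L t ω) ^ k =
      ∑ a ∈ Finset.range (v + 1), (-1 : ℝ) ^ a * (v.choose a : ℝ) *
        Real.exp (-((k + a : ℕ) : ℝ) * L t ω) := fun ω => by
    rw [← altDiff_pow, altDiff]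
    refine Finset.sum_congr rfl fun a _ => ?_
    rw [← Real.exp_nat_mul, mul_neg, neg_mul]
  simp_rw [h]
  rw [integral_finsetSum _ fun a _ => (hL.integrable_exp _ _).const_mul _]
  refine Finset.sum_congr rfl fun a _ => ?_
  rw [integral_const_mul, hL.integral_exp]

lemma integrable_pow_mul_exp (hL : IsSubordinator μ L) (v k : ℕ) (t : ℝ≥0) :
    Integrable (fun ω => (1 - Real.exp (-L t ω)) ^ v * Real.exp (-L t ω) ^ k) μ := by
  have hm : Measurable fun ω => Real.exp (-L t ω) := (hL.measurable t).neg.exp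
  refine Integrable.of_bound
    (((measurable_const.sub hm).pow_const v).mul (hm.pow_const k)).aestronglyMeasurable 1 ?_
  filter_upwards [hL.ae_nonneg] with ω hω
  have h1 : Real.exp (-L t ω) ≤ 1 := Real.exp_le_one_iff.2 (by linarith [hω t])
  have h0 := Real.exp_pos (-L t ω)
  rw [norm_mul, norm_pow, norm_pow]
  refine mul_le_one₀ (pow_le_one₀ (norm_nonneg _) ?_) (by positivity)
    (pow_le_one₀ (norm_nonneg _) ?_) <;> rw [Real.norm_eq_abs, abs_le] <;> constructor <;> linarith

/-- Given L_t, each of the n - i working components fails independently with probability 1 -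
e^{-L_t}. In this form positivity and unit row sums are visible, which the signed sum hides. -/
lemma semigroup_apply (hL : IsSubordinator μ L) (n : ℕ) (t : ℝ≥0) (i j : Fin (n + 1)) :
    semigroup (laplaceExponent μ L) n t i j =
      if i ≤ j then ((n - i : ℕ).choose (j - i) : ℝ) *
        ∫ ω, (1 - Real.exp (-L t ω)) ^ ((j : ℕ) - i) * Real.exp (-L t ω) ^ (n - (j : ℕ)) ∂μ
      else 0 := by
  rw [semigroup, binomConj_apply, hL.integral_pow_mul_exp]

lemma semigroup_nonneg (hL : IsSubordinator μ L) (n : ℕ) (t : ℝ≥0) (i j : Fin (n + 1)) :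
    0 ≤ semigroup (laplaceExponent μ L) n t i j := by
  rw [hL.semigroup_apply]
  split_ifs
  · refine mul_nonneg (Nat.cast_nonneg _) (integral_nonneg_of_ae ?_)
    filter_upwards [hL.ae_nonneg] with ω hω
    have h1 : Real.exp (-L t ω) ≤ 1 := Real.exp_le_one_iff.2 (by linarith [hω t])
    exact mul_nonneg (pow_nonneg (by linarith) _) (pow_nonneg (Real.exp_pos _).le _)
  · exact le_rfl

lemma semigroup_row_sum (hL : IsSubordinator μ L) (n : ℕ) (t : ℝ≥0) (i : Fin (n + 1)) :
    ∑ j, semigroup (laplaceExponent μ L) n t i j = 1 := by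
  set x : Ω → ℝ := fun ω => Real.exp (-L t ω)
  have hi : (i : ℕ) ≤ n := by omega
  have h1 : ∀ j : Fin (n + 1), semigroup (laplaceExponent μ L) n t i j =
      if (i : ℕ) ≤ j then ∫ ω, ((n - i : ℕ).choose (j - i) : ℝ) *
        ((1 - x ω) ^ ((j : ℕ) - i) * x ω ^ (n - (j : ℕ))) ∂μ else 0 := fun j => by
    rw [hL.semigroup_apply, integral_const_mul]; rfl
  simp_rw [h1]
  rw [Fin.sum_univ_eq_sum_range (fun j => if (i : ℕ) ≤ j then
    ∫ ω, ((n - i : ℕ).choose (j - i) : ℝ) * ((1 - x ω) ^ (j - i) * x ω ^ (n - j)) ∂μ else 0) (n + 1),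
    ← Finset.sum_range_add_sum_Ico _ (show (i : ℕ) ≤ n + 1 by omega), Finset.sum_eq_zero, zero_add,
    Finset.sum_Ico_eq_sum_range, show n + 1 - i = n - i + 1 by omega]
  · simp only [le_add_iff_nonneg_right, zero_le, if_true, Nat.add_sub_cancel_left]
    rw [← integral_finsetSum]
    · have : ∀ ω, ∑ v ∈ Finset.range (n - i + 1), ((n - i : ℕ).choose v : ℝ) *
          ((1 - x ω) ^ v * x ω ^ (n - (i + v))) = 1 := fun ω => by
        have := add_pow (1 - x ω) (x ω) (n - i)
        rw [sub_add_cancel, one_pow] at this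
        refine Eq.trans (Finset.sum_congr rfl fun v hv => ?_) this.symm
        rw [Nat.sub_sub]; ring
      simp_rw [this]
      simp
    · exact fun v _ => (hL.integrable_pow_mul_exp _ _ t).const_mul _
  · intro j hj
    have hj := Finset.mem_range.1 hj
    rw [if_neg (by omega)]

/-- In a system of l components, C(l,v) λ^{(l)}_v is the derivative at time 0 of the probability of
moving from 0 to v failures. That probability is nonnegative and vanishes at time 0. -/
lemma lam_nonneg (hL : IsSubordinator μ L) {l v : ℕ} (hv : 1 ≤ v) (hvl : v ≤ l) :
    0 ≤ lam (laplaceExponent μ L) l v := by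
  have h := semigroup_hasDerivAt (laplaceExponent μ L) (laplaceExponent_zero μ L) l 0
    ⟨v, by omega⟩
  have hne : (0 : Fin (l + 1)) ≠ ⟨v, by omega⟩ := by
    intro h
    have := congrArg Fin.val h
    simp at this
    omega
  rw [generator, if_neg hne, rate, if_pos ⟨by simpa using Nat.pos_of_ne_zero (by omega), by simpa using hvl⟩] at h
  have h0 := ge_of_tendsto' h fun t => div_nonneg
    (by rw [Matrix.one_apply_ne hne, sub_zero]; exact hL.semigroup_nonneg l t _ _) t.2
  have hc : (0 : ℝ) < (l.choose v : ℝ) := by exact_mod_cast Nat.choose_pos hvl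
  exact nonneg_of_mul_nonneg_right (by simpa using h0) hc

/-- If E[e^{-kL_1}] were at least 1, the nonnegative variable 1 - e^{-kL_1} would have mean zero,
forcing L_1 = 0 almost surely. -/
lemma laplaceExponent_pos (hL : IsSubordinator μ L) (hnt : ¬ ∀ᵐ ω ∂μ, L 1 ω = 0) {k : ℕ}
    (hk : 1 ≤ k) : 0 < laplaceExponent μ L k := by
  have hk' : (0 : ℝ) < k := by exact_mod_cast hk
  have h1 : ∫ ω, Real.exp (-(k : ℝ) * L 1 ω) ∂μ < 1 := by
    by_contra hge
    push Not at hge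
    refine hnt ?_
    have hint := (integrable_const (μ := μ) (1 : ℝ)).sub (hL.integrable_exp k 1)
    have hnn : 0 ≤ᵐ[μ] fun ω => (1 : ℝ) - Real.exp (-(k : ℝ) * L 1 ω) := by
      filter_upwards [hL.ae_nonneg] with ω hω
      have := mul_nonneg hk'.le (hω 1)
      simp only [Pi.zero_apply, sub_nonneg, Real.exp_le_one_iff]
      linarith
    have h0 : ∫ ω, ((1 : ℝ) - Real.exp (-(k : ℝ) * L 1 ω)) ∂μ = 0 := by
      refine le_antisymm ?_ (integral_nonneg_of_ae hnn)
      rw [integral_sub (integrable_const _) (hL.integrable_exp k 1)]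
      simpa using hge
    have := (integral_eq_zero_iff_of_nonneg_ae hnn hint).1 h0
    filter_upwards [this] with ω hω
    simp only [Pi.zero_apply, sub_eq_zero] at hω
    have := (Real.exp_eq_one_iff _).1 hω.symm
    rcases mul_eq_zero.1 this with h | h
    · linarith
    · exact h
  rw [laplaceExponent, neg_pos]
  exact Real.log_neg (integral_exp_pos (hL.integrable_exp k 1)) h1

end IsSubordinator

end

lemma notMem_failedSet {Ω : Type*} {L : ℝ≥0 → Ω → ℝ} {n : ℕ} {ε : Fin n → Ω → ℝ} {t : ℝ≥0} {i : Fin n} {ω : Ω} :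
    i ∉ failedSet L ε t ω ↔ L t ω < ε i ω := by
  simp [failedSet]

lemma mem_failedSet {Ω : Type*} {L : ℝ≥0 → Ω → ℝ} {n : ℕ} {ε : Fin n → Ω → ℝ} {t : ℝ≥0} {i : Fin n} {ω : Ω} :
    i ∈ failedSet L ε t ω ↔ ε i ω ≤ L t ω := by
  simp [failedSet]

section

variable {Ω : Type*} [MeasurableSpace Ω] {μ : Measure Ω} [IsProbabilityMeasure μ]
  {L : ℝ≥0 → Ω → ℝ} {n : ℕ} {ε : Fin n → Ω → ℝ}

/-! ### Measurability -/

lemma measurableSet_mem_failedSet (hL : ∀ t, Measurable (L t)) (hε : ∀ i, Measurable (ε i))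
    (t : ℝ≥0) (i : Fin n) : MeasurableSet {ω | i ∈ failedSet L ε t ω} := by
  simp only [failedSet, Finset.mem_filter, Finset.mem_univ, true_and]
  exact measurableSet_le (hε i) (hL t)

lemma measurableSet_failedSet_eq (hL : ∀ t, Measurable (L t)) (hε : ∀ i, Measurable (ε i))
    (t : ℝ≥0) (A : Finset (Fin n)) : MeasurableSet {ω | failedSet L ε t ω = A} := by
  have : {ω | failedSet L ε t ω = A} = ⋂ i, {ω | i ∈ failedSet L ε t ω ↔ i ∈ A} := by
    ext ω; simp [Finset.ext_iff]
  rw [this]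
  refine MeasurableSet.iInter fun i => ?_
  by_cases h : i ∈ A
  · simp only [h, iff_true]
    exact measurableSet_mem_failedSet hL hε t i
  · simp only [h, iff_false]
    exact (measurableSet_mem_failedSet hL hε t i).compl

/-- A probability of an event determined by a variable with finitely many values. -/
lemma measureReal_setOf_comp {Ω : Type*} [MeasurableSpace Ω] {μ : Measure Ω} [IsFiniteMeasure μ]
    {κ : Type*} [Fintype κ] (X : Ω → κ)
    (hX : ∀ c, MeasurableSet {ω | X ω = c}) (P : κ → Prop) [DecidablePred P] :
    μ.real {ω | P (X ω)} = ∑ c, if P c then μ.real {ω | X ω = c} else 0 := by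
  rw [← Finset.sum_filter, ← measureReal_biUnion_finset]
  · congr 1
    ext ω
    simp
  · intro a _ b _ hab
    refine Set.disjoint_left.2 fun ω h1 h2 => hab ?_
    rw [← h1, ← h2]
  · exact fun c _ => hX c

lemma measurableSet_setOf_comp {κ : Type*} [Finite κ] (X : Ω → κ)
    (hX : ∀ c, MeasurableSet {ω | X ω = c}) (P : κ → Prop) : MeasurableSet {ω | P (X ω)} := by
  have : {ω | P (X ω)} = ⋃ c ∈ {c | P c}, {ω | X ω = c} := by ext; simp
  rw [this]
  exact MeasurableSet.biUnion (Set.to_countable _) fun c _ => hX c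

lemma measurableSet_failures_eq (hL : ∀ t, Measurable (L t)) (hε : ∀ i, Measurable (ε i))
    (t : ℝ≥0) (j : Fin (n + 1)) : MeasurableSet {ω | failures L ε t ω = j} := by
  have := measurableSet_setOf_comp (failedSet L ε t) (measurableSet_failedSet_eq hL hε t)
    (fun A => A.card = j)
  simpa [failures, Fin.ext_iff] using this

namespace IsModel

/-- Fubini: integrate out the independent triggers with the path of `L` fixed. The prescribed sets
may depend on the whole path. -/
lemma lintegral_trigger (hM : IsModel μ L ε) (I : Fin n → (ℝ≥0 → ℝ) → Set ℝ)
    (hI : ∀ a, MeasurableSet {p : (ℝ≥0 → ℝ) × ℝ | p.2 ∈ I a p.1}) :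
    μ {ω | ∀ a, ε a ω ∈ I a fun t => L t ω} =
      ∫⁻ ω, ∏ a, expMeasure 1 (I a fun t => L t ω) ∂μ := by
  have := isProbabilityMeasure_expMeasure one_pos
  have hp : Measurable fun ω t => L t ω := measurable_pi_lambda _ hM.subordinator.measurable
  have he : Measurable fun ω i => ε i ω := measurable_pi_lambda _ hM.trigger_measurable
  have hS : MeasurableSet {p : (ℝ≥0 → ℝ) × (Fin n → ℝ) | ∀ a, p.2 a ∈ I a p.1} := by
    simp only [Set.ofPred_forall]
    refine MeasurableSet.iInter fun a => ?_
    have : Measurable fun p : (ℝ≥0 → ℝ) × (Fin n → ℝ) => (p.1, p.2 a) := by fun_prop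
    exact this (hI a)
  have hlaw : μ.map (fun ω i => ε i ω) = Measure.pi fun _ => expMeasure 1 := by
    rw [(iIndepFun_iff_map_fun_eq_pi_map fun i => (hM.trigger_measurable i).aemeasurable).1
      hM.trigger_indep]
    congr 1
    funext i
    exact (hM.trigger_law i).map_eq
  have hprod := (indepFun_iff_map_prod_eq_prod_map_map hp.aemeasurable he.aemeasurable).1 hM.indep
  calc μ {ω | ∀ a, ε a ω ∈ I a fun t => L t ω}
      = (μ.map fun ω => ((fun t => L t ω), (fun i => ε i ω)))
          {p : (ℝ≥0 → ℝ) × (Fin n → ℝ) | ∀ a, p.2 a ∈ I a p.1} := by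
        rw [Measure.map_apply (hp.prodMk he) hS]; rfl
    _ = _ := by
        have := Measure.isProbabilityMeasure_map (μ := μ) hp.aemeasurable
        rw [hprod, hlaw, Measure.prod_apply hS, lintegral_map (measurable_measure_prodMk_left hS) hp]
        refine lintegral_congr fun ω => ?_
        rw [← Measure.pi_pi]
        congr 1
        ext y
        simp

lemma measure_trigger_mem (hM : IsModel μ L ε) (i : Fin n) (I : (ℝ≥0 → ℝ) → Set ℝ)
    (hI : MeasurableSet {p : (ℝ≥0 → ℝ) × ℝ | p.2 ∈ I p.1}) :
    μ {ω | ε i ω ∈ I fun t => L t ω} = ∫⁻ ω, expMeasure 1 (I fun t => L t ω) ∂μ := by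
  have := isProbabilityMeasure_expMeasure one_pos
  have h := hM.lintegral_trigger (fun a p => if a = i then I p else Set.univ) fun a => by
    by_cases h : a = i
    · simpa [h] using hI
    · simp [h]
  refine Eq.trans (congrArg μ ?_) (h.trans (lintegral_congr fun ω => ?_))
  · ext ω
    constructor
    · intro hω a
      by_cases ha : a = i
      · subst ha; simpa using hω
      · simp [ha]
    · intro hω; simpa using hω i
  · rw [Finset.prod_eq_single i]
    · simp
    · intro b _ hb; simp [hb]
    · simp

lemma ae_pos_trigger (hM : IsModel μ L ε) : ∀ᵐ ω ∂μ, ∀ i, 0 < ε i ω := by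
  refine ae_all_iff.2 fun i => ?_
  have h := hM.measure_trigger_mem i (fun _ => Set.Iic 0)
    (measurableSet_Iic.preimage measurable_snd)
  simp only [expMeasure_one_Iic_zero, lintegral_zero] at h
  rw [ae_iff]
  simpa using h

lemma ae_ne_trigger (hM : IsModel μ L ε) (i : Fin n) (t : ℝ≥0) : ∀ᵐ ω ∂μ, ε i ω ≠ L t ω := by
  have h := hM.measure_trigger_mem i (fun p => {p t})
    (measurableSet_eq_fun measurable_snd ((measurable_pi_apply t).comp measurable_fst))
  simp only [expMeasure_one_singleton, lintegral_zero] at h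
  rw [ae_iff]
  simpa using h

/-- A trigger is not exceeded by time k with probability e^{-kΨ(1)}, which tends to 0 because Ψ(1) >
0. This makes all lifetimes finite. -/
lemma ae_exists_trigger_lt (hM : IsModel μ L ε) (i : Fin n) :
    ∀ᵐ ω ∂μ, ∃ k : ℕ, ε i ω < L k ω := by
  have hle : ∀ k : ℕ, μ {ω | ¬ ∃ k : ℕ, ε i ω < L k ω} ≤
      ENNReal.ofReal (Real.exp (-(k * laplaceExponent μ L 1))) := by
    intro k
    have h := hM.measure_trigger_mem i (fun p => Set.Ioi (p k))
      (measurableSet_lt ((measurable_pi_apply _).comp measurable_fst) measurable_snd)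
    have h2 := hM.subordinator.lintegral_exp 1 k
    simp only [Nat.cast_one, neg_mul, one_mul, NNReal.coe_natCast] at h2
    rw [← h2]
    calc μ {ω | ¬ ∃ k : ℕ, ε i ω < L k ω} ≤ μ {ω | ε i ω ∈ Set.Ioi (L k ω)} := by
          refine measure_mono_ae ?_
          filter_upwards [hM.ae_ne_trigger i k] with ω hne hω
          simp only [not_exists, not_lt] at hω
          exact lt_of_le_of_ne (hω k) hne.symm
      _ = _ := by
          rw [h]
          refine lintegral_congr_ae ?_
          filter_upwards [hM.subordinator.ae_nonneg] with ω hω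
          exact expMeasure_one_Ioi (hω _)
  have hpos : 0 < laplaceExponent μ L 1 := by
    simpa using hM.subordinator.laplaceExponent_pos hM.nontrivial le_rfl
  have hlim : Tendsto (fun k : ℕ => ENNReal.ofReal (Real.exp (-(k * laplaceExponent μ L 1))))
      atTop (𝓝 0) := by
    rw [← ENNReal.ofReal_zero]
    refine ENNReal.tendsto_ofReal (Real.tendsto_exp_neg_atTop_nhds_zero.comp ?_)
    exact tendsto_natCast_atTop_atTop.atTop_mul_const hpos
  rw [ae_iff]
  exact le_antisymm (ge_of_tendsto' hlim hle) zero_le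

/-! ### Factorisation of the past and the future -/

/-- The probability of a history of failed sets up to time `τ l₀`, together with prescriptions on
the triggers that are still working, is the integral of a functional of the past of the
subordinator times the conditional probabilities of these prescriptions. -/
lemma exists_past_density (hM : IsModel μ L ε) {κ : Type*} [Countable κ] (τ : κ → ℝ≥0)
    (A : κ → Finset (Fin n)) (l₀ : κ) (hτ : ∀ l, τ l ≤ τ l₀) :
    ∃ H : Ω → ℝ≥0∞, Measurable[past L (τ l₀)] H ∧
      ∀ (J : Fin n → (ℝ≥0 → ℝ) → Set ℝ) (w : Fin n → Ω → ℝ≥0∞),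
        (∀ a, MeasurableSet {p : (ℝ≥0 → ℝ) × ℝ | p.2 ∈ J a p.1}) →
        (∀ a p, J a p ⊆ Set.Ioi (p (τ l₀))) →
        (∀ᵐ ω ∂μ, ∀ a ∉ A l₀, expMeasure 1 (J a fun t => L t ω) =
          ENNReal.ofReal (Real.exp (-L (τ l₀) ω)) * w a ω) →
        μ {ω | (∀ l, failedSet L ε (τ l) ω = A l) ∧ ∀ a ∉ A l₀, ε a ω ∈ J a fun t => L t ω} =
          ∫⁻ ω, H ω * ∏ a ∈ (A l₀)ᶜ, w a ω ∂μ := by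
  have := isProbabilityMeasure_expMeasure one_pos
  -- Failed sets grow along the path, so any other history has probability zero and the density 0
  -- serves.
  by_cases hA : ∀ l, A l ⊆ A l₀
  swap
  · refine ⟨fun _ => 0, @measurable_const _ _ _ (past L (τ l₀)) _, fun J w _ _ _ => ?_⟩
    push Not at hA
    obtain ⟨l, hl⟩ := hA
    simp only [zero_mul, lintegral_zero]
    refine measure_mono_null (t := {ω | ¬ Monotone fun t => L t ω}) ?_ hM.subordinator.monotone
    intro ω hω hmono
    refine hl ?_
    rw [← hω.1 l, ← hω.1 l₀]
    intro i hi
    rw [mem_failedSet] at *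
    exact hi.trans (hmono (hτ l))
  have hset : ∀ a, MeasurableSet {p : (κ → ℝ) × ℝ | ∀ l, p.2 ≤ p.1 l ↔ a ∈ A l} := by
    intro a
    simp only [Set.ofPred_forall]
    refine MeasurableSet.iInter fun l => ?_
    have : MeasurableSet {p : (κ → ℝ) × ℝ | p.2 ≤ p.1 l} :=
      measurableSet_le measurable_snd ((measurable_pi_apply l).comp measurable_fst)
    by_cases h : a ∈ A l
    · simp only [h, iff_true]
      exact this
    · simp only [h, iff_false]
      exact this.compl
  -- Conditional probability, given `L` at the observed times, that the trigger of a follows the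
  -- history of a.
  let h : Fin n → (κ → ℝ) → ℝ≥0∞ := fun a x => expMeasure 1 {y | ∀ l, y ≤ x l ↔ a ∈ A l}
  have hh : ∀ a, Measurable (h a) := fun a => measurable_measure_prodMk_left (hset a)
  have hvec : Measurable[past L (τ l₀)] fun ω l => L (τ l) ω :=
    @measurable_pi_lambda _ _ _ (past L (τ l₀)) _ _ fun l => measurable_past (hτ l)
  -- Failed components contribute the probability of their history; each working one contributes its
  -- survival probability e^{-L(τ l₀)}, leaving in `w` only what is conditional on survival.
  refine ⟨fun ω => (∏ a ∈ A l₀, h a fun l => L (τ l) ω) *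
    ∏ _a ∈ (A l₀)ᶜ, ENNReal.ofReal (Real.exp (-L (τ l₀) ω)), ?_, fun J w hJm hJ hw => ?_⟩
  · have h1 : Measurable fun x : κ → ℝ => (∏ a ∈ A l₀, h a x) *
        ∏ _a ∈ (A l₀)ᶜ, ENNReal.ofReal (Real.exp (-x l₀)) := by fun_prop
    exact h1.comp hvec
  · have key := hM.lintegral_trigger
      (fun a p => if a ∈ A l₀ then {y | ∀ l, y ≤ p (τ l) ↔ a ∈ A l} else J a p) fun a => by
        by_cases ha : a ∈ A l₀
        · have hg : Measurable fun p : (ℝ≥0 → ℝ) × ℝ => ((fun l => p.1 (τ l)), p.2) := by fun_prop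
          simpa [ha] using hg (hset a)
        · simpa [ha] using hJm a
    have hev : μ {ω | (∀ l, failedSet L ε (τ l) ω = A l) ∧ ∀ a ∉ A l₀, ε a ω ∈ J a fun t => L t ω} =
        μ {ω | ∀ a, ε a ω ∈ (fun a p => if a ∈ A l₀ then {y | ∀ l, y ≤ p (τ l) ↔ a ∈ A l}
          else J a p) a fun t => L t ω} := by
      refine measure_congr (eventuallyEq_set.2 ?_)
      filter_upwards [hM.subordinator.monotone] with ω hmono
      constructor
      · rintro ⟨h1, h2⟩ a
        by_cases ha : a ∈ A l₀
        · simp only [ha, if_true]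
          intro l
          rw [← h1 l, mem_failedSet]
        · simpa [ha] using h2 a ha
      · intro hω
        refine ⟨fun l => ?_, fun a ha => by simpa [ha] using hω a⟩
        ext a
        rw [mem_failedSet]
        have := hω a
        by_cases ha : a ∈ A l₀
        · simp only [ha, if_true] at this
          exact this l
        -- For a component still working at τ l₀ the history imposes nothing more: its trigger
        -- exceeds L there, hence at every earlier time.
        · simp only [ha, if_false] at this
          have h1 : L (τ l₀) ω < ε a ω := hJ a _ this
          have h2 : L (τ l) ω ≤ L (τ l₀) ω := hmono (hτ l)
          exact iff_of_false (by linarith) fun h => ha (hA l h)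
    rw [hev, key]
    refine lintegral_congr_ae ?_
    filter_upwards [hw] with ω hω
    rw [mul_assoc, ← Finset.prod_mul_distrib, ← Finset.prod_mul_prod_compl (A l₀)]
    congr 1
    · refine Finset.prod_congr rfl fun a ha => ?_
      simp only [ha, if_true, h]
    · refine Finset.prod_congr rfl fun a ha => ?_
      have ha' := Finset.mem_compl.1 ha
      simp only [ha', if_false]
      exact hω a ha'

variable {κ : Type*} [Countable κ]

/-- Joint survival probabilities of the working components after a history of failed sets. -/
lemma measure_history_and_survive (hM : IsModel μ L ε) (τ : κ → ℝ≥0)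
    (A : κ → Finset (Fin n)) (l₀ : κ) (hτ : ∀ l, τ l ≤ τ l₀) (s : Fin n → ℝ≥0) :
    μ {ω | (∀ l, failedSet L ε (τ l) ω = A l) ∧ ∀ a ∉ A l₀, L (τ l₀ + s a) ω < ε a ω} =
      μ {ω | ∀ l, failedSet L ε (τ l) ω = A l} *
        ENNReal.ofReal (Real.exp (-shockExponent (laplaceExponent μ L) (A l₀)ᶜ s)) := by
  obtain ⟨H, hH, hfac⟩ := hM.exists_past_density τ A l₀ hτ
  -- Prescribing only survival, with w = 1, identifies the integral of `H` as the probability of the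
  -- history.
  have h0 : μ {ω | ∀ l, failedSet L ε (τ l) ω = A l} = ∫⁻ ω, H ω ∂μ := by
    have := hfac (fun _ p => Set.Ioi (p (τ l₀))) (fun _ _ => 1)
      (fun a => measurableSet_lt ((measurable_pi_apply _).comp measurable_fst) measurable_snd)
      (fun _ _ => subset_rfl) (by
        filter_upwards [hM.subordinator.ae_nonneg] with ω hω a _
        rw [mul_one]; exact expMeasure_one_Ioi (hω _))
    simp only [Finset.prod_const_one, mul_one] at this
    rw [← this]
    congr 1
    ext ω
    refine ⟨fun h => ⟨h, fun a ha => ?_⟩, fun h => h.1⟩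
    rw [← h l₀, notMem_failedSet] at ha
    exact ha
  rw [h0, ← hM.subordinator.lintegral_past_mul_prod_exp _ _ hH]
  -- The maximum makes the inclusion in `Ioi (p (τ l₀))` hold for every function p; on monotone
  -- paths it is just the later value.
  have h1 := hfac (fun a p => Set.Ioi (max (p (τ l₀)) (p (τ l₀ + s a))))
    (fun a ω => ENNReal.ofReal (Real.exp (-(L (τ l₀ + s a) ω - L (τ l₀) ω))))
    (fun a => measurableSet_lt (by fun_prop) measurable_snd)
    (fun a p => Set.Ioi_subset_Ioi (le_max_left _ _)) (by
      filter_upwards [hM.subordinator.ae_nonneg, hM.subordinator.monotone] with ω hω hmono a _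
      have : L (τ l₀) ω ≤ L (τ l₀ + s a) ω := hmono le_self_add
      rw [max_eq_right this, expMeasure_one_Ioi (hω _), ← ENNReal.ofReal_mul (Real.exp_pos _).le,
        ← Real.exp_add]
      ring_nf)
  rw [← h1]
  refine measure_congr (eventuallyEq_set.2 ?_)
  filter_upwards [hM.subordinator.monotone] with ω hmono
  refine and_congr_right fun _ => forall₂_congr fun a _ => ?_
  have : L (τ l₀) ω ≤ L (τ l₀ + s a) ω := hmono le_self_add
  rw [max_eq_right this, Set.mem_Ioi]

/-- The failed set is a Markov process. -/
lemma measure_history_and_next (hM : IsModel μ L ε) (τ : κ → ℝ≥0)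
    (A : κ → Finset (Fin n)) (l₀ : κ) (hτ : ∀ l, τ l ≤ τ l₀) (h : ℝ≥0) {B : Finset (Fin n)}
    (hB : A l₀ ⊆ B) :
    μ.real {ω | (∀ l, failedSet L ε (τ l) ω = A l) ∧ failedSet L ε (τ l₀ + h) ω = B} =
      μ.real {ω | ∀ l, failedSet L ε (τ l) ω = A l} *
        ∫ ω, (1 - Real.exp (-L h ω)) ^ (B.card - (A l₀).card) *
          Real.exp (-L h ω) ^ (n - B.card) ∂μ := by
  obtain ⟨H, hH, hfac⟩ := hM.exists_past_density τ A l₀ hτ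
  have h0 : μ {ω | ∀ l, failedSet L ε (τ l) ω = A l} = ∫⁻ ω, H ω ∂μ := by
    have := hfac (fun _ p => Set.Ioi (p (τ l₀))) (fun _ _ => 1)
      (fun a => measurableSet_lt ((measurable_pi_apply _).comp measurable_fst) measurable_snd)
      (fun _ _ => subset_rfl) (by
        filter_upwards [hM.subordinator.ae_nonneg] with ω hω a _
        rw [mul_one]; exact expMeasure_one_Ioi (hω _))
    simp only [Finset.prod_const_one, mul_one] at this
    rw [← this]
    congr 1
    ext ω
    refine ⟨fun h => ⟨h, fun a ha => ?_⟩, fun h => h.1⟩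
    rw [← h l₀, notMem_failedSet] at ha
    exact ha
  -- A working component either fails during (τ l₀, τ l₀ + h] or outlives it. By memorylessness the
  -- conditional probabilities depend only on the increment of `L`.
  have h1 := hfac (fun a p => if a ∈ B then Set.Ioc (p (τ l₀)) (p (τ l₀ + h))
      else Set.Ioi (max (p (τ l₀)) (p (τ l₀ + h))))
    (fun a ω => if a ∈ B then ENNReal.ofReal (1 - Real.exp (-(L (τ l₀ + h) ω - L (τ l₀) ω)))
      else ENNReal.ofReal (Real.exp (-(L (τ l₀ + h) ω - L (τ l₀) ω))))
    (fun a => by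
      split_ifs
      · exact (measurableSet_lt (by fun_prop) measurable_snd).inter
          (measurableSet_le measurable_snd (by fun_prop))
      · exact measurableSet_lt (by fun_prop) measurable_snd)
    (fun a p => by
      split_ifs
      · exact Set.Ioc_subset_Ioi_self
      · exact Set.Ioi_subset_Ioi (le_max_left _ _))
    (by
      filter_upwards [hM.subordinator.ae_nonneg, hM.subordinator.monotone] with ω hω hmono a _
      have : L (τ l₀) ω ≤ L (τ l₀ + h) ω := hmono le_self_add
      split_ifs
      · exact expMeasure_one_Ioc (hω _) this
      · rw [max_eq_right this, expMeasure_one_Ioi (hω _), ← ENNReal.ofReal_mul (Real.exp_pos _).le,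
          ← Real.exp_add]
        ring_nf)
  set g : ℝ → ℝ≥0∞ := fun x => ENNReal.ofReal (1 - Real.exp (-x)) ^ (B.card - (A l₀).card) *
    ENNReal.ofReal (Real.exp (-x)) ^ (n - B.card) with hg
  have hprod : ∀ ω, (∏ a ∈ (A l₀)ᶜ, if a ∈ B then
      ENNReal.ofReal (1 - Real.exp (-(L (τ l₀ + h) ω - L (τ l₀) ω)))
      else ENNReal.ofReal (Real.exp (-(L (τ l₀ + h) ω - L (τ l₀) ω)))) =
      g (L (τ l₀ + h) ω - L (τ l₀) ω) := fun ω => by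
    rw [Finset.prod_ite, Finset.prod_const, Finset.prod_const, hg]
    simp only
    congr 2
    · rw [← Finset.card_sdiff_of_subset hB]
      congr 1; ext a; simp [and_comm]
    · have hBc : n - B.card = Bᶜ.card := by rw [Finset.card_compl, Fintype.card_fin]
      rw [hBc]
      congr 1; ext a
      simp only [Finset.mem_filter, Finset.mem_compl]
      exact ⟨fun h => h.2, fun h => ⟨fun h' => h (hB h'), h⟩⟩
  simp_rw [hprod] at h1
  rw [hM.subordinator.lintegral_past_mul hH (by fun_prop), ← h0] at h1
  have hev : μ {ω | (∀ l, failedSet L ε (τ l) ω = A l) ∧ failedSet L ε (τ l₀ + h) ω = B} =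
      μ {ω | ∀ l, failedSet L ε (τ l) ω = A l} * ∫⁻ ω, g (L h ω) ∂μ := by
    rw [← h1]
    refine measure_congr (eventuallyEq_set.2 ?_)
    filter_upwards [hM.subordinator.monotone] with ω hmono
    refine and_congr_right fun hA => ?_
    have hle : L (τ l₀) ω ≤ L (τ l₀ + h) ω := hmono le_self_add
    constructor
    · intro hω a ha
      rw [← hA l₀, notMem_failedSet] at ha
      split_ifs with haB
      · rw [← hω, mem_failedSet] at haB
        exact ⟨ha, haB⟩
      · rw [← hω, notMem_failedSet] at haB
        exact max_lt ha haB
    · intro hω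
      ext a
      rw [mem_failedSet]
      by_cases ha : a ∈ A l₀
      · refine iff_of_true ?_ (hB ha)
        rw [← hA l₀, mem_failedSet] at ha
        exact ha.trans hle
      · have := hω a ha
        split_ifs at this with haB
        · exact iff_of_true this.2 haB
        · exact iff_of_false (not_le.2 ((le_max_right _ _).trans_lt this)) haB
  rw [measureReal_def, hev, ENNReal.toReal_mul, ← measureReal_def]
  congr 1
  rw [integral_eq_lintegral_of_nonneg_ae]
  · congr 1
    refine lintegral_congr_ae ?_
    filter_upwards [hM.subordinator.ae_nonneg] with ω hω
    have h1 : 0 ≤ 1 - Real.exp (-L h ω) := by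
      have := Real.exp_le_one_iff.2 (neg_nonpos.2 (hω h)); linarith
    rw [hg]
    simp only
    rw [← ENNReal.ofReal_pow h1, ← ENNReal.ofReal_pow (Real.exp_pos _).le,
      ← ENNReal.ofReal_mul (pow_nonneg h1 _)]
  · filter_upwards [hM.subordinator.ae_nonneg] with ω hω
    have h1 : 0 ≤ 1 - Real.exp (-L h ω) := by
      have := Real.exp_le_one_iff.2 (neg_nonpos.2 (hω h)); linarith
    exact mul_nonneg (pow_nonneg h1 _) (pow_nonneg (Real.exp_pos _).le _)
  · exact (hM.subordinator.integrable_pow_mul_exp _ _ h).aestronglyMeasurable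

end IsModel

end

/-! ### Regular paths -/

lemma exists_nnrat_btwn {s t : ℝ≥0} (h : s < t) : ∃ q : ℚ≥0, s < (q : ℝ≥0) ∧ (q : ℝ≥0) < t := by
  obtain ⟨q, h1, h2⟩ := exists_rat_btwn (show (s : ℝ) < t from h)
  have h0 : 0 ≤ q := by exact_mod_cast s.2.trans h1.le
  lift q to ℚ≥0 using h0
  have e : ((q : ℝ≥0) : ℝ) = ((q : ℚ) : ℝ) := rfl
  exact ⟨q, NNReal.coe_lt_coe.1 (e ▸ h1), NNReal.coe_lt_coe.1 (e ▸ h2)⟩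

/-- The almost sure properties of the paths that the pathwise arguments use. -/
structure GoodPath {Ω : Type*} {n : ℕ} (L : ℝ≥0 → Ω → ℝ) (ε : Fin n → Ω → ℝ) (ω : Ω) : Prop where
  mono : Monotone fun t => L t ω
  rightCts : ∀ t, ContinuousWithinAt (fun s => L s ω) (Set.Ici t) t
  zero : L 0 ω = 0
  pos : ∀ i, 0 < ε i ω
  ne : ∀ i (q : ℚ≥0), ε i ω ≠ L (q : ℝ≥0) ω
  exceeds : ∀ i, ∃ k : ℕ, ε i ω < L k ω

lemma IsModel.ae_goodPath {Ω : Type*} [MeasurableSpace Ω] {μ : Measure Ω} [IsProbabilityMeasure μ]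
    {L : ℝ≥0 → Ω → ℝ} {n : ℕ} {ε : Fin n → Ω → ℝ} (hM : IsModel μ L ε) :
    ∀ᵐ ω ∂μ, GoodPath L ε ω := by
  filter_upwards [hM.subordinator.monotone, hM.subordinator.rightCts, hM.subordinator.zero,
    hM.ae_pos_trigger, ae_all_iff.2 fun i => ae_all_iff.2 fun q : ℚ≥0 => hM.ae_ne_trigger i q,
    ae_all_iff.2 hM.ae_exists_trigger_lt] with ω h1 h2 h3 h4 h5 h6
  exact ⟨h1, h2, h3, h4, h5, h6⟩

namespace GoodPath

variable {Ω : Type*} {n : ℕ} {L : ℝ≥0 → Ω → ℝ} {ε : Fin n → Ω → ℝ} {ω : Ω}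

lemma failedSet_mono (hg : GoodPath L ε ω) {s t : ℝ≥0} (h : s ≤ t) :
    failedSet L ε s ω ⊆ failedSet L ε t ω := fun i hi => by
  rw [mem_failedSet] at *
  exact hi.trans (hg.mono h)

lemma failures_mono (hg : GoodPath L ε ω) : Monotone fun t => failures L ε t ω :=
  fun _ _ h => Finset.card_le_card (hg.failedSet_mono h)

/-- Failure is defined by ε ≤ L but the lifetime by ε < L. They could disagree only if L stayed
equal to ε on an interval; such an interval contains a rational time, where equality is excluded. -/
lemma lt_of_mem_failedSet (hg : GoodPath L ε ω) {s t : ℝ≥0} {i : Fin n}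
    (hi : i ∈ failedSet L ε s ω) (h : s < t) : ε i ω < L t ω := by
  obtain ⟨q, hq1, hq2⟩ := exists_nnrat_btwn h
  rw [mem_failedSet] at hi
  exact (lt_of_le_of_ne (hi.trans (hg.mono hq1.le)) (hg.ne i q)).trans_le (hg.mono hq2.le)

lemma exists_gt_of_notMem_failedSet (hg : GoodPath L ε ω) {t : ℝ≥0} {i : Fin n}
    (hi : i ∉ failedSet L ε t ω) : ∃ s, t < s ∧ i ∉ failedSet L ε s ω := by
  rw [notMem_failedSet] at hi
  have h1 : ∀ᶠ s in 𝓝[>] t, L s ω < ε i ω :=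
    ((hg.rightCts t).mono Set.Ioi_subset_Ici_self).eventually_lt_const hi
  obtain ⟨s, hs, hts⟩ := (h1.and self_mem_nhdsWithin).exists
  exact ⟨s, hts, notMem_failedSet.2 hs⟩

/-- Right-continuity rules out a lifetime equal to t without failure at t; the converse is
`lt_of_mem_failedSet`. -/
lemma lifetime_le_iff (hg : GoodPath L ε ω) {i : Fin n} {t : ℝ≥0} :
    lifetime L ε i ω ≤ t ↔ i ∈ failedSet L ε t ω := by
  constructor
  · intro h
    by_contra hi
    obtain ⟨s, hts, hs⟩ := hg.exists_gt_of_notMem_failedSet hi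
    rw [notMem_failedSet] at hs
    have : (s : ℝ≥0∞) ≤ lifetime L ε i ω := le_iInf₂ fun r hr => by
      rw [ENNReal.coe_le_coe]
      by_contra hrs
      exact absurd (hs.trans hr) (not_lt.2 (hg.mono (not_le.1 hrs).le))
    exact absurd (this.trans h) (by simpa using hts)
  · intro hi
    refine le_of_forall_gt fun x hx => ?_
    obtain ⟨r, hr1, hr2⟩ := ENNReal.lt_iff_exists_nnreal_btwn.1 hx
    exact (iInf₂_le r (hg.lt_of_mem_failedSet hi (by simpa using hr1))).trans_lt hr2

lemma failures_zero (hg : GoodPath L ε ω) : failures L ε 0 ω = 0 := by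
  have : failedSet L ε 0 ω = ∅ := by
    ext i
    simp [mem_failedSet, hg.zero, hg.pos i]
  simp [failures, this]

lemma failures_rightCts (hg : GoodPath L ε ω) (t : ℝ≥0) :
    ∀ᶠ s in 𝓝[>] t, failures L ε s ω = failures L ε t ω := by
  have h1 : ∀ i, ∀ᶠ s in 𝓝[>] t, i ∈ failedSet L ε s ω → i ∈ failedSet L ε t ω := by
    intro i
    by_cases hi : i ∈ failedSet L ε t ω
    · simp [hi]
    · obtain ⟨s, hts, hs⟩ := hg.exists_gt_of_notMem_failedSet hi
      filter_upwards [Ioo_mem_nhdsGT hts] with r hr h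
      exact absurd (hg.failedSet_mono hr.2.le h) hs
  filter_upwards [eventually_all.2 h1, self_mem_nhdsWithin] with s hs hts
  have : failedSet L ε s ω = failedSet L ε t ω :=
    Finset.Subset.antisymm (fun i => hs i) (hg.failedSet_mono (le_of_lt hts))
  simp only [failures, this]

lemma exists_failures_eq_last (hg : GoodPath L ε ω) : ∃ t, failures L ε t ω = Fin.last n := by
  choose k hk using hg.exceeds
  refine ⟨((Finset.univ.sup k : ℕ) : ℝ≥0), ?_⟩
  have : failedSet L ε ((Finset.univ.sup k : ℕ) : ℝ≥0) ω = Finset.univ := by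
    ext i
    simp only [mem_failedSet, Finset.mem_univ, iff_true]
    exact (hk i).le.trans (hg.mono (by exact_mod_cast Finset.le_sup (Finset.mem_univ i)))
  rw [failures, Fin.ext_iff]
  simp only [this, Finset.card_univ, Fintype.card_fin, Fin.val_last]

end GoodPath

/-! ### The number of failed components is a Markov chain -/

/-- The number of failed sets of size j reachable from A depends only on |A|. This is what allows
the Markov chain of failed sets to be lumped by cardinality. -/
lemma card_filter_superset_card {n : ℕ} (A : Finset (Fin n)) {j : ℕ} (hj : A.card ≤ j) :
    (Finset.univ.filter fun B : Finset (Fin n) => A ⊆ B ∧ B.card = j).card =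
      (n - A.card).choose (j - A.card) := by
  have hc : n - A.card = Aᶜ.card := by rw [Finset.card_compl, Fintype.card_fin]
  rw [hc, ← Finset.card_powersetCard]
  refine Finset.card_bij' (fun B _ => B \ A) (fun C _ => A ∪ C) ?_ ?_ ?_ ?_
  · intro B hB
    simp only [Finset.mem_filter, Finset.mem_univ, true_and] at hB
    rw [Finset.mem_powersetCard, Finset.card_sdiff_of_subset hB.1, hB.2]
    refine ⟨fun a ha => ?_, rfl⟩
    rw [Finset.mem_sdiff] at ha
    exact Finset.mem_compl.2 ha.2
  · intro C hC
    rw [Finset.mem_powersetCard] at hC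
    simp only [Finset.mem_filter, Finset.mem_univ, true_and]
    refine ⟨Finset.subset_union_left, ?_⟩
    rw [Finset.card_union_of_disjoint, hC.2]
    · omega
    · exact Finset.disjoint_left.2 fun a ha hC' => Finset.mem_compl.1 (hC.1 hC') ha
  · intro B hB
    simp only [Finset.mem_filter, Finset.mem_univ, true_and] at hB
    exact Finset.union_sdiff_of_subset hB.1
  · intro C hC
    rw [Finset.mem_powersetCard] at hC
    ext a
    simp only [Finset.mem_sdiff, Finset.mem_union]
    have : a ∈ C → a ∉ A := fun h => Finset.mem_compl.1 (hC.1 h)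
    tauto

section

variable {Ω : Type*} [MeasurableSpace Ω] {μ : Measure Ω} [IsProbabilityMeasure μ]
  {L : ℝ≥0 → Ω → ℝ} {n : ℕ} {ε : Fin n → Ω → ℝ}

/-- Sum over all histories of failed sets with the prescribed sizes. Each reachable set of the next
size has the same conditional probability, and their number is the binomial coefficient in the
transition matrix. -/
lemma IsModel.failures_markov (hM : IsModel μ L ε) (m : ℕ) (t : ℕ → ℝ≥0) (ht : Monotone t)
    (x : ℕ → Fin (n + 1)) :
    μ.real {ω | ∀ l ≤ m + 1, failures L ε (t l) ω = x l} =
      μ.real {ω | ∀ l ≤ m, failures L ε (t l) ω = x l} *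
        semigroup (laplaceExponent μ L) n (t (m + 1) - t m) (x m) (x (m + 1)) := by
  classical
  have hLm := hM.subordinator.measurable
  have hεm := hM.trigger_measurable
  set X : Ω → Fin (m + 1) → Finset (Fin n) := fun ω l => failedSet L ε (t l) ω with hX
  set Y : Ω → Finset (Fin n) := fun ω => failedSet L ε (t (m + 1)) ω with hY
  have hXm : ∀ A, MeasurableSet {ω | X ω = A} := fun A => by
    have : {ω | X ω = A} = ⋂ l : Fin (m + 1), {ω | failedSet L ε (t l) ω = A l} := by
      ext ω; simp [X, funext_iff]
    rw [this]
    exact MeasurableSet.iInter fun l => measurableSet_failedSet_eq hLm hεm _ _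
  have hYm : ∀ B, MeasurableSet {ω | Y ω = B} := fun B => measurableSet_failedSet_eq hLm hεm _ _
  have hXYm : ∀ c : (Fin (m + 1) → Finset (Fin n)) × Finset (Fin n),
      MeasurableSet {ω | (X ω, Y ω) = c} := fun c => by
    have : {ω | (X ω, Y ω) = c} = {ω | X ω = c.1} ∩ {ω | Y ω = c.2} := by
      ext ω; simp [Prod.ext_iff]
    rw [this]
    exact (hXm _).inter (hYm _)
  have hcard : ∀ (s : ℝ≥0) ω (j : Fin (n + 1)), failures L ε s ω = j ↔
      (failedSet L ε s ω).card = j := fun s ω j => by simp [failures, Fin.ext_iff]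
  have e1 : μ.real {ω | ∀ l ≤ m, failures L ε (t l) ω = x l} =
      ∑ A, if ∀ l : Fin (m + 1), (A l).card = (x l : ℕ) then μ.real {ω | X ω = A} else 0 := by
    rw [← measureReal_setOf_comp X hXm]
    congr 1
    ext ω
    simp only [hcard, Set.mem_ofPred_eq, X]
    exact ⟨fun h l => h l (by omega), fun h l hl => h ⟨l, by omega⟩⟩
  have e2 : μ.real {ω | ∀ l ≤ m + 1, failures L ε (t l) ω = x l} =
      ∑ c : (Fin (m + 1) → Finset (Fin n)) × Finset (Fin n),
        if (∀ l : Fin (m + 1), (c.1 l).card = (x l : ℕ)) ∧ c.2.card = (x (m + 1) : ℕ) then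
          μ.real {ω | (X ω, Y ω) = c} else 0 := by
    rw [← measureReal_setOf_comp (fun ω => (X ω, Y ω)) hXYm fun c =>
      (∀ l : Fin (m + 1), (c.1 l).card = (x l : ℕ)) ∧ c.2.card = (x (m + 1) : ℕ)]
    congr 1
    ext ω
    simp only [hcard, Set.mem_ofPred_eq, X, Y]
    refine ⟨fun h => ⟨fun l => h l (by omega), h _ le_rfl⟩, fun h l hl => ?_⟩
    rcases Nat.lt_or_ge m l with h' | h'
    · obtain rfl : l = m + 1 := by omega
      exact h.2
    · exact h.1 ⟨l, by omega⟩
  rw [e1, e2, Fintype.sum_prod_type, Finset.sum_mul]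
  refine Finset.sum_congr rfl fun A _ => ?_
  by_cases hA : ∀ l, (A l).card = x l
  swap
  · simp [hA]
  simp only [hA, implies_true, true_and, if_true]
  have hlast : (A (Fin.last m)).card = x m := by simpa using hA (Fin.last m)
  set h := t (m + 1) - t m with hh
  have hth : t m + h = t (m + 1) := add_tsub_cancel_of_le (ht (Nat.le_succ m))
  have hnext : ∀ B, μ.real {ω | (X ω, Y ω) = (A, B)} = if A (Fin.last m) ⊆ B then
      μ.real {ω | X ω = A} * ∫ ω, (1 - Real.exp (-L h ω)) ^ (B.card - (A (Fin.last m)).card) *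
          Real.exp (-L h ω) ^ (n - B.card) ∂μ else 0 := by
    intro B
    split_ifs with hAB
    · have := hM.measure_history_and_next (fun l : Fin (m + 1) => t l) A (Fin.last m)
        (fun l => ht (by simp; omega)) h hAB
      simp only [Fin.val_last, hth] at this
      rw [← show {ω | ∀ l : Fin (m + 1), failedSet L ε (t l) ω = A l} = {ω | X ω = A} by
        ext ω; simp [X, funext_iff], ← this]
      congr 1
      ext ω
      simp [X, Y, funext_iff, Prod.ext_iff]
    · rw [measureReal_def, measure_mono_null (t := {ω | ¬ GoodPath L ε ω}), ENNReal.toReal_zero]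
      · intro ω hω hg
        simp only [Set.mem_ofPred_eq, Prod.mk.injEq] at hω
        refine hAB ?_
        rw [← hω.1, ← hω.2]
        exact hg.failedSet_mono (ht (by simp))
      · exact hM.ae_goodPath
  rw [hM.subordinator.semigroup_apply]
  simp_rw [hnext]
  have hcalc : ∀ B : Finset (Fin n), (if B.card = x (m + 1) then if A (Fin.last m) ⊆ B then
      μ.real {ω | X ω = A} * ∫ ω, (1 - Real.exp (-L h ω)) ^ (B.card - (A (Fin.last m)).card) *
          Real.exp (-L h ω) ^ (n - B.card) ∂μ else 0 else 0) =
      if A (Fin.last m) ⊆ B ∧ B.card = x (m + 1) then μ.real {ω | X ω = A} *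
        ∫ ω, (1 - Real.exp (-L h ω)) ^ ((x (m + 1) : ℕ) - x m) *
          Real.exp (-L h ω) ^ (n - (x (m + 1) : ℕ)) ∂μ else 0 := by
    intro B
    by_cases h1 : B.card = x (m + 1) <;> by_cases h2 : A (Fin.last m) ⊆ B <;>
      simp [h1, h2, hlast]
  rw [Finset.sum_congr rfl fun B _ => hcalc B, ← Finset.sum_filter, Finset.sum_const, nsmul_eq_mul]
  split_ifs with hij
  · rw [card_filter_superset_card _ (by rw [hlast]; exact hij), hlast]
    ring
  · rw [Finset.filter_eq_empty_iff.2]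
    · simp
    · rintro B - ⟨h1, h2⟩
      have := Finset.card_le_card h1
      rw [hlast, h2] at this
      exact hij this

theorem IsModel.isCTMC_failures (hM : IsModel μ L ε) :
    IsCTMC μ (failures L ε) (generator (laplaceExponent μ L) n) where
  measurable t i := measurableSet_failures_eq hM.subordinator.measurable hM.trigger_measurable t i
  rightCts := by
    filter_upwards [hM.ae_goodPath] with ω hg t using hg.failures_rightCts t
  markov := ⟨semigroup (laplaceExponent μ L) n, semigroup_zero _ n,
    hM.subordinator.semigroup_nonneg n, hM.subordinator.semigroup_row_sum n,
    semigroup_add _ n, semigroup_hasDerivAt _ (laplaceExponent_zero μ L) n,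
    fun m t ht x => hM.failures_markov m t ht x⟩

end

/-! ### Laws on `[0, ∞]` and their survival functions -/

lemma expLaw_Ioi {r : ℝ} (hr : 0 ≤ r) (s : ℝ≥0) :
    expLaw r (Set.Ioi (s : ℝ≥0∞)) = ENNReal.ofReal (Real.exp (-(r * s))) := by
  rcases hr.eq_or_lt with rfl | h
  · simp [expLaw]
  · have := isProbabilityMeasure_expMeasure h
    have hpre : ENNReal.ofReal ⁻¹' Set.Ioi (s : ℝ≥0∞) = (Set.Iic (s : ℝ))ᶜ := by
      ext x
      simp [ENNReal.lt_ofReal_iff_toReal_lt]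
    rw [expLaw, if_pos h, Measure.map_apply ENNReal.measurable_ofReal measurableSet_Ioi, hpre,
      prob_compl_eq_one_sub measurableSet_Iic, ← ofReal_cdf, cdf_expMeasure_eq h,
      if_pos (NNReal.coe_nonneg s), ← ENNReal.ofReal_one, ← ENNReal.ofReal_sub _ (by
        simpa using mul_nonneg h.le s.2)]
    congr 1; ring

lemma measurableSet_forall_lt {ι : Type*} [Countable ι] (s : ι → ℝ≥0∞) :
    MeasurableSet {x : ι → ℝ≥0∞ | ∀ a, s a < x a} := by
  simp only [Set.ofPred_forall]
  exact MeasurableSet.iInter fun a => measurableSet_lt measurable_const (measurable_pi_apply a)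

/-- Two laws of strictly positive vectors with the same joint survival function are equal. -/
lemma measure_ext_of_survival {ι : Type*} [Finite ι] {ν₁ ν₂ : Measure (ι → ℝ≥0∞)}
    [IsProbabilityMeasure ν₁] [IsProbabilityMeasure ν₂]
    (h0 : ν₁ {x | ∀ a, 0 < x a} = 1)
    (h : ∀ s : ι → ℝ≥0, ν₁ {x | ∀ a, (s a : ℝ≥0∞) < x a} = ν₂ {x | ∀ a, (s a : ℝ≥0∞) < x a}) :
    ν₁ = ν₂ := by
  have h0' : ν₂ {x | ∀ a, 0 < x a} = 1 := by
    rw [← h0]; simpa using (h 0).symm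
  have hae₁ : ∀ᵐ x ∂ν₁, ∀ a, 0 < x a :=
    (mem_ae_iff_prob_eq_one (measurableSet_forall_lt fun _ => 0)).2 h0
  have hae₂ : ∀ᵐ x ∂ν₂, ∀ a, 0 < x a :=
    (mem_ae_iff_prob_eq_one (measurableSet_forall_lt fun _ => 0)).2 h0'
  -- No `Ioi c` contains 0, so `univ` is added to provide a cover. Coordinates are almost surely
  -- positive, so `univ` then acts as `Ioi 0`.
  let C : Set (Set ℝ≥0∞) := insert Set.univ (Set.range Set.Ioi)
  have hgen : MeasurableSpace.generateFrom C = (inferInstance : MeasurableSpace ℝ≥0∞) := by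
    rw [MeasurableSpace.generateFrom_insert_univ, ← borel_eq_generateFrom_Ioi]
    exact (BorelSpace.measurable_eq).symm
  have hpi : IsPiSystem C := by
    have := (isPiSystem_image_Ioi (Set.univ : Set ℝ≥0∞)).insert_univ
    rwa [Set.image_univ] at this
  refine ext_of_generate_finite (Set.univ.pi '' Set.univ.pi fun _ : ι => C)
    (generateFrom_eq_pi (fun _ => hgen) fun _ => ⟨fun _ => Set.univ, fun _ => Or.inl rfl, Set.iUnion_const _⟩).symm
    (IsPiSystem.pi fun _ => hpi) ?_ (by simp)
  rintro _ ⟨B, hB, rfl⟩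
  have hc : ∀ a, ∃ c : ℝ≥0∞, ∀ x : ℝ≥0∞, 0 < x → (x ∈ B a ↔ c < x) := fun a => by
    rcases hB a (Set.mem_univ a) with h | ⟨c, h⟩
    · exact ⟨0, fun x hx => by simp [h, hx]⟩
    · exact ⟨c, fun x _ => by simp [← h]⟩
  choose c hc using hc
  have hbox : ∀ ν : Measure (ι → ℝ≥0∞), (∀ᵐ x ∂ν, ∀ a, 0 < x a) →
      ν (Set.univ.pi B) = ν {x | ∀ a, c a < x a} := fun ν hν => by
    refine measure_congr (eventuallyEq_set.2 ?_)
    filter_upwards [hν] with x hx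
    simp only [Set.mem_pi, Set.mem_univ, true_implies]
    exact forall_congr' fun a => hc a _ (hx a)
  rw [hbox _ hae₁, hbox _ hae₂]
  by_cases htop : ∃ a, c a = ⊤
  · obtain ⟨a, ha⟩ := htop
    have : {x : ι → ℝ≥0∞ | ∀ a, c a < x a} = ∅ := by
      ext x
      simp only [Set.mem_ofPred_eq, Set.mem_empty_iff_false, iff_false, not_forall]
      exact ⟨a, by simp [ha]⟩
    simp [this]
  · push Not at htop
    lift c to ι → ℝ≥0 using htop
    exact h c

/-- Finiteness keeps the inequality strict; over an empty family the infimum is ∞, above any finite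
s. -/
lemma lt_biInf_iff_of_finite {κ : Type*} [Finite κ] (p : κ → Prop) (e : κ → ℝ≥0∞) (s : ℝ≥0) :
    (s : ℝ≥0∞) < ⨅ (V : κ) (_ : p V), e V ↔ ∀ V, p V → (s : ℝ≥0∞) < e V := by
  classical
  cases nonempty_fintype κ
  have : ⨅ (V : κ) (_ : p V), e V = (Finset.univ.filter p).inf e := by
    rw [Finset.inf_eq_iInf]; simp
  rw [this, Finset.lt_inf_iff (by simp)]
  simp

section

variable {Ω : Type*} [MeasurableSpace Ω] {μ : Measure Ω} [IsProbabilityMeasure μ]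
  {L : ℝ≥0 → Ω → ℝ} {n : ℕ} {ε : Fin n → Ω → ℝ}

instance (Ψ : ℝ → ℝ) (A : Finset (Fin n)) : IsProbabilityMeasure (shockLaw Ψ A) := by
  unfold shockLaw; infer_instance

namespace IsSubordinator

lemma lam_shock_nonneg (hL : IsSubordinator μ L) (A : Finset (Fin n)) (V : Shock A) :
    0 ≤ lam (laplaceExponent μ L) (n - A.card) V.1.card := by
  refine hL.lam_nonneg (Finset.card_pos.2 V.2.1) ?_
  have hc : n - A.card = Aᶜ.card := by rw [Finset.card_compl, Fintype.card_fin]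
  rw [hc]
  exact Finset.card_le_card fun a ha =>
    Finset.mem_compl.2 (Finset.disjoint_left.1 V.2.2 ha)

lemma shockLaw_forall_lt (hL : IsSubordinator μ L) (A : Finset (Fin n))
    (s : Shock A → ℝ≥0) :
    shockLaw (laplaceExponent μ L) A {e | ∀ V, (s V : ℝ≥0∞) < e V} =
      ENNReal.ofReal (Real.exp (-∑ V : Shock A,
        lam (laplaceExponent μ L) (n - A.card) V.1.card * s V)) := by
  have : {e : Shock A → ℝ≥0∞ | ∀ V, (s V : ℝ≥0∞) < e V} =
      Set.univ.pi fun V => Set.Ioi (s V : ℝ≥0∞) := by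
    ext e; simp
  rw [this, shockLaw, Measure.pi_pi,
    Finset.prod_congr rfl fun V _ => expLaw_Ioi (hL.lam_shock_nonneg A V) (s V),
    ← ENNReal.ofReal_prod_of_nonneg fun _ _ => (Real.exp_pos _).le, ← Real.exp_sum,
    Finset.sum_neg_distrib]

/-- The shock exponent also runs over V = ∅, which adds nothing since its rate is zero. -/
lemma sum_shock_eq_shockExponent (Ψ : ℝ → ℝ) (A : Finset (Fin n)) (s : Fin n → ℝ≥0) :
    ∑ V : Shock A, lam Ψ (n - A.card) V.1.card * (V.1.sup s : ℝ≥0) =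
      shockExponent Ψ Aᶜ s := by
  have hc : n - A.card = Aᶜ.card := by rw [Finset.card_compl, Fintype.card_fin]
  rw [shockExponent, ← hc, ← Finset.sum_erase (s := Aᶜ.powerset) (a := ∅) (by simp [lam_zero_right])]
  symm
  refine Finset.sum_subtype _ (fun V => ?_) _
  rw [Finset.mem_erase, Finset.mem_powerset, ← Finset.nonempty_iff_ne_empty,
    Finset.disjoint_left]
  simp [Finset.subset_iff]

lemma card_shock_card_eq (A : Finset (Fin n)) {v : ℕ} (hv : 1 ≤ v) :
    (Finset.univ.filter fun V : Shock A => V.1.card = v).card = (n - A.card).choose v := by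
  have hc : n - A.card = Aᶜ.card := by rw [Finset.card_compl, Fintype.card_fin]
  rw [hc, ← Finset.card_powersetCard, ← Finset.card_map (Function.Embedding.subtype _)]
  congr 1
  ext V
  simp only [Finset.mem_map, Finset.mem_filter, Finset.mem_univ, true_and,
    Function.Embedding.coe_subtype, Subtype.exists, Finset.mem_powersetCard]
  constructor
  · rintro ⟨W, ⟨-, h2⟩, h3, rfl⟩
    exact ⟨fun a ha => Finset.mem_compl.2 (Finset.disjoint_left.1 h2 ha), h3⟩
  · rintro ⟨h1, h2⟩
    exact ⟨V, ⟨Finset.card_pos.1 (by omega), Finset.disjoint_left.2 fun a ha =>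
      Finset.mem_compl.1 (h1 ha)⟩, h2, rfl⟩

/-- The time of the first shock that hits exactly `v` working components. -/
lemma hasLaw_first_shock (hL : IsSubordinator μ L) (A : Finset (Fin n)) {v : ℕ} (hv : 1 ≤ v)
    (hvn : v ≤ n - A.card) :
    HasLaw (fun e : Shock A → ℝ≥0∞ => ⨅ (V : Shock A) (_ : V.1.card = v), e V)
      (expLaw (((n - A.card).choose v : ℝ) * lam (laplaceExponent μ L) (n - A.card) v))
      (shockLaw (laplaceExponent μ L) A) := by
  classical
  have hmeas : Measurable fun e : Shock A → ℝ≥0∞ =>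
      ⨅ (V : Shock A) (_ : V.1.card = v), e V :=
    Measurable.iInf fun V => Measurable.iInf fun _ => measurable_pi_apply V
  refine ⟨hmeas.aemeasurable, ?_⟩
  have := Measure.isProbabilityMeasure_map (μ := shockLaw (laplaceExponent μ L) A)
    hmeas.aemeasurable
  refine Measure.ext_of_Iic _ _ fun x => ?_
  induction x with
  | top => simp
  | coe s =>
    rw [← Set.compl_Ioi, prob_compl_eq_one_sub measurableSet_Ioi,
      prob_compl_eq_one_sub measurableSet_Ioi, Measure.map_apply hmeas measurableSet_Ioi,
      expLaw_Ioi (mul_nonneg (Nat.cast_nonneg _) (hL.lam_nonneg hv hvn))]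
    congr 1
    have hae : shockLaw (laplaceExponent μ L) A {e | ∀ V, ((0 : ℝ≥0) : ℝ≥0∞) < e V} = 1 := by
      rw [hL.shockLaw_forall_lt A fun _ => 0]; simp
    have hae' : ∀ᵐ e ∂shockLaw (laplaceExponent μ L) A, ∀ V, ((0 : ℝ≥0) : ℝ≥0∞) < e V :=
      (mem_ae_iff_prob_eq_one (measurableSet_forall_lt _)).2 hae
    -- Shocks of the other sizes receive threshold 0, which they exceed almost surely.
    have key := hL.shockLaw_forall_lt A fun V => if V.1.card = v then s else 0
    have hsum : ∑ V : Shock A, lam (laplaceExponent μ L) (n - A.card) V.1.card *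
        ((if V.1.card = v then s else 0 : ℝ≥0) : ℝ) =
        ((n - A.card).choose v : ℝ) * lam (laplaceExponent μ L) (n - A.card) v * s := by
      have : ∀ V : Shock A, lam (laplaceExponent μ L) (n - A.card) V.1.card *
        ((if V.1.card = v then s else 0 : ℝ≥0) : ℝ) =
        if V.1.card = v then lam (laplaceExponent μ L) (n - A.card) v * s else 0 := fun V => by
        split_ifs with h
        · rw [h]
        · simp
      rw [Finset.sum_congr rfl fun V _ => this V, ← Finset.sum_filter, Finset.sum_const,
        card_shock_card_eq A hv, nsmul_eq_mul, mul_assoc]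
    rw [hsum] at key
    rw [← key]
    refine measure_congr (eventuallyEq_set.2 ?_)
    filter_upwards [hae'] with e he
    simp only [Set.mem_preimage, Set.mem_Ioi, lt_biInf_iff_of_finite]
    refine forall_congr' fun V => ?_
    split_ifs with h
    · simp [h]
    · simpa [h] using he V

end IsSubordinator

namespace GoodPath

/-- A countable infimum, giving a measurable version of the lifetime. -/
lemma lifetime_eq_iInf_rat {Ω : Type*} {L : ℝ≥0 → Ω → ℝ} {ε : Fin n → Ω → ℝ} {ω : Ω}
    (hg : GoodPath L ε ω) (i : Fin n) :
    lifetime L ε i ω = ⨅ q : ℚ≥0, if ε i ω < L (q : ℝ≥0) ω then ((q : ℝ≥0) : ℝ≥0∞) else ⊤ := by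
  refine le_antisymm (le_iInf fun q => ?_) (le_iInf₂ fun t ht => ?_)
  · split_ifs with h
    · exact iInf₂_le (q : ℝ≥0) h
    · exact le_top
  · refine le_of_forall_gt fun x hx => ?_
    obtain ⟨r, hr1, hr2⟩ := ENNReal.lt_iff_exists_nnreal_btwn.1 hx
    obtain ⟨q, hq1, hq2⟩ := exists_nnrat_btwn (ENNReal.coe_lt_coe.1 hr1)
    refine (iInf_le _ q).trans_lt ?_
    rw [if_pos (ht.trans_le (hg.mono hq1.le))]
    exact lt_trans (by exact_mod_cast hq2) hr2

end GoodPath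

namespace IsModel

lemma aemeasurable_lifetime (hM : IsModel μ L ε) (i : Fin n) : AEMeasurable (lifetime L ε i) μ := by
  refine ⟨fun ω => ⨅ q : ℚ≥0, if ε i ω < L (q : ℝ≥0) ω then ((q : ℝ≥0) : ℝ≥0∞) else ⊤, ?_, ?_⟩
  · exact Measurable.iInf fun q => Measurable.ite
      (measurableSet_lt (hM.trigger_measurable i) (hM.subordinator.measurable _))
      measurable_const measurable_const
  · filter_upwards [hM.ae_goodPath] with ω hg using hg.lifetime_eq_iInf_rat i

/-- The remaining lifetimes of the working components have a Marshall-Olkin law. -/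
lemma map_cond_lifetime (hM : IsModel μ L ε) (t : ℝ≥0) (A : Finset (Fin n))
    (hA : μ {ω | failedSet L ε t ω = A} ≠ 0) :
    (ProbabilityTheory.cond μ {ω | failedSet L ε t ω = A}).map
        (fun ω (a : {a : Fin n // a ∉ A}) => lifetime L ε a.1 ω - (t : ℝ≥0∞)) =
      (shockLaw (laplaceExponent μ L) A).map
        (fun e (a : {a : Fin n // a ∉ A}) => ⨅ (V : Shock A) (_ : a.1 ∈ V.1), e V) := by
  classical
  set E := {ω | failedSet L ε t ω = A} with hE
  have hEm : MeasurableSet E := measurableSet_failedSet_eq hM.subordinator.measurable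
    hM.trigger_measurable t A
  have hcond : IsProbabilityMeasure (ProbabilityTheory.cond μ E) := cond_isProbabilityMeasure hA
  have hf : AEMeasurable (fun ω (a : {a : Fin n // a ∉ A}) => lifetime L ε a.1 ω - (t : ℝ≥0∞))
      (ProbabilityTheory.cond μ E) :=
    aemeasurable_pi_lambda _ fun a => ((hM.aemeasurable_lifetime a.1).mono_ac
      cond_absolutelyContinuous).sub aemeasurable_const
  have hg : Measurable fun (e : Shock A → ℝ≥0∞) (a : {a : Fin n // a ∉ A}) =>
      ⨅ (V : Shock A) (_ : a.1 ∈ V.1), e V :=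
    measurable_pi_lambda _ fun a => Measurable.iInf fun V => Measurable.iInf fun _ =>
      measurable_pi_apply V
  have := Measure.isProbabilityMeasure_map hf
  have := Measure.isProbabilityMeasure_map (μ := shockLaw (laplaceExponent μ L) A) hg.aemeasurable
  have hleft : ∀ s : {a : Fin n // a ∉ A} → ℝ≥0,
      (ProbabilityTheory.cond μ E).map
        (fun ω (a : {a : Fin n // a ∉ A}) => lifetime L ε a.1 ω - (t : ℝ≥0∞))
        {x | ∀ a, (s a : ℝ≥0∞) < x a} =
      ENNReal.ofReal (Real.exp (-shockExponent (laplaceExponent μ L) Aᶜ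
        fun a => if h : a ∉ A then s ⟨a, h⟩ else 0)) := by
    intro s
    have key := hM.measure_history_and_survive (fun _ : Unit => t) (fun _ => A) ()
      (fun _ => le_rfl) (fun a => if h : a ∉ A then s ⟨a, h⟩ else 0)
    simp only [forall_const] at key
    rw [Measure.map_apply_of_aemeasurable hf (measurableSet_forall_lt _), cond_apply hEm]
    have hev : μ (E ∩ (fun ω (a : {a : Fin n // a ∉ A}) => lifetime L ε a.1 ω - (t : ℝ≥0∞)) ⁻¹'
        {x | ∀ a, (s a : ℝ≥0∞) < x a}) = μ {ω | failedSet L ε t ω = A ∧ ∀ a ∉ A,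
          L (t + if h : a ∉ A then s ⟨a, h⟩ else 0) ω < ε a ω} := by
      refine measure_congr (eventuallyEq_set.2 ?_)
      filter_upwards [hM.ae_goodPath] with ω hω
      refine and_congr_right fun _ => ?_
      simp only [Set.mem_preimage, Set.mem_ofPred_eq, Subtype.forall]
      refine forall₂_congr fun a ha => ?_
      rw [dif_pos ha, lt_tsub_iff_left, ← ENNReal.coe_add, ← not_le, hω.lifetime_le_iff,
        notMem_failedSet]
    rw [hev, key, ← mul_assoc, ENNReal.inv_mul_cancel hA (measure_ne_top _ _), one_mul]
  have hright : ∀ s : {a : Fin n // a ∉ A} → ℝ≥0,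
      (shockLaw (laplaceExponent μ L) A).map
        (fun e (a : {a : Fin n // a ∉ A}) => ⨅ (V : Shock A) (_ : a.1 ∈ V.1), e V)
        {x | ∀ a, (s a : ℝ≥0∞) < x a} =
      ENNReal.ofReal (Real.exp (-shockExponent (laplaceExponent μ L) Aᶜ
        fun a => if h : a ∉ A then s ⟨a, h⟩ else 0)) := by
    intro s
    rw [Measure.map_apply hg (measurableSet_forall_lt _),
      ← IsSubordinator.sum_shock_eq_shockExponent, ← hM.subordinator.shockLaw_forall_lt]
    congr 1
    ext e
    simp only [Set.mem_preimage, Set.mem_ofPred_eq, lt_biInf_iff_of_finite]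
    -- All minima exceed their thresholds exactly when each e V exceeds the largest threshold in V.
    -- V is nonempty, so this maximum is attained at a member of V.
    constructor
    · intro h V
      obtain ⟨a, ha, hsup⟩ := Finset.exists_mem_eq_sup V.1 V.2.1
        (fun a => if h : a ∉ A then s ⟨a, h⟩ else 0)
      have haA := Finset.disjoint_left.1 V.2.2 ha
      rw [hsup, dif_pos haA]
      exact h ⟨a, haA⟩ V ha
    · intro h a V haV
      refine lt_of_le_of_lt ?_ (h V)
      have := Finset.le_sup (f := fun a => if h : a ∉ A then s ⟨a, h⟩ else 0) haV
      rw [dif_pos a.2] at this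
      exact_mod_cast this
  refine measure_ext_of_survival ?_ fun s => (hleft s).trans (hright s).symm
  have := hleft 0
  rw [shockExponent_eq_zero _ _ _ fun a _ => by simp] at this
  simpa using this

end IsModel

end

/-! ### Visited states -/

open Classical in
/-- The set of values of a family in a finite type. -/
def visited {κ S : Type*} [Fintype S] (x : κ → S) : Finset S :=
  Finset.univ.filter fun r => ∃ l, x l = r

lemma mem_visited {κ S : Type*} [Fintype S] {x : κ → S} {r : S} : r ∈ visited x ↔ ∃ l, x l = r := by
  simp [visited]

section

variable {Ω : Type*} [MeasurableSpace Ω] {μ : Measure Ω} [IsProbabilityMeasure μ] {n : ℕ}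

lemma measurableSet_visited_eq {κ S : Type*} [Countable κ] [Fintype S] {X : κ → Ω → S}
    (hX : ∀ l r, MeasurableSet {ω | X l ω = r}) (R : Finset S) :
    MeasurableSet {ω | visited (fun l => X l ω) = R} := by
  have : {ω | visited (fun l => X l ω) = R} = ⋂ r, {ω | (∃ l, X l ω = r) ↔ r ∈ R} := by
    ext ω
    simp [Finset.ext_iff, mem_visited]
  rw [this]
  refine MeasurableSet.iInter fun r => ?_
  have hm : MeasurableSet {ω | ∃ l, X l ω = r} := by
    simp only [Set.ofPred_exists]
    exact MeasurableSet.iUnion fun l => hX l r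
  by_cases h : r ∈ R
  · simp only [h, iff_true]
    exact hm
  · simp only [h, iff_false]
    exact hm.compl

/-! ### Markov chains in discrete time -/

/-- The Markov property for events that depend on the whole history. -/
lemma measureReal_history_mul {S : Type*} [Fintype S] {Y : ℕ → Ω → S} {p : Matrix S S ℝ}
    (hY : ∀ l r, MeasurableSet {ω | Y l ω = r})
    (hp : ∀ (m : ℕ) (x : ℕ → S), μ.real {ω | ∀ l ≤ m + 1, Y l ω = x l} =
      μ.real {ω | ∀ l ≤ m, Y l ω = x l} * p (x m) (x (m + 1)))
    {m : ℕ} {B : (ℕ → S) → Prop} (hB : ∀ x y, (∀ l ≤ m, x l = y l) → B x → B y) {i : S}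
    (hBi : ∀ x, B x → x m = i) (j : S) :
    μ.real {ω | B (fun l => Y l ω) ∧ Y (m + 1) ω = j} =
      μ.real {ω | B fun l => Y l ω} * p i j := by
  classical
  set X : Ω → Fin (m + 1) → S := fun ω l => Y l ω with hX
  -- Past time m the extended history is constantly j, so the elementary Markov property at m gives
  -- the factor p i j.
  let ext : (Fin (m + 1) → S) → ℕ → S := fun z l => if h : l < m + 1 then z ⟨l, h⟩ else j
  have hext : ∀ z l (h : l < m + 1), ext z l = z ⟨l, h⟩ := fun z l h => dif_pos h
  have hXm : ∀ z, MeasurableSet {ω | X ω = z} := fun z => by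
    have : {ω | X ω = z} = ⋂ l : Fin (m + 1), {ω | Y l ω = z l} := by
      ext ω; simp [X, funext_iff]
    rw [this]
    exact MeasurableSet.iInter fun l => hY _ _
  have hBext : ∀ ω, B (fun l => Y l ω) ↔ B (ext (X ω)) := fun ω => by
    have h : ∀ l ≤ m, Y l ω = ext (X ω) l := fun l hl => (hext (X ω) l (by omega)).symm
    exact ⟨hB _ _ h, hB _ _ fun l hl => (h l hl).symm⟩
  have e1 := measureReal_setOf_comp (μ := μ) X hXm fun z => B (ext z)
  have e2 := measureReal_setOf_comp (μ := μ.restrict {ω | Y (m + 1) ω = j}) X hXm fun z => B (ext z)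
  have hres : ∀ E, (μ.restrict {ω | Y (m + 1) ω = j}).real E = μ.real (E ∩ {ω | Y (m + 1) ω = j}) :=
    fun E => measureReal_restrict_apply' (hY _ _)
  simp only [hres] at e2
  simp only [hBext]
  rw [e1, Finset.sum_mul]
  refine Eq.trans ?_ (e2.trans (Finset.sum_congr rfl fun z _ => ?_))
  · rfl
  split_ifs with hz
  · have h := hp m (ext z)
    have hm : ext z m = i := hBi _ hz
    have hm1 : ext z (m + 1) = j := by simp [ext]
    rw [hm, hm1] at h
    have hset : {ω | X ω = z} = {ω | ∀ l ≤ m, Y l ω = ext z l} := by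
      ext ω
      simp only [Set.mem_ofPred_eq, funext_iff, X]
      constructor
      · intro h l hl
        rw [hext z l (by omega)]
        exact h ⟨l, by omega⟩
      · intro h l
        rw [h l (by omega), hext z l l.2]
    rw [hset, ← h]
    congr 1
    ext ω
    simp only [Set.mem_inter_iff, Set.mem_ofPred_eq]
    constructor
    · rintro ⟨h1, h2⟩ l hl
      rcases Nat.lt_or_ge m l with h' | h'
      · obtain rfl : l = m + 1 := by omega
        rw [h2, hm1]
      · exact h1 l h'
    · exact fun h => ⟨fun l hl => h l (by omega), by rw [h _ le_rfl, hm1]⟩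
  · simp

/-- The states visited by a monotone sequence up to time `l` are the elements of `S`, and the
sequence is at `i` at time `l`. -/
def HistoryIs (S : Finset (Fin (n + 1))) (i : Fin (n + 1)) (l : ℕ) (x : ℕ → Fin (n + 1)) : Prop :=
  (∀ r, r ∈ S ↔ ∃ a ≤ l, x a = r) ∧ x l = i

/-- Look at the step just before the first visit to j: by monotonicity it lies in S and is at least
i, hence equals i. -/
lemma filter_visited_eq_insert_iff {x : ℕ → Fin (n + 1)} (hx : Monotone x)
    {S : Finset (Fin (n + 1))} {i j : Fin (n + 1)} (hiS : i ∈ S) (hS : ∀ r ∈ S, r ≤ i)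
    (hij : i < j) :
    (visited x).filter (· ≤ j) = insert j S ↔ ∃ l, HistoryIs S i l x ∧ x (l + 1) = j := by
  constructor
  · intro h
    have hmem : ∀ r, ((∃ l, x l = r) ∧ r ≤ j) ↔ (r = j ∨ r ∈ S) := fun r => by
      have := Finset.ext_iff.1 h r
      simpa [mem_visited] using this
    obtain ⟨⟨b, hb⟩, -⟩ := (hmem i).2 (Or.inr hiS)
    have hex : ∃ a, x a = j := ((hmem j).2 (Or.inl rfl)).1
    classical
    set a := Nat.find hex
    have ha : x a = j := Nat.find_spec hex
    have hba : b < a := by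
      by_contra hle
      have := hx (not_lt.1 hle)
      rw [hb, ha] at this
      exact absurd hij this.not_gt
    obtain ⟨l, hl⟩ : ∃ l, a = l + 1 := ⟨a - 1, by omega⟩
    have hxl : x l < j := by
      refine lt_of_le_of_ne ?_ (Nat.find_min hex (show l < a by omega))
      rw [← ha]; exact hx (by omega)
    have hxlS : x l ∈ S := ((hmem (x l)).1 ⟨⟨l, rfl⟩, hxl.le⟩).resolve_left hxl.ne
    have hxi : x l = i := le_antisymm (hS _ hxlS) (hb ▸ hx (by omega))
    refine ⟨l, ⟨fun r => ⟨fun hr => ?_, ?_⟩, hxi⟩, hl ▸ ha⟩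
    · obtain ⟨⟨c, hc⟩, -⟩ := (hmem r).2 (Or.inr hr)
      refine ⟨c, ?_, hc⟩
      by_contra hcl
      have := hx (show a ≤ c by omega)
      rw [ha, hc] at this
      exact absurd ((hS r hr).trans_lt hij) this.not_gt
    · rintro ⟨c, hcl, hc⟩
      have hlt : r < j := hc ▸ (hx hcl).trans_lt hxl
      exact ((hmem r).1 ⟨⟨c, hc⟩, hlt.le⟩).resolve_left hlt.ne
  · rintro ⟨l, ⟨h1, h2⟩, h3⟩
    ext r
    rw [Finset.mem_filter, mem_visited, Finset.mem_insert]
    constructor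
    · rintro ⟨⟨c, hc⟩, hr⟩
      rcases Nat.lt_or_ge l c with h | h
      · have := hx (show l + 1 ≤ c by omega)
        rw [h3, hc] at this
        exact Or.inl (le_antisymm hr this)
      · exact Or.inr ((h1 r).2 ⟨c, h, hc⟩)
    · rintro (rfl | hr)
      · exact ⟨⟨_, h3⟩, le_rfl⟩
      · obtain ⟨c, -, hc⟩ := (h1 r).1 hr
        exact ⟨⟨c, hc⟩, (hS r hr).trans hij.le⟩

/-- Here l is the last time spent at i; it exists because the sequence reaches n > i. -/
lemma filter_visited_eq_iff {x : ℕ → Fin (n + 1)} (hx : Monotone x)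
    (hlast : ∃ k, x k = Fin.last n) {S : Finset (Fin (n + 1))} {i : Fin (n + 1)} (hiS : i ∈ S)
    (hS : ∀ r ∈ S, r ≤ i) (hi : i < Fin.last n) :
    (visited x).filter (· ≤ i) = S ↔ ∃ l, HistoryIs S i l x ∧ x (l + 1) ≠ i := by
  constructor
  · intro h
    have hmem : ∀ r, ((∃ l, x l = r) ∧ r ≤ i) ↔ r ∈ S := fun r => by
      have := Finset.ext_iff.1 h r
      simpa [mem_visited] using this
    obtain ⟨⟨b, hb⟩, -⟩ := (hmem i).2 hiS
    have hex : ∃ a, i < x a := by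
      obtain ⟨k, hk⟩ := hlast
      exact ⟨k, hk ▸ hi⟩
    classical
    set a := Nat.find hex
    have ha : i < x a := Nat.find_spec hex
    have hba : b < a := by
      by_contra hle
      have := hx (not_lt.1 hle)
      rw [hb] at this
      exact absurd ha this.not_gt
    obtain ⟨l, hl⟩ : ∃ l, a = l + 1 := ⟨a - 1, by omega⟩
    have hxl : x l ≤ i := not_lt.1 (Nat.find_min hex (show l < a by omega))
    have hxi : x l = i := le_antisymm hxl (hb ▸ hx (by omega))
    refine ⟨l, ⟨fun r => ⟨fun hr => ?_, ?_⟩, hxi⟩, (hl ▸ ha).ne'⟩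
    · obtain ⟨⟨c, hc⟩, -⟩ := (hmem r).2 hr
      refine ⟨c, ?_, hc⟩
      by_contra hcl
      have := hx (show a ≤ c by omega)
      rw [hc] at this
      exact absurd (ha.trans_le this) (hS r hr).not_gt
    · rintro ⟨c, hcl, hc⟩
      exact (hmem r).1 ⟨⟨c, hc⟩, hc ▸ (hx hcl).trans hxl⟩
  · rintro ⟨l, ⟨h1, h2⟩, h3⟩
    ext r
    rw [Finset.mem_filter, mem_visited]
    constructor
    · rintro ⟨⟨c, hc⟩, hr⟩
      rcases Nat.lt_or_ge l c with h | h
      · have h4 := hx (show l + 1 ≤ c by omega)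
        have h5 := hx (show l ≤ l + 1 by omega)
        rw [hc] at h4
        rw [h2] at h5
        exact absurd (le_antisymm (h4.trans hr) h5) h3
      · exact (h1 r).2 ⟨c, h, hc⟩
    · intro hr
      obtain ⟨c, -, hc⟩ := (h1 r).1 hr
      exact ⟨⟨c, hc⟩, hS r hr⟩

/-- For a monotone Markov chain in discrete time, the probability that the next state visited
after `i` is `j`, given the states visited up to `i`, is `p i j / (1 - p i i)`. -/
lemma measureReal_visited_mul {Y : ℕ → Ω → Fin (n + 1)} {p : Matrix (Fin (n + 1)) (Fin (n + 1)) ℝ}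
    (hY : ∀ l r, MeasurableSet {ω | Y l ω = r})
    (hp : ∀ (m : ℕ) (x : ℕ → Fin (n + 1)), μ.real {ω | ∀ l ≤ m + 1, Y l ω = x l} =
      μ.real {ω | ∀ l ≤ m, Y l ω = x l} * p (x m) (x (m + 1)))
    (hmono : ∀ᵐ ω ∂μ, Monotone fun l => Y l ω)
    (hlast : ∀ᵐ ω ∂μ, ∃ k, Y k ω = Fin.last n)
    {S : Finset (Fin (n + 1))} {i j : Fin (n + 1)} (hiS : i ∈ S) (hS : ∀ r ∈ S, r ≤ i)
    (hij : i < j) (hpij : 0 ≤ p i j) (hpii : p i i ≤ 1) :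
    μ.real {ω | (visited fun l => Y l ω).filter (· ≤ j) = insert j S} * (1 - p i i) =
      μ.real {ω | (visited fun l => Y l ω).filter (· ≤ i) = S} * p i j := by
  have hi : i < Fin.last n := hij.trans_le (Fin.le_last j)
  set F : ℕ → Set Ω := fun l => {ω | HistoryIs S i l fun l => Y l ω} with hF
  have hFm : ∀ l, MeasurableSet (F l) := fun l => by
    have : F l = (⋂ r, {ω | r ∈ S ↔ ∃ a ≤ l, Y a ω = r}) ∩ {ω | Y l ω = i} := by
      ext ω; simp [F, HistoryIs]
    rw [this]
    refine (MeasurableSet.iInter fun r => ?_).inter (hY l i)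
    have hm : MeasurableSet {ω | ∃ a ≤ l, Y a ω = r} := by
      have : {ω | ∃ a ≤ l, Y a ω = r} = ⋃ a ∈ Set.Iic l, {ω | Y a ω = r} := by ext; simp
      rw [this]
      exact MeasurableSet.biUnion (Set.to_countable _) fun a _ => hY a r
    by_cases h : r ∈ S
    · simp only [h, true_iff]
      exact hm
    · simp only [h, false_iff]
      exact hm.compl
  have hmark : ∀ l j, μ.real (F l ∩ {ω | Y (l + 1) ω = j}) = μ.real (F l) * p i j := fun l j =>
    measureReal_history_mul hY hp (B := HistoryIs S i l) (fun x y hxy hx => by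
      refine ⟨fun r => (hx.1 r).trans ⟨?_, ?_⟩, by rw [← hxy l le_rfl]; exact hx.2⟩
      · rintro ⟨a, ha, h⟩; exact ⟨a, ha, by rw [← hxy a ha]; exact h⟩
      · rintro ⟨a, ha, h⟩; exact ⟨a, ha, by rw [hxy a ha]; exact h⟩) (fun x hx => hx.2) j
  have h1 : ∀ l, μ (F l ∩ {ω | Y (l + 1) ω = j}) = μ (F l) * ENNReal.ofReal (p i j) := fun l => by
    rw [← ofReal_measureReal, hmark, ENNReal.ofReal_mul measureReal_nonneg, ofReal_measureReal]
  have h2 : ∀ l, μ (F l ∩ {ω | Y (l + 1) ω = i}ᶜ) = μ (F l) * ENNReal.ofReal (1 - p i i) :=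
    fun l => by
    have h := measureReal_inter_add_sdiff (μ := μ) (s := F l) (hY (l + 1) i)
    rw [hmark, Set.sdiff_eq] at h
    rw [← ofReal_measureReal (s := F l ∩ {ω | Y (l + 1) ω = i}ᶜ),
      show μ.real (F l ∩ {ω | Y (l + 1) ω = i}ᶜ) = μ.real (F l) * (1 - p i i) by linarith,
      ENNReal.ofReal_mul measureReal_nonneg, ofReal_measureReal]
  -- The events are split by the time l of the jump to j. The series ∑ μ(F l) is common to both
  -- sides, and in [0, ∞] its convergence is not an issue.
  have hD : μ {ω | (visited fun l => Y l ω).filter (· ≤ j) = insert j S} =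
      (∑' l, μ (F l)) * ENNReal.ofReal (p i j) := by
    rw [← ENNReal.tsum_mul_right, ← tsum_congr h1, ← measure_iUnion]
    · refine measure_congr (eventuallyEq_set.2 ?_)
      filter_upwards [hmono] with ω hω
      simp only [Set.mem_ofPred_eq, filter_visited_eq_insert_iff hω hiS hS hij, Set.mem_iUnion,
        Set.mem_inter_iff, F]
    · have key : ∀ l l', l < l' → Disjoint (F l ∩ {ω | Y (l + 1) ω = j})
          (F l' ∩ {ω | Y (l' + 1) ω = j}) := fun l l' hll => by
        refine Set.disjoint_left.2 fun ω hω hω' => ?_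
        have : j ∈ S := (hω'.1.1 j).2 ⟨l + 1, by omega, hω.2⟩
        exact absurd hij (hS j this).not_gt
      intro l l' hne
      rcases lt_or_gt_of_ne hne with h | h
      · exact key _ _ h
      · exact (key _ _ h).symm
    · exact fun l => (hFm l).inter (hY _ _)
  -- The same series, now split by the last time l spent at i, after which the chain leaves with
  -- probability 1 - p i i.
  have hC : μ {ω | (visited fun l => Y l ω).filter (· ≤ i) = S} =
      (∑' l, μ (F l)) * ENNReal.ofReal (1 - p i i) := by
    rw [← ENNReal.tsum_mul_right, ← tsum_congr h2, ← measure_iUnion₀]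
    · refine measure_congr (eventuallyEq_set.2 ?_)
      filter_upwards [hmono, hlast] with ω hω hω'
      simp only [Set.mem_ofPred_eq, filter_visited_eq_iff hω hω' hiS hS hi, Set.mem_iUnion,
        Set.mem_inter_iff, F, Set.mem_compl_iff, ne_eq]
    · have key : ∀ l l', l < l' → AEDisjoint μ (F l ∩ {ω | Y (l + 1) ω = i}ᶜ)
          (F l' ∩ {ω | Y (l' + 1) ω = i}ᶜ) := fun l l' hll => by
        refine measure_mono_null (t := {ω | ¬ Monotone fun l => Y l ω}) ?_ hmono
        rintro ω ⟨hω, hω'⟩ hm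
        refine hω.2 ?_
        have h3 : Y l ω ≤ Y (l + 1) ω := hm (Nat.le_succ l)
        have h4 : Y (l + 1) ω ≤ Y l' ω := hm hll
        have h5 : Y l ω = i := hω.1.2
        have h6 : Y l' ω = i := hω'.1.2
        rw [h5] at h3
        rw [h6] at h4
        exact le_antisymm h4 h3
      intro l l' hne
      rcases lt_or_gt_of_ne hne with h | h
      · exact key _ _ h
      · exact (key _ _ h).symm
    · exact fun l => ((hFm l).inter (hY _ _).compl).nullMeasurableSet
  rw [measureReal_def, measureReal_def, ← ENNReal.toReal_ofReal hpij,
    ← ENNReal.toReal_ofReal (sub_nonneg.2 hpii), ← ENNReal.toReal_mul, ← ENNReal.toReal_mul, hD, hC]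
  congr 1
  ring

/-! ### Monotone Markov chains in continuous time -/

/-- A rational q is a multiple of 1/k! once k is at least its denominator, and there are only
finitely many states to catch. -/
lemma eventually_visited_grid_eq (f : ℝ≥0 → Fin (n + 1)) :
    ∀ᶠ k : ℕ in atTop, visited (fun l : ℕ => f (l * ((k.factorial : ℝ≥0))⁻¹)) =
      visited fun q : ℚ≥0 => f q := by
  have h1 : ∀ r ∈ visited (fun q : ℚ≥0 => f q), ∀ᶠ k : ℕ in atTop,
      r ∈ visited fun l : ℕ => f (l * ((k.factorial : ℝ≥0))⁻¹) := by
    intro r hr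
    obtain ⟨q, rfl⟩ := mem_visited.1 hr
    filter_upwards [eventually_ge_atTop q.den] with k hk
    obtain ⟨c, hc⟩ := Nat.dvd_factorial q.den_pos hk
    refine mem_visited.2 ⟨q.num * c, ?_⟩
    congr 1
    have hd : (q.den : ℝ≥0) ≠ 0 := by exact_mod_cast q.den_ne_zero
    have hc0 : (c : ℝ≥0) ≠ 0 := by
      rintro h
      have : c = 0 := by exact_mod_cast h
      rw [this, mul_zero] at hc
      exact Nat.factorial_ne_zero k hc
    rw [hc, NNRat.cast_def]
    push_cast
    field_simp
  filter_upwards [(Finset.eventually_all (visited fun q : ℚ≥0 => f q)).2 h1] with k hk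
  refine Finset.Subset.antisymm (fun r hr => ?_) hk
  obtain ⟨l, rfl⟩ := mem_visited.1 hr
  refine mem_visited.2 ⟨l * ((k.factorial : ℚ≥0))⁻¹, ?_⟩
  push_cast
  rfl

/-- For a monotone Markov chain in continuous time with generator `G`, the probability that the
next state visited after `i` is `j`, given the states visited up to `i`, is `-G i j / G i i`. -/
lemma IsCTMC.measureReal_visited_mul {X : ℝ≥0 → Ω → Fin (n + 1)}
    {G : Matrix (Fin (n + 1)) (Fin (n + 1)) ℝ} (hX : IsCTMC μ X G)
    (hmono : ∀ᵐ ω ∂μ, Monotone fun t => X t ω)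
    (hlast : ∀ᵐ ω ∂μ, ∃ t, X t ω = Fin.last n)
    {S : Finset (Fin (n + 1))} {i j : Fin (n + 1)} (hiS : i ∈ S) (hS : ∀ r ∈ S, r ≤ i)
    (hij : i < j) :
    μ.real {ω | (visited fun q : ℚ≥0 => X q ω).filter (· ≤ j) = insert j S} * -G i i =
      μ.real {ω | (visited fun q : ℚ≥0 => X q ω).filter (· ≤ i) = S} * G i j := by
  obtain ⟨p, -, hp0, hp1, -, hG, hmk⟩ := hX.markov
  let δ : ℕ → ℝ≥0 := fun k => ((k.factorial : ℝ≥0))⁻¹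
  have hδpos : ∀ k, 0 < δ k := fun k => by
    have : (0 : ℝ≥0) < k.factorial := by exact_mod_cast k.factorial_pos
    positivity
  have hδ : Tendsto δ atTop (𝓝[>] 0) := by
    refine tendsto_nhdsWithin_iff.2 ⟨?_, Eventually.of_forall hδpos⟩
    refine (tendsto_inv_atTop_zero (𝕜 := ℝ≥0)).comp ?_
    exact tendsto_natCast_atTop_atTop.comp
      (tendsto_atTop_mono Nat.self_le_factorial tendsto_id)
  let Y : ℕ → ℕ → Ω → Fin (n + 1) := fun k l ω => X (l * δ k) ω
  have hYm : ∀ k l r, MeasurableSet {ω | Y k l ω = r} := fun k l r => hX.measurable _ _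
  have hle : ∀ k, p (δ k) i i ≤ 1 := fun k => by
    rw [← hp1 (δ k) i]
    exact Finset.single_le_sum (f := fun j => p (δ k) i j) (fun j _ => hp0 _ i j) (Finset.mem_univ i)
  have hgrid : ∀ k, μ.real {ω | (visited fun l => Y k l ω).filter (· ≤ j) = insert j S} *
      (1 - p (δ k) i i) =
      μ.real {ω | (visited fun l => Y k l ω).filter (· ≤ i) = S} * p (δ k) i j := by
    intro k
    refine LFMO.measureReal_visited_mul (hYm k) (fun m x => ?_) ?_ ?_ hiS hS hij (hp0 _ _ _) (hle k)
    · have hm : Monotone fun l : ℕ => (l : ℝ≥0) * δ k := fun a b hab => by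
        have : (a : ℝ≥0) ≤ b := by exact_mod_cast hab
        exact mul_le_mul_left this _
      have := hmk m (fun l : ℕ => (l : ℝ≥0) * δ k) hm x
      have hsub : ((m + 1 : ℕ) : ℝ≥0) * δ k - m * δ k = δ k := by
        rw [Nat.cast_succ, add_mul, one_mul, add_tsub_cancel_left]
      rw [hsub] at this
      exact this
    · filter_upwards [hmono] with ω hω a b hab
      have : (a : ℝ≥0) ≤ b := by exact_mod_cast hab
      exact hω (mul_le_mul_left this _)
    · filter_upwards [hmono, hlast] with ω hω ⟨t, ht⟩
      obtain ⟨l, hl⟩ := exists_nat_ge (t * (δ k)⁻¹)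
      refine ⟨l, le_antisymm (Fin.le_last _) (ht ▸ hω ?_)⟩
      rwa [mul_inv_le_iff₀ (hδpos k)] at hl
  -- For each ω the indicator of the grid event is eventually that of the limit event, which gives
  -- convergence of probabilities.
  have hlim : ∀ (i : Fin (n + 1)) (S : Finset (Fin (n + 1))),
      Tendsto (fun k => μ.real {ω | (visited fun l => Y k l ω).filter (· ≤ i) = S}) atTop
        (𝓝 (μ.real {ω | (visited fun q : ℚ≥0 => X q ω).filter (· ≤ i) = S})) := by
    intro i S
    refine (ENNReal.tendsto_toReal (measure_ne_top _ _)).comp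
      (tendsto_measure_of_tendsto_indicator_of_isFiniteMeasure atTop μ (fun k => ?_) fun ω => ?_)
    · exact measurableSet_setOf_comp _ (measurableSet_visited_eq (hYm k)) fun R =>
        R.filter (· ≤ i) = S
    · filter_upwards [eventually_visited_grid_eq fun t => X t ω] with k hk
      simp only [Y, δ, hk]
  have hii : Tendsto (fun k => (1 - p (δ k) i i) / (δ k : ℝ)) atTop (𝓝 (-G i i)) := by
    refine ((hG i i).comp hδ).neg.congr fun k => ?_
    simp only [Function.comp, Matrix.one_apply_eq]
    ring
  have hijl : Tendsto (fun k => p (δ k) i j / (δ k : ℝ)) atTop (𝓝 (G i j)) := by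
    refine ((hG i j).comp hδ).congr fun k => ?_
    simp only [Function.comp, Matrix.one_apply_ne hij.ne, sub_zero]
  refine tendsto_nhds_unique ((hlim j (insert j S)).mul hii) (((hlim i S).mul hijl).congr fun k => ?_)
  rw [← mul_div_assoc, ← mul_div_assoc, hgrid]

end

/-! ### The increasing enumeration of the visited states -/

section Chain

variable {n : ℕ} {R : Finset (Fin (n + 1))} {a i j : Fin (n + 1)} {m : ℕ}

/-- The least element of `R` above `a`, or `n` if there is none. -/
def succVal (R : Finset (Fin (n + 1))) (a : Fin (n + 1)) : Fin (n + 1) :=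
  if h : (R.filter (a < ·)).Nonempty then (R.filter (a < ·)).min' h else Fin.last n

/-- The elements of `R` in increasing order, starting at `0` and stopped at `n`. -/
def chain (R : Finset (Fin (n + 1))) : ℕ → Fin (n + 1)
  | 0 => 0
  | m + 1 => succVal R (chain R m)

lemma succVal_last : succVal R (Fin.last n) = Fin.last n := by
  rw [succVal, dif_neg]
  rintro ⟨r, hr⟩
  exact absurd (Finset.mem_filter.1 hr).2 (Fin.le_last r).not_gt

lemma succVal_spec (hl : Fin.last n ∈ R) (ha : a < Fin.last n) :
    succVal R a ∈ R ∧ a < succVal R a ∧ ∀ r ∈ R, a < r → succVal R a ≤ r := by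
  have hne : (R.filter (a < ·)).Nonempty := ⟨_, Finset.mem_filter.2 ⟨hl, ha⟩⟩
  rw [succVal, dif_pos hne]
  have := Finset.mem_filter.1 (Finset.min'_mem _ hne)
  exact ⟨this.1, this.2, fun r hr har => Finset.min'_le _ _ (Finset.mem_filter.2 ⟨hr, har⟩)⟩

lemma succVal_eq_iff (hl : Fin.last n ∈ R) (ha : a < Fin.last n) :
    succVal R a = j ↔ j ∈ R ∧ a < j ∧ ∀ r ∈ R, a < r → j ≤ r := by
  obtain ⟨h1, h2, h3⟩ := succVal_spec hl ha
  constructor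
  · rintro rfl; exact ⟨h1, h2, h3⟩
  · rintro ⟨h4, h5, h6⟩
    exact le_antisymm (h3 _ h4 h5) (h6 _ h1 h2)

lemma succVal_mem (hl : Fin.last n ∈ R) : succVal R a ∈ R := by
  rcases (Fin.le_last a).lt_or_eq with h | rfl
  · exact (succVal_spec hl h).1
  · rwa [succVal_last]

/-- Expresses the next element through the traces of R on initial segments, the events whose
probabilities are known. -/
lemma succVal_eq_iff_filter (hl : Fin.last n ∈ R) (haj : a < j) :
    succVal R a = j ↔ R.filter (· ≤ j) = insert j (R.filter (· ≤ a)) := by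
  rw [succVal_eq_iff hl (haj.trans_le (Fin.le_last j))]
  constructor
  · rintro ⟨h1, -, h2⟩
    ext r
    rw [Finset.mem_filter, Finset.mem_insert, Finset.mem_filter]
    constructor
    · rintro ⟨hr, hrj⟩
      rcases le_or_gt r a with h | h
      · exact Or.inr ⟨hr, h⟩
      · exact Or.inl (le_antisymm hrj (h2 r hr h))
    · rintro (rfl | ⟨hr, hra⟩)
      · exact ⟨h1, le_rfl⟩
      · exact ⟨hr, hra.trans haj.le⟩
  · intro h
    have hj : j ∈ R := (Finset.mem_filter.1 (h ▸ Finset.mem_insert_self j _)).1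
    refine ⟨hj, haj, fun r hr har => ?_⟩
    by_contra hjr
    have : r ∈ R.filter (· ≤ j) := Finset.mem_filter.2 ⟨hr, (not_le.1 hjr).le⟩
    rw [h, Finset.mem_insert, Finset.mem_filter] at this
    rcases this with rfl | ⟨-, h'⟩
    · exact hjr le_rfl
    · exact absurd har h'.not_gt

lemma chain_mem (h0 : 0 ∈ R) (hl : Fin.last n ∈ R) (m : ℕ) : chain R m ∈ R := by
  cases m with
  | zero => exact h0
  | succ m => exact succVal_mem hl

lemma chain_lt_succ (hl : Fin.last n ∈ R) (h : chain R m < Fin.last n) :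
    chain R m < chain R (m + 1) := (succVal_spec hl h).2.1

lemma chain_mono (hl : Fin.last n ∈ R) : Monotone (chain R) := by
  refine monotone_nat_of_le_succ fun m => ?_
  rcases (Fin.le_last (chain R m)).lt_or_eq with h | h
  · exact (chain_lt_succ hl h).le
  · rw [chain, h, succVal_last]

/-- The chain is strictly increasing until it reaches n. Hence n steps suffice for absorption, and a
state i < n can only occur within the first i steps. -/
lemma le_chain (hl : Fin.last n ∈ R) (h : chain R m < Fin.last n) : m ≤ (chain R m : ℕ) := by
  induction m with
  | zero => exact Nat.zero_le _
  | succ m ih =>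
    have h1 : chain R m < Fin.last n := (chain_mono hl (Nat.le_succ m)).trans_lt h
    exact (ih h1).trans_lt (chain_lt_succ hl h1)

lemma exists_chain_eq_last (hl : Fin.last n ∈ R) : chain R n = Fin.last n := by
  rcases (Fin.le_last (chain R n)).lt_or_eq with h | h
  · have h1 := le_chain hl h
    have h2 : (chain R n : ℕ) < n := h
    omega
  · exact h

lemma exists_chain_eq (hl : Fin.last n ∈ R) (hi : i ∈ R) : ∃ m, chain R m = i := by
  classical
  have hex : ∃ m, i ≤ chain R m := ⟨n, by rw [exists_chain_eq_last hl]; exact Fin.le_last i⟩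
  rcases hm : Nat.find hex with _ | l
  · have := Nat.find_spec hex
    rw [hm] at this
    exact ⟨0, le_antisymm (Fin.zero_le _) this⟩
  · have h1 := Nat.find_spec hex
    rw [hm] at h1
    have h2 : chain R l < i := not_le.1 (Nat.find_min hex (show l < Nat.find hex by omega))
    refine ⟨l + 1, le_antisymm ?_ h1⟩
    exact (succVal_spec hl (h2.trans_le (Fin.le_last i))).2.2 _ hi h2

/-- No element of R lies strictly between consecutive values of the chain, so the step crossing i
lands on the first element above i, whether or not i belongs to R. -/
lemma succVal_chain_of_le_of_lt (hl : Fin.last n ∈ R) (h1 : chain R m ≤ i)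
    (h2 : i < chain R (m + 1)) : chain R (m + 1) = succVal R i := by
  have hi : i < Fin.last n := h2.trans_le (Fin.le_last _)
  obtain ⟨h3, -, h5⟩ := succVal_spec hl (h1.trans_lt hi)
  exact ((succVal_eq_iff hl hi).2 ⟨h3, h2, fun r hr hir => h5 r hr (h1.trans_lt hir)⟩).symm

lemma exists_chain_crossing (hl : Fin.last n ∈ R) (hi : i < Fin.last n) :
    ∃ m, chain R m ≤ i ∧ chain R (m + 1) = succVal R i := by
  classical
  have hex : ∃ m, i < chain R m := ⟨n, by rwa [exists_chain_eq_last hl]⟩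
  rcases hm : Nat.find hex with _ | l
  · have := Nat.find_spec hex
    rw [hm] at this
    exact absurd this (Fin.zero_le i).not_gt
  · have h1 := Nat.find_spec hex
    rw [hm] at h1
    have h2 := not_lt.1 (Nat.find_min hex (show l < Nat.find hex by omega))
    exact ⟨l, h2, succVal_chain_of_le_of_lt hl h2 h1⟩

lemma filter_le_eq_image_chain (h0 : 0 ∈ R) (hl : Fin.last n ∈ R) (h : chain R m < Fin.last n) :
    R.filter (· ≤ chain R m) = (Finset.range (m + 1)).image (chain R) := by
  induction m with
  | zero =>
    ext r
    simp only [chain, Finset.mem_filter, Fin.le_zero_iff, zero_add, Finset.range_one,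
      Finset.image_singleton, Finset.mem_singleton]
    exact ⟨fun h => h.2, fun h => ⟨h ▸ h0, h⟩⟩
  | succ m ih =>
    have h1 : chain R m < Fin.last n := (chain_mono hl (Nat.le_succ m)).trans_lt h
    rw [(succVal_eq_iff_filter hl (chain_lt_succ hl h1)).1 rfl, ih h1,
      Finset.range_add_one (n := m + 1), Finset.image_insert]

/-- Below n, knowing the first m steps of the chain is the same as knowing R up to the current
state. -/
lemma chain_eq_iff_filter {R₀ : Finset (Fin (n + 1))} (h0 : 0 ∈ R) (hl : Fin.last n ∈ R)
    (h0' : 0 ∈ R₀) (hl' : Fin.last n ∈ R₀) (h : chain R₀ m < Fin.last n) :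
    (∀ l ≤ m, chain R l = chain R₀ l) ↔
      R.filter (· ≤ chain R₀ m) = R₀.filter (· ≤ chain R₀ m) := by
  constructor
  · intro heq
    rw [filter_le_eq_image_chain h0' hl' h, ← heq m le_rfl,
      filter_le_eq_image_chain h0 hl (by rwa [heq m le_rfl])]
    refine Finset.image_congr fun l hl => heq l ?_
    have := Finset.mem_range.1 hl
    omega
  · intro hf
    have hmem : ∀ r, r ≤ chain R₀ m → (r ∈ R ↔ r ∈ R₀) := fun r hr => by
      have := Finset.ext_iff.1 hf r
      simpa [hr] using this
    intro l
    induction l with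
    | zero => exact fun _ => rfl
    | succ l ih =>
      intro hlm
      have h1 : chain R₀ l < Fin.last n := (chain_mono hl' (show l ≤ m by omega)).trans_lt h
      have h2 : chain R₀ (l + 1) ≤ chain R₀ m := chain_mono hl' hlm
      rw [chain, ih (by omega), succVal_eq_iff hl h1]
      obtain ⟨h3, h4, h5⟩ := succVal_spec hl' h1
      refine ⟨(hmem _ h2).2 h3, h4, fun r hr har => ?_⟩
      rcases le_or_gt r (chain R₀ m) with h6 | h6
      · exact h5 r ((hmem r h6).1 hr) har
      · exact h2.trans h6.le

end Chain

/-! ### The law of the enumeration -/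

section ChainLaw

variable {Ω : Type*} [MeasurableSpace Ω] {μ : Measure Ω} {n : ℕ}
  {R : Ω → Finset (Fin (n + 1))} {p : Matrix (Fin (n + 1)) (Fin (n + 1)) ℝ}

/-- The random set `R` contains the end points, and the probability that its next element after
`i` is `j`, given its elements up to `i`, is `p i j`. -/
structure IsRegenerative (μ : Measure Ω) (R : Ω → Finset (Fin (n + 1)))
    (p : Matrix (Fin (n + 1)) (Fin (n + 1)) ℝ) : Prop where
  measurable : ∀ S, MeasurableSet {ω | R ω = S}
  ends : ∀ᵐ ω ∂μ, 0 ∈ R ω ∧ Fin.last n ∈ R ω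
  next : ∀ (S : Finset (Fin (n + 1))) (i j : Fin (n + 1)), i ∈ S → (∀ r ∈ S, r ≤ i) → i < j →
    μ.real {ω | (R ω).filter (· ≤ j) = insert j S} =
      μ.real {ω | (R ω).filter (· ≤ i) = S} * p i j
  apply_le : ∀ i j, i < Fin.last n → j ≤ i → p i j = 0
  apply_last : ∀ j, p (Fin.last n) j = if j = Fin.last n then 1 else 0

namespace IsRegenerative

lemma measurableSet (hR : IsRegenerative μ R p) (P : Finset (Fin (n + 1)) → Prop) :
    MeasurableSet {ω | P (R ω)} :=
  measurableSet_setOf_comp R hR.measurable P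

/-- A history that ends below n is an event about the trace of R on an initial segment, so the
hypothesis `next` gives the one-step factor. A history that no admissible R realises has probability
zero. -/
lemma chain_markov (hR : IsRegenerative μ R p) (m : ℕ) (x : ℕ → Fin (n + 1)) :
    μ.real {ω | ∀ l ≤ m + 1, chain (R ω) l = x l} =
      μ.real {ω | ∀ l ≤ m, chain (R ω) l = x l} * p (x m) (x (m + 1)) := by
  have hsplit : ∀ R : Finset (Fin (n + 1)), (∀ l ≤ m + 1, chain R l = x l) ↔
      (∀ l ≤ m, chain R l = x l) ∧ succVal R (x m) = x (m + 1) := fun R => by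
    constructor
    · exact fun h => ⟨fun l hl => h l (by omega), by rw [← h (m + 1) le_rfl, ← h m (by omega)]; rfl⟩
    · rintro ⟨h1, h2⟩ l hl
      rcases Nat.lt_or_ge m l with h' | h'
      · obtain rfl : l = m + 1 := by omega
        rw [chain, h1 m le_rfl, h2]
      · exact h1 l h'
  simp only [hsplit]
  have hnull : ∀ E : Set Ω, (∀ ω ∈ E, ¬ (0 ∈ R ω ∧ Fin.last n ∈ R ω)) → μ.real E = 0 := by
    intro E hE
    rw [measureReal_def, measure_mono_null hE hR.ends, ENNReal.toReal_zero]
  by_cases hex : ∃ R₀ : Finset (Fin (n + 1)), 0 ∈ R₀ ∧ Fin.last n ∈ R₀ ∧ ∀ l ≤ m, chain R₀ l = x l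
  swap
  · push Not at hex
    rw [hnull, hnull, zero_mul]
    · intro ω hω hR'
      obtain ⟨l, hl, hne⟩ := hex _ hR'.1 hR'.2
      exact hne (hω l hl)
    · intro ω hω hR'
      obtain ⟨l, hl, hne⟩ := hex _ hR'.1 hR'.2
      exact hne (hω.1 l hl)
  obtain ⟨R₀, h0, hl, hx⟩ := hex
  rcases (Fin.le_last (x m)).lt_or_eq with hm | hm
  swap
  · rw [hm, hR.apply_last]
    simp only [succVal_last]
    split_ifs with h
    · simp [h]
    · simp [Ne.symm h]
  rcases le_or_gt (x (m + 1)) (x m) with hle | hlt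
  · rw [hR.apply_le _ _ hm hle, mul_zero]
    refine hnull _ fun ω hω hR' => ?_
    have := (succVal_spec hR'.2 hm).2.1
    rw [hω.2] at this
    exact absurd this hle.not_gt
  set S := R₀.filter (· ≤ x m) with hS
  have hxm := hx m le_rfl
  have hiS : x m ∈ S := by
    rw [hS, Finset.mem_filter, ← hxm]
    exact ⟨chain_mem h0 hl m, le_rfl⟩
  have hiff : ∀ R : Finset (Fin (n + 1)), 0 ∈ R → Fin.last n ∈ R →
      ((∀ l ≤ m, chain R l = x l) ↔ R.filter (· ≤ x m) = S) := fun R h0' hl' => by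
    rw [hS, ← hxm, ← chain_eq_iff_filter h0' hl' h0 hl (by rwa [hxm])]
    exact forall₂_congr fun l hl => by rw [hx l hl]
  have hins : ∀ R : Finset (Fin (n + 1)), R.filter (· ≤ x (m + 1)) = insert (x (m + 1)) S →
      R.filter (· ≤ x m) = S := fun R h => by
    have hmem := fun r => Finset.ext_iff.1 h r
    ext r
    have := hmem r
    rw [Finset.mem_filter, Finset.mem_insert] at this
    rw [Finset.mem_filter]
    have hSr : r ∈ S → r ≤ x m := fun h => (Finset.mem_filter.1 h).2
    constructor
    · rintro ⟨h1, h2⟩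
      exact (this.1 ⟨h1, h2.trans hlt.le⟩).resolve_left (h2.trans_lt hlt).ne
    · exact fun hr => ⟨(this.2 (Or.inr hr)).1, hSr hr⟩
  have e1 : μ.real {ω | ∀ l ≤ m, chain (R ω) l = x l} =
      μ.real {ω | (R ω).filter (· ≤ x m) = S} := by
    refine measureReal_congr (eventuallyEq_set.2 ?_)
    filter_upwards [hR.ends] with ω hω using hiff _ hω.1 hω.2
  rw [e1, ← hR.next S _ _ hiS (fun r hr => (Finset.mem_filter.1 hr).2) hlt]
  refine measureReal_congr (eventuallyEq_set.2 ?_)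
  filter_upwards [hR.ends] with ω hω
  simp only [hiff _ hω.1 hω.2, succVal_eq_iff_filter hω.2 hlt]
  constructor
  · rintro ⟨h1, h2⟩
    rw [h2, h1]
  · intro h
    have := hins _ h
    exact ⟨this, by rw [this]; exact h⟩

lemma chain_measurable (hR : IsRegenerative μ R p) (l : ℕ) (i : Fin (n + 1)) :
    MeasurableSet {ω | chain (R ω) l = i} := hR.measurableSet fun R => chain R l = i

variable [IsProbabilityMeasure μ]

/-- Given that `i` is an element of `R`, the next element is `j` with probability `p i j`. -/
lemma measureReal_mem_succVal (hR : IsRegenerative μ R p) {i j : Fin (n + 1)} (hij : i < j) :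
    μ.real {ω | i ∈ R ω ∧ succVal (R ω) i = j} = μ.real {ω | i ∈ R ω} * p i j := by
  have hXm : ∀ S, MeasurableSet {ω | (R ω).filter (· ≤ i) = S} := fun S =>
    hR.measurableSet fun R => R.filter (· ≤ i) = S
  have hE : MeasurableSet {ω | succVal (R ω) i = j} := hR.measurableSet fun R => succVal R i = j
  have e1 := measureReal_setOf_comp (μ := μ) (fun ω => (R ω).filter (· ≤ i)) hXm (i ∈ ·)
  have e2 := measureReal_setOf_comp (μ := μ.restrict {ω | succVal (R ω) i = j})
    (fun ω => (R ω).filter (· ≤ i)) hXm (i ∈ ·)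
  simp only [measureReal_restrict_apply' hE] at e2
  simp only [Finset.mem_filter, le_refl, and_true] at e1 e2
  rw [e1, Finset.sum_mul]
  refine e2.trans (Finset.sum_congr rfl fun S _ => ?_)
  split_ifs with hiS
  swap
  · simp
  by_cases hS : ∀ r ∈ S, r ≤ i
  · rw [← hR.next S i j hiS hS hij]
    refine measureReal_congr (eventuallyEq_set.2 ?_)
    filter_upwards [hR.ends] with ω hω
    simp only [Set.mem_inter_iff, Set.mem_ofPred_eq, succVal_eq_iff_filter hω.2 hij]
    constructor
    · rintro ⟨h1, h2⟩
      rw [h2, h1]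
    · intro h
      have : (R ω).filter (· ≤ i) = S := by
        ext r
        have := Finset.ext_iff.1 h r
        rw [Finset.mem_filter, Finset.mem_insert] at this
        rw [Finset.mem_filter]
        constructor
        · rintro ⟨h1, h2⟩
          exact (this.1 ⟨h1, h2.trans hij.le⟩).resolve_left (h2.trans_lt hij).ne
        · exact fun hr => ⟨(this.2 (Or.inr hr)).1, hS r hr⟩
      exact ⟨this, by rw [this]; exact h⟩
  · have : {ω | (R ω).filter (· ≤ i) = S} = ∅ := by
      ext ω
      simp only [Set.mem_ofPred_eq, Set.mem_empty_iff_false, iff_false]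
      rintro rfl
      exact hS fun r hr => (Finset.mem_filter.1 hr).2
    simp [this]

lemma measureReal_chain_succ (hR : IsRegenerative μ R p) (l : ℕ) (i j : Fin (n + 1)) :
    μ.real {ω | chain (R ω) l = i ∧ chain (R ω) (l + 1) = j} =
      μ.real {ω | chain (R ω) l = i} * p i j :=
  measureReal_history_mul (Y := fun l ω => chain (R ω) l) hR.chain_measurable hR.chain_markov
    (B := fun x => x l = i) (fun x y h hx => by rw [← h l le_rfl]; exact hx) (fun x hx => hx) j

/-- The law of the chain at step `l`, outside the absorbing state. -/
lemma measureReal_chain_eq_pow (hR : IsRegenerative μ R p)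
    {q : Matrix (Fin (n + 1)) (Fin (n + 1)) ℝ} (hq : ∀ i j, i < Fin.last n → q i j = p i j)
    (hql : ∀ j, q (Fin.last n) j = 0) (l : ℕ) {i : Fin (n + 1)} (hi : i < Fin.last n) :
    μ.real {ω | chain (R ω) l = i} = (q ^ l) 0 i := by
  induction l generalizing i with
  | zero =>
    rw [pow_zero, Matrix.one_apply]
    split_ifs with h
    · simp [chain, h]
    · simp [chain, h]
  | succ l ih =>
    have e := measureReal_setOf_comp (μ := μ.restrict {ω | chain (R ω) (l + 1) = i})
      (fun ω => chain (R ω) l) (hR.chain_measurable l) fun _ => True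
    simp only [measureReal_restrict_apply' (hR.chain_measurable (l + 1) i), if_true] at e
    rw [pow_succ, Matrix.mul_apply]
    have e' : μ.real {ω | chain (R ω) (l + 1) = i} = μ.real ({ω | True} ∩ {ω | chain (R ω) (l + 1) = i}) := by
      congr 1; ext; simp
    rw [e', e]
    refine Finset.sum_congr rfl fun a _ => ?_
    rw [show {ω | chain (R ω) l = a} ∩ {ω | chain (R ω) (l + 1) = i} =
      {ω | chain (R ω) l = a ∧ chain (R ω) (l + 1) = i} from rfl, hR.measureReal_chain_succ]
    rcases (Fin.le_last a).lt_or_eq with h | rfl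
    · rw [ih h, hq a i h]
    -- Paths through the absorbing state contribute nothing: `p` never leaves it, and the last row
    -- of `q` is zero.
    · rw [hR.apply_last, if_neg hi.ne, hql, mul_zero, mul_zero]

/-- The probability that `i` is an element of `R`. -/
lemma measureReal_mem_eq_sum (hR : IsRegenerative μ R p)
    {q : Matrix (Fin (n + 1)) (Fin (n + 1)) ℝ} (hq : ∀ i j, i < Fin.last n → q i j = p i j)
    (hql : ∀ j, q (Fin.last n) j = 0) {i : Fin (n + 1)} (hi : i < Fin.last n) :
    μ.real {ω | i ∈ R ω} = ∑ l ∈ Finset.range ((i : ℕ) + 1), (q ^ l) 0 i := by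
  rw [← Finset.sum_congr rfl fun l _ => hR.measureReal_chain_eq_pow hq hql l hi,
    ← measureReal_biUnion_finset₀]
  · refine measureReal_congr (eventuallyEq_set.2 ?_)
    filter_upwards [hR.ends] with ω hω
    simp only [Set.mem_iUnion, Set.mem_ofPred_eq, exists_prop, Finset.mem_range]
    constructor
    · intro h
      obtain ⟨m, hm⟩ := exists_chain_eq hω.2 h
      have := le_chain hω.2 (hm ▸ hi)
      rw [hm] at this
      exact ⟨m, by omega, hm⟩
    · rintro ⟨m, -, hm⟩
      exact hm ▸ chain_mem hω.1 hω.2 m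
  · have key : ∀ a b, a < b →
        AEDisjoint μ {ω | chain (R ω) a = i} {ω | chain (R ω) b = i} := fun a b hab => by
      refine measure_mono_null (t := {ω | ¬ (0 ∈ R ω ∧ Fin.last n ∈ R ω)}) ?_ hR.ends
      rintro ω ⟨h1, h2⟩ hω
      have h1' : chain (R ω) a = i := h1
      have h2' : chain (R ω) b = i := h2
      have := (chain_lt_succ hω.2 (h1' ▸ hi)).trans_le (chain_mono hω.2 hab)
      rw [h1', h2'] at this
      exact absurd this (lt_irrefl i)
    intro a _ b _ hab
    rcases lt_or_gt_of_ne hab with h | h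
    · exact key a b h
    · exact (key b a h).symm
  · exact fun l _ => (hR.chain_measurable l i).nullMeasurableSet

end IsRegenerative

end ChainLaw

/-! ### Order statistics -/

/-- Sorting permutes the entries, so it preserves the number of those at most y. -/
lemma orderStat_le_iff {n : ℕ} (x : Fin n → ℝ≥0∞) {k : ℕ} (h1 : 1 ≤ k) (hk : k ≤ n) (y : ℝ≥0∞) :
    orderStat x k ≤ y ↔ k ≤ (Finset.univ.filter fun i => x i ≤ y).card := by
  rw [orderStat, dif_pos ⟨h1, hk⟩]
  have h := Tuple.lt_card_le_iff_apply_le_of_monotone (j := (⟨k - 1, by omega⟩ : Fin n)) (a := y)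
    (Tuple.monotone_sort x)
  have hc : (Finset.univ.filter fun i => (x ∘ Tuple.sort x) i ≤ y).card =
      (Finset.univ.filter fun i => x i ≤ y).card := by
    rw [← Finset.card_map (Tuple.sort x).toEmbedding]
    congr 1
    ext i
    simp only [Finset.mem_map_equiv, Finset.mem_filter, Finset.mem_univ, true_and,
      Function.comp, Equiv.apply_symm_apply]
  rw [hc] at h
  exact h.symm.trans (by dsimp only; omega)

lemma orderStat_mono {n : ℕ} (x : Fin n → ℝ≥0∞) {k r : ℕ} (h1 : 1 ≤ k) (hkr : k ≤ r) (hr : r ≤ n) :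
    orderStat x k ≤ orderStat x r := by
  rw [orderStat, orderStat, dif_pos ⟨h1, hkr.trans hr⟩, dif_pos ⟨h1.trans hkr, hr⟩]
  exact Tuple.monotone_sort x (by simp only [Fin.mk_le_mk]; omega)

/-! ### The paths of the embedded chain -/

lemma leftLim_eq_of_eqOn {α : Type*} [TopologicalSpace α] [T2Space α] {f : ℝ≥0 → α} {a t : ℝ≥0}
    {c : α} (hat : a < t) (h : ∀ r, a ≤ r → r < t → f r = c) : Function.leftLim f t = c := by
  have hne : (𝓝[<] t).NeBot := nhdsLT_neBot_of_exists_lt ⟨a, hat⟩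
  refine leftLim_eq_of_tendsto (tendsto_const_nhds.congr' ?_)
  filter_upwards [Ioo_mem_nhdsLT hat] with r hr using (h r hr.1.le hr.2).symm

/-- A monotone function with finitely many values attains its largest value before t, and keeps it
from there until t. -/
lemma exists_eqOn_Ico {α : Type*} [LinearOrder α] [Finite α] {f : ℝ≥0 → α} (hf : Monotone f)
    {t : ℝ≥0} (ht : 0 < t) : ∃ a < t, ∀ r, a ≤ r → r < t → f r = f a := by
  obtain ⟨c, ⟨a, hat, rfl⟩, hc⟩ := (Set.toFinite (f '' Set.Iio t)).exists_maximal
    ⟨_, Set.mem_image_of_mem f ht⟩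
  refine ⟨a, hat, fun r har hrt => le_antisymm ?_ (hf har)⟩
  exact (hc (Set.mem_image_of_mem f hrt) (hf har))

/-- The states visited by the number of failed components. -/
def failureStates {Ω : Type*} {n : ℕ} (L : ℝ≥0 → Ω → ℝ) (ε : Fin n → Ω → ℝ) (ω : Ω) :
    Finset (Fin (n + 1)) :=
  visited fun q : ℚ≥0 => failures L ε q ω

namespace GoodPath

variable {Ω : Type*} {n : ℕ} {L : ℝ≥0 → Ω → ℝ} {ε : Fin n → Ω → ℝ} {ω : Ω}

/-- The path stays constant for a while after each time, so rational times see every state. -/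
lemma mem_failureStates (hg : GoodPath L ε ω) {r : Fin (n + 1)} :
    r ∈ failureStates L ε ω ↔ ∃ t, failures L ε t ω = r := by
  rw [failureStates, mem_visited]
  constructor
  · rintro ⟨q, h⟩; exact ⟨q, h⟩
  · rintro ⟨t, rfl⟩
    obtain ⟨s, hts, hs⟩ := (mem_nhdsGT_iff_exists_Ioo_subset (a := t)).1 (hg.failures_rightCts t)
    obtain ⟨q, hq1, hq2⟩ := exists_nnrat_btwn hts
    exact ⟨q, hs ⟨hq1, hq2⟩⟩

lemma zero_mem_failureStates (hg : GoodPath L ε ω) : 0 ∈ failureStates L ε ω :=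
  hg.mem_failureStates.2 ⟨0, hg.failures_zero⟩

lemma last_mem_failureStates (hg : GoodPath L ε ω) : Fin.last n ∈ failureStates L ε ω :=
  hg.mem_failureStates.2 hg.exists_failures_eq_last

lemma orderStat_lifetime_le_iff (hg : GoodPath L ε ω) {k : ℕ} (h1 : 1 ≤ k) (hk : k ≤ n) (t : ℝ≥0) :
    orderStat (fun i => lifetime L ε i ω) k ≤ t ↔ k ≤ (failures L ε t ω : ℕ) := by
  rw [orderStat_le_iff _ h1 hk]
  simp only [hg.lifetime_le_iff, failures]
  rw [Finset.filter_univ_mem]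

/-- The order statistic of index i + 1 is the first time at which N exceeds i. By monotonicity, the
value of N there is the least visited state above i. -/
lemma exists_first_passage (hg : GoodPath L ε ω) {i : Fin (n + 1)} (hi : i < Fin.last n) :
    ∃ s : ℝ≥0, orderStat (fun i => lifetime L ε i ω) ((i : ℕ) + 1) = s ∧
      failures L ε s ω = succVal (failureStates L ε ω) i ∧
      ∀ t, t < s → failures L ε t ω ≤ i := by
  have hin : (i : ℕ) + 1 ≤ n := hi
  have hle := fun t => hg.orderStat_lifetime_le_iff (Nat.succ_pos (i : ℕ)) hin t
  obtain ⟨u, hu⟩ := hg.exists_failures_eq_last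
  have htop : orderStat (fun i => lifetime L ε i ω) ((i : ℕ) + 1) ≠ ⊤ :=
    (((hle u).2 (by rw [hu]; exact hin)).trans_lt ENNReal.coe_lt_top).ne
  lift orderStat (fun i => lifetime L ε i ω) ((i : ℕ) + 1) to ℝ≥0 using htop with s hs
  simp only [ENNReal.coe_le_coe] at hle
  refine ⟨s, rfl, ?_, fun t hts => ?_⟩
  · symm
    rw [succVal_eq_iff hg.last_mem_failureStates hi]
    have h := (hle s).1 le_rfl
    refine ⟨hg.mem_failureStates.2 ⟨s, rfl⟩, h, fun r hr hir => ?_⟩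
    obtain ⟨t, rfl⟩ := hg.mem_failureStates.1 hr
    exact hg.failures_mono ((hle t).2 hir)
  · by_contra h
    exact absurd ((hle t).2 (not_le.1 h)) hts.not_ge

lemma limUnder_failures (hg : GoodPath L ε ω) :
    limUnder atTop (fun t => failures L ε t ω) = Fin.last n := by
  refine Tendsto.limUnder_eq (tendsto_const_nhds.congr' ?_)
  obtain ⟨u, hu⟩ := hg.exists_failures_eq_last
  filter_upwards [eventually_ge_atTop u] with t ht
  exact le_antisymm (hu ▸ hg.failures_mono ht) (Fin.le_last _)

lemma leftLim_failures_le_of_forall_lt (hg : GoodPath L ε ω) {i : Fin (n + 1)} {s : ℝ≥0} (hs : 0 < s)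
    (h : ∀ t, t < s → failures L ε t ω ≤ i) :
    Function.leftLim (fun t => failures L ε t ω) s ≤ i := by
  obtain ⟨a, has, ha⟩ := exists_eqOn_Ico hg.failures_mono hs
  rw [leftLim_eq_of_eqOn has ha]
  exact h a has

/-- Below n, the next jump is the first passage above the current state. Once N equals n there is no
further jump: the infimum is ∞, where N is read as its limit n. -/
lemma jumpTime_spec (hg : GoodPath L ε ω) (m : ℕ) :
    (∃ s : ℝ≥0, jumpTime L ε m ω = s ∧ failures L ε s ω = chain (failureStates L ε ω) m) ∨
      (jumpTime L ε m ω = ⊤ ∧ chain (failureStates L ε ω) m = Fin.last n) := by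
  induction m with
  | zero => exact Or.inl ⟨0, by simp [jumpTime], hg.failures_zero⟩
  | succ m ih =>
    rcases ih with ⟨s, hs, hN⟩ | ⟨htop, hl⟩
    · rcases (Fin.le_last (chain (failureStates L ε ω) m)).lt_or_eq with hlt | heq
      · obtain ⟨s', -, hs', hbefore⟩ := hg.exists_first_passage hlt
        have hlt' := (succVal_spec hg.last_mem_failureStates hlt).2.1
        rw [← hs'] at hlt'
        have hss' : s < s' := by
          by_contra h
          have h1 : failures L ε s' ω ≤ failures L ε s ω := hg.failures_mono (not_lt.1 h)
          rw [hN] at h1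
          exact absurd hlt' h1.not_gt
        refine Or.inl ⟨s', ?_, hs'⟩
        have hjump : jumpTime L ε m ω < (s' : ℝ≥0∞) ∧
            Function.leftLim (fun t => failures L ε t ω) s' < failures L ε s' ω :=
          ⟨by rw [hs]; exact_mod_cast hss',
            (hg.leftLim_failures_le_of_forall_lt (zero_le.trans_lt hss') hbefore).trans_lt hlt'⟩
        refine le_antisymm (iInf₂_le s' hjump) (le_iInf₂ fun t ht => ?_)
        -- No jump can come earlier: N is constant from s until just before s', so its left limit
        -- there equals its value.
        · rw [hs, ENNReal.coe_lt_coe] at ht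
          rw [ENNReal.coe_le_coe]
          by_contra hts
          have hconst : ∀ r, s ≤ r → r < s' → failures L ε r ω = chain (failureStates L ε ω) m :=
            fun r h1 h2 => le_antisymm (hbefore r h2) (hN ▸ hg.failures_mono h1)
          rw [leftLim_eq_of_eqOn ht.1 fun r h1 h2 => hconst r h1 (h2.trans (not_le.1 hts)),
            hconst t ht.1.le (not_le.1 hts)] at ht
          exact lt_irrefl _ ht.2
      · refine Or.inr ⟨?_, by rw [chain, heq, succVal_last]⟩
        rw [jumpTime, iInf₂_eq_top]
        rintro t ⟨h1, h2⟩
        exfalso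
        rw [hs, ENNReal.coe_lt_coe] at h1
        rw [heq] at hN
        have hconst : ∀ r, s ≤ r → failures L ε r ω = Fin.last n := fun r h =>
          le_antisymm (Fin.le_last _) (hN ▸ hg.failures_mono h)
        rw [leftLim_eq_of_eqOn h1 fun r h _ => hconst r h, hconst t h1.le] at h2
        exact lt_irrefl _ h2
    · refine Or.inr ⟨?_, by rw [chain, hl, succVal_last]⟩
      rw [jumpTime, iInf₂_eq_top]
      rintro t ⟨h1, -⟩
      rw [htop] at h1
      exact absurd h1 not_top_lt

lemma jumpChain_eq_chain (hg : GoodPath L ε ω) (m : ℕ) :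
    jumpChain L ε m ω = chain (failureStates L ε ω) m := by
  rcases hg.jumpTime_spec m with ⟨s, hs, h⟩ | ⟨htop, h⟩
  · rw [jumpChain, failuresAt, hs, if_neg ENNReal.coe_ne_top, ENNReal.toNNReal_coe, h]
  · rw [jumpChain, failuresAt, htop, if_pos rfl, hg.limUnder_failures, h]

lemma failuresAt_orderStat (hg : GoodPath L ε ω) {i : Fin (n + 1)} (hi : i < Fin.last n) :
    failuresAt L ε (orderStat (fun i => lifetime L ε i ω) ((i : ℕ) + 1)) ω =
      succVal (failureStates L ε ω) i := by
  obtain ⟨s, hs, h, -⟩ := hg.exists_first_passage hi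
  rw [hs, failuresAt, if_neg ENNReal.coe_ne_top, ENNReal.toNNReal_coe, h]

/-- The k-th failure has occurred by the time of failure i + 1 exactly when N at that time is at
least k. -/
lemma orderStat_lt_iff (hg : GoodPath L ε ω) {i : Fin (n + 1)} (hi : i < Fin.last n) {k : ℕ}
    (hk : 1 ≤ k) (hkn : k ≤ n) :
    orderStat (fun i => lifetime L ε i ω) ((i : ℕ) + 1) <
        orderStat (fun i => lifetime L ε i ω) k ↔
      (succVal (failureStates L ε ω) i : ℕ) < k := by
  obtain ⟨s, hs, h, -⟩ := hg.exists_first_passage hi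
  rw [hs, ← not_le, hg.orderStat_lifetime_le_iff hk hkn, h, not_le]

end GoodPath

/-! ### Jumps of the enumeration -/

section Jumps

variable {n : ℕ} {R : Finset (Fin (n + 1))} {i j : Fin (n + 1)}

lemma lt_succVal (hl : Fin.last n ∈ R) (hi : i < Fin.last n) : i < succVal R i :=
  (succVal_spec hl hi).2.1

lemma exists_chain_jump_iff (hl : Fin.last n ∈ R) (hi : i < Fin.last n)
    {P : Fin (n + 1) → Prop} (hP : ∀ r, P r → i < r) :
    (∃ m, chain R m ≤ i ∧ P (chain R (m + 1))) ↔ P (succVal R i) := by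
  constructor
  · rintro ⟨m, h1, h2⟩
    rwa [succVal_chain_of_le_of_lt hl h1 (hP _ h2)] at h2
  · intro h
    obtain ⟨m, h1, h2⟩ := exists_chain_crossing hl hi
    exact ⟨m, h1, h2 ▸ h⟩

lemma exists_chain_eq_and_succ_iff (h0 : 0 ∈ R) (hl : Fin.last n ∈ R) :
    (∃ m, chain R m = i ∧ chain R (m + 1) = j) ↔ i ∈ R ∧ succVal R i = j := by
  constructor
  · rintro ⟨m, h1, h2⟩
    subst h1
    exact ⟨chain_mem h0 hl m, h2⟩
  · rintro ⟨hi, h⟩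
    obtain ⟨m, rfl⟩ := exists_chain_eq hl hi
    exact ⟨m, rfl, h⟩

/-- Either `i` is skipped, or it is the successor of its predecessor `k`. -/
lemma mem_iff_succVal_eq {k : Fin (n + 1)} (hl : Fin.last n ∈ R) (hki : (k : ℕ) + 1 = i) :
    i ∈ R ↔ succVal R k = i := by
  have hk : k < i := by rw [Fin.lt_def]; omega
  rw [succVal_eq_iff hl (hk.trans_le (Fin.le_last i))]
  refine ⟨fun h => ⟨h, hk, fun r _ hr => ?_⟩, fun h => h.1⟩
  rw [Fin.lt_def] at hr
  rw [Fin.le_def]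
  omega

/-- If i is not in R, the elements of R above i and above its predecessor k are the same; if i is in
R, the chain visits i before jumping on. -/
lemma succVal_eq_iff_of_val_succ {k : Fin (n + 1)} (hl : Fin.last n ∈ R) (hki : (k : ℕ) + 1 = i)
    (hij : i < j) : succVal R i = j ↔ succVal R k = j ∨ i ∈ R ∧ succVal R i = j := by
  have hk : k < i := by rw [Fin.lt_def]; omega
  have hi : i < Fin.last n := hij.trans_le (Fin.le_last j)
  rw [succVal_eq_iff hl hi, succVal_eq_iff hl (hk.trans hi)]
  have hiff : ∀ r : Fin (n + 1), k < r ↔ i = r ∨ i < r := fun r => by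
    rw [Fin.lt_def, Fin.lt_def, Fin.ext_iff]; omega
  constructor
  · intro h
    by_cases hiR : i ∈ R
    · exact Or.inr ⟨hiR, h⟩
    · refine Or.inl ⟨h.1, hk.trans hij, fun r hr hkr => h.2.2 r hr ?_⟩
      exact ((hiff r).1 hkr).resolve_left fun h => hiR (h ▸ hr)
  · rintro (⟨h1, h2, h3⟩ | h)
    · exact ⟨h1, hij, fun r hr hir => h3 r hr (hk.trans hir)⟩
    · exact h.2

end Jumps

namespace IsRegenerative

variable {Ω : Type*} [MeasurableSpace Ω] {μ : Measure Ω} {n : ℕ}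
  {R : Ω → Finset (Fin (n + 1))} {p : Matrix (Fin (n + 1)) (Fin (n + 1)) ℝ}
  {X : ℕ → Ω → Fin (n + 1)}

lemma isDTMC (hR : IsRegenerative μ R p) (hX : ∀ᵐ ω ∂μ, ∀ m, X m ω = chain (R ω) m)
    (h0 : ∀ i j, 0 ≤ p i j) (h1 : ∀ i, ∑ j, p i j = 1) : IsDTMC μ X p where
  nonneg := h0
  row_sum := h1
  markov m x := by
    have h : ∀ m, μ.real {ω | ∀ l ≤ m, X l ω = x l} =
        μ.real {ω | ∀ l ≤ m, chain (R ω) l = x l} := fun m => by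
      refine measureReal_congr (eventuallyEq_set.2 ?_)
      filter_upwards [hX] with ω hω
      simp only [hω]
    rw [h, h, hR.chain_markov]

lemma jumpInto_eq (hR : IsRegenerative μ R p) (hX : ∀ᵐ ω ∂μ, ∀ m, X m ω = chain (R ω) m)
    {i j : Fin (n + 1)} (hij : i < j) :
    jumpInto μ X i j = μ.real {ω | succVal (R ω) i = j} := by
  refine measureReal_congr (eventuallyEq_set.2 ?_)
  filter_upwards [hX, hR.ends] with ω hω he
  have hval : (i : ℕ) < j := hij
  simp only [hω, hval, and_true, Fin.val_inj, Fin.val_fin_le]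
  exact exists_chain_jump_iff he.2 (hij.trans_le (Fin.le_last j)) (P := (· = j))
    fun r hr => hr ▸ hij

lemma jumpIntoSet_eq (hR : IsRegenerative μ R p) (hX : ∀ᵐ ω ∂μ, ∀ m, X m ω = chain (R ω) m)
    {i : Fin (n + 1)} {j k : ℕ} (hij : (i : ℕ) < j) (hi : i < Fin.last n) :
    jumpIntoSet μ X i j k = μ.real {ω | j ≤ (succVal (R ω) i : ℕ) ∧ (succVal (R ω) i : ℕ) ≤ k} := by
  refine measureReal_congr (eventuallyEq_set.2 ?_)
  filter_upwards [hX, hR.ends] with ω hω he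
  simp only [hω, Fin.val_fin_le]
  exact exists_chain_jump_iff he.2 hi (P := fun r => j ≤ (r : ℕ) ∧ (r : ℕ) ≤ k)
    fun r hr => hij.trans_le hr.1

lemma jumpFrom_eq (hR : IsRegenerative μ R p) (hX : ∀ᵐ ω ∂μ, ∀ m, X m ω = chain (R ω) m)
    {i j : Fin (n + 1)} (hij : i < j) :
    jumpFrom μ X i j = μ.real {ω | i ∈ R ω ∧ succVal (R ω) i = j} := by
  refine measureReal_congr (eventuallyEq_set.2 ?_)
  filter_upwards [hX, hR.ends] with ω hω he
  have hval : (i : ℕ) < j := hij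
  simp only [hω, hval, and_true, Fin.val_inj]
  exact exists_chain_eq_and_succ_iff he.1 he.2

/-- State i is visited exactly when the chain enters it from {0, ..., i-1}; this turns visit
probabilities into the factor of the recursion. -/
lemma measureReal_mem_eq_jumpInto (hR : IsRegenerative μ R p)
    (hX : ∀ᵐ ω ∂μ, ∀ m, X m ω = chain (R ω) m) {k i : Fin (n + 1)} (hki : (k : ℕ) + 1 = i) :
    μ.real {ω | i ∈ R ω} = jumpInto μ X k i := by
  rw [hR.jumpInto_eq hX (by rw [Fin.lt_def]; omega)]
  refine measureReal_congr (eventuallyEq_set.2 ?_)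
  filter_upwards [hR.ends] with ω he using mem_iff_succVal_eq he.2 hki

lemma jumpInto_zero_left (hR : IsRegenerative μ R p) (hX : ∀ᵐ ω ∂μ, ∀ m, X m ω = chain (R ω) m)
    {j : Fin (n + 1)} (hj : 0 < j) : jumpInto μ X 0 j = jumpFrom μ X 0 j := by
  refine (hR.jumpInto_eq hX hj).trans ((hR.jumpFrom_eq hX hj).trans ?_).symm
  refine measureReal_congr (eventuallyEq_set.2 ?_)
  filter_upwards [hR.ends] with ω he
  simp [he.1]

variable [IsProbabilityMeasure μ]

lemma jumpFrom_eq_mul (hR : IsRegenerative μ R p) (hX : ∀ᵐ ω ∂μ, ∀ m, X m ω = chain (R ω) m)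
    {i j : Fin (n + 1)} (hij : i < j) :
    jumpFrom μ X i j = μ.real {ω | i ∈ R ω} * p i j := by
  rw [hR.jumpFrom_eq hX hij, hR.measureReal_mem_succVal hij]

lemma measureReal_zero_mem (hR : IsRegenerative μ R p) : μ.real {ω | 0 ∈ R ω} = 1 := by
  rw [← probReal_univ (μ := μ)]
  refine measureReal_congr (eventuallyEq_set.2 ?_)
  filter_upwards [hR.ends] with ω he
  simp [he.1]

/-- The two events are disjoint: if i is visited, the first element above its predecessor is i and
not j. -/
lemma jumpInto_eq_add_jumpFrom (hR : IsRegenerative μ R p)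
    (hX : ∀ᵐ ω ∂μ, ∀ m, X m ω = chain (R ω) m) {k i j : Fin (n + 1)} (hki : (k : ℕ) + 1 = i)
    (hij : i < j) : jumpInto μ X i j = jumpInto μ X k j + jumpFrom μ X i j := by
  have hk : k < i := by rw [Fin.lt_def]; omega
  rw [hR.jumpInto_eq hX hij, hR.jumpInto_eq hX (hk.trans hij), hR.jumpFrom_eq hX hij,
    ← measureReal_union₀]
  · refine measureReal_congr (eventuallyEq_set.2 ?_)
    filter_upwards [hR.ends] with ω he using succVal_eq_iff_of_val_succ he.2 hki hij
  · exact (hR.measurableSet fun R => i ∈ R ∧ succVal R i = j).nullMeasurableSet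
  · refine measure_mono_null (t := {ω | ¬ (0 ∈ R ω ∧ Fin.last n ∈ R ω)}) ?_ hR.ends
    rintro ω ⟨h1, h2⟩ he
    have h1' : succVal (R ω) k = j := h1
    rw [(mem_iff_succVal_eq he.2 hki).1 h2.1] at h1'
    exact hij.ne h1'

lemma jumpInto_eq_sum_jumpFrom (hR : IsRegenerative μ R p)
    (hX : ∀ᵐ ω ∂μ, ∀ m, X m ω = chain (R ω) m) {i j : ℕ} (hij : i < j) (hjn : j ≤ n) :
    jumpInto μ X i j = ∑ l ∈ Finset.range (i + 1), jumpFrom μ X l j := by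
  induction i with
  | zero =>
    simpa using hR.jumpInto_zero_left hX (j := ⟨j, by omega⟩) hij
  | succ i ih =>
    rw [Finset.sum_range_succ, ← ih (by omega)]
    exact hR.jumpInto_eq_add_jumpFrom hX (k := ⟨i, by omega⟩) (i := ⟨i + 1, by omega⟩)
      (j := ⟨j, by omega⟩) rfl hij

lemma jumpIntoSet_eq_sum (hR : IsRegenerative μ R p)
    (hX : ∀ᵐ ω ∂μ, ∀ m, X m ω = chain (R ω) m) {i j k : ℕ} (hij : i < j) (hjk : j ≤ k)
    (hkn : k ≤ n) :
    jumpIntoSet μ X i j k = ∑ l ∈ Finset.Icc j k, jumpInto μ X i l := by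
  have hin : i < n := by omega
  have e : ∀ l ∈ Finset.Icc j k, jumpInto μ X i l =
      μ.real {ω | (succVal (R ω) ⟨i, by omega⟩ : ℕ) = l} := fun l hl => by
    rw [Finset.mem_Icc] at hl
    have := hR.jumpInto_eq hX (i := ⟨i, by omega⟩) (j := ⟨l, by omega⟩)
      (by rw [Fin.lt_def]; dsimp only; omega)
    simpa only [Fin.ext_iff] using this
  rw [Finset.sum_congr rfl e, ← measureReal_biUnion_finset]
  · refine (hR.jumpIntoSet_eq hX (i := ⟨i, by omega⟩) hij hin).trans ?_
    congr 1
    ext ω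
    simp
  · intro a _ b _ hab
    exact Set.disjoint_left.2 fun ω h1 h2 => hab (h1.symm.trans h2)
  · exact fun l _ => hR.measurableSet fun R => (succVal R _ : ℕ) = l

end IsRegenerative

/-! ### The embedded chain of the number of failed components -/

namespace IsModel

variable {Ω : Type*} [MeasurableSpace Ω] {μ : Measure Ω} [IsProbabilityMeasure μ] {n : ℕ}
  {L : ℝ≥0 → Ω → ℝ} {ε : Fin n → Ω → ℝ}

lemma generator_self (μ : Measure Ω) [IsProbabilityMeasure μ] (L : ℝ≥0 → Ω → ℝ)
    (i : Fin (n + 1)) :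
    generator (laplaceExponent μ L) n i i = -laplaceExponent μ L ((n - i : ℕ) : ℝ) := by
  rw [generator, if_pos rfl,
    sum_rate _ (laplaceExponent_zero μ L) (Nat.lt_succ_iff.1 i.isLt)]

/-- The limit on grids gives G i j / (-G i i), and -G i i = Ψ(n-i) > 0 turns this quotient into
P_{i,j}. -/
lemma isRegenerative_failureStates (hM : IsModel μ L ε) :
    IsRegenerative μ (failureStates L ε) (absorbedMatrix (laplaceExponent μ L) n) where
  measurable := measurableSet_visited_eq fun q => hM.isCTMC_failures.measurable q
  ends := by
    filter_upwards [hM.ae_goodPath] with ω hg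
      using ⟨hg.zero_mem_failureStates, hg.last_mem_failureStates⟩
  next S i j hiS hS hij := by
    have hval : (i : ℕ) < j := hij
    have hjn : (j : ℕ) ≤ n := Nat.lt_succ_iff.1 j.isLt
    have h := hM.isCTMC_failures.measureReal_visited_mul
      (hM.ae_goodPath.mono fun ω hg => hg.failures_mono)
      (hM.ae_goodPath.mono fun ω hg => hg.exists_failures_eq_last) hiS hS hij
    have hpos := hM.subordinator.laplaceExponent_pos hM.nontrivial
      (show 1 ≤ n - (i : ℕ) by omega)
    rw [generator_self, neg_neg, generator, if_neg hij.ne] at h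
    rw [absorbedMatrix, if_neg (hij.trans_le (Fin.le_last j)).ne, transProb_eq_rate_div,
      ← mul_div_assoc, eq_div_iff hpos.ne']
    exact h
  apply_le i j hi hji := by
    have hval : (j : ℕ) ≤ i := hji
    rw [absorbedMatrix, if_neg hi.ne, transProb, if_neg (by omega)]
  apply_last j := by rw [absorbedMatrix, if_pos rfl]

lemma absorbedMatrix_nonneg (hM : IsModel μ L ε) (i j : Fin (n + 1)) :
    0 ≤ absorbedMatrix (laplaceExponent μ L) n i j := by
  unfold absorbedMatrix transProb
  split_ifs with h1 h2 h3
  · exact zero_le_one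
  · exact le_rfl
  · exact mul_nonneg (Nat.cast_nonneg _) (div_nonneg
      (hM.subordinator.lam_nonneg (by omega) (by omega))
      (hM.subordinator.laplaceExponent_pos hM.nontrivial (by omega)).le)
  · exact le_rfl

lemma absorbedMatrix_row_sum (hM : IsModel μ L ε) (i : Fin (n + 1)) :
    ∑ j, absorbedMatrix (laplaceExponent μ L) n i j = 1 := by
  unfold absorbedMatrix
  by_cases hi : i = Fin.last n
  · simp [hi]
  · have hin : (i : ℕ) < n := (Fin.le_last i).lt_of_ne hi
    simp only [if_neg hi, transProb_eq_rate_div]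
    rw [← Finset.sum_div, sum_rate _ (laplaceExponent_zero μ L) hin.le]
    exact div_self (hM.subordinator.laplaceExponent_pos hM.nontrivial (by omega)).ne'

lemma ae_jumpChain_eq (hM : IsModel μ L ε) :
    ∀ᵐ ω ∂μ, ∀ m, jumpChain L ε m ω = chain (failureStates L ε ω) m :=
  hM.ae_goodPath.mono fun _ hg => hg.jumpChain_eq_chain

lemma jumpFrom_eq_sum_pow (hM : IsModel μ L ε) {i j : Fin (n + 1)} (hij : i < j) :
    jumpFrom μ (jumpChain L ε) i j = ∑ l ∈ Finset.range ((i : ℕ) + 1),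
      ((transMatrix (laplaceExponent μ L) n) ^ l) 0 i *
        transMatrix (laplaceExponent μ L) n i j := by
  have hi : i < Fin.last n := hij.trans_le (Fin.le_last j)
  have hq : ∀ i j : Fin (n + 1), i < Fin.last n →
      transMatrix (laplaceExponent μ L) n i j = absorbedMatrix (laplaceExponent μ L) n i j :=
    fun i j h => by rw [absorbedMatrix, if_neg h.ne]; rfl
  have hl : ∀ j, transMatrix (laplaceExponent μ L) n (Fin.last n) j = 0 := fun j => by
    have := Nat.lt_succ_iff.1 j.isLt
    rw [transMatrix, transProb, if_neg]
    simp only [Fin.val_last]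
    omega
  rw [hM.isRegenerative_failureStates.jumpFrom_eq_mul hM.ae_jumpChain_eq hij,
    hM.isRegenerative_failureStates.measureReal_mem_eq_sum hq hl hi, Finset.sum_mul, hq i j hi]

lemma jumpInto_zero (hM : IsModel μ L ε) {j : ℕ} (hj : 0 < j) (hjn : j ≤ n) :
    jumpInto μ (jumpChain L ε) 0 j = transProb (laplaceExponent μ L) n 0 j := by
  have hR := hM.isRegenerative_failureStates
  have hlt : (0 : Fin (n + 1)) < ⟨j, by omega⟩ := hj
  refine (hR.jumpInto_zero_left hM.ae_jumpChain_eq hlt).trans ?_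
  refine (hR.jumpFrom_eq_mul hM.ae_jumpChain_eq hlt).trans ?_
  rw [hR.measureReal_zero_mem, one_mul, absorbedMatrix,
    if_neg (hlt.trans_le (Fin.le_last _)).ne]
  rfl

lemma jumpInto_recursion (hM : IsModel μ L ε) {i j : ℕ} (hi : 1 ≤ i) (hij : i < j) (hjn : j ≤ n) :
    jumpInto μ (jumpChain L ε) i j = jumpInto μ (jumpChain L ε) (i - 1) j +
      jumpInto μ (jumpChain L ε) (i - 1) i * transProb (laplaceExponent μ L) n i j := by
  have hR := hM.isRegenerative_failureStates
  have hX := hM.ae_jumpChain_eq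
  obtain ⟨k, rfl⟩ : ∃ k, i = k + 1 := ⟨i - 1, by omega⟩
  have hlt : (⟨k + 1, by omega⟩ : Fin (n + 1)) < ⟨j, by omega⟩ := hij
  have hki : ((⟨k, by omega⟩ : Fin (n + 1)) : ℕ) + 1 = (⟨k + 1, by omega⟩ : Fin (n + 1)) := rfl
  have h := hR.jumpInto_eq_add_jumpFrom hX hki hlt
  rw [hR.jumpFrom_eq_mul hX hlt, hR.measureReal_mem_eq_jumpInto hX hki, absorbedMatrix,
    if_neg (hlt.trans_le (Fin.le_last _)).ne] at h
  exact h

/-! ### Order statistics and the embedded chain -/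

/-- The shift r - 1 appears because the r-th failure time is the first passage of N above r - 1. -/
lemma ae_orderStat (hM : IsModel μ L ε) {r : ℕ} (hr : 1 ≤ r) (hrn : r ≤ n) :
    ∀ᵐ ω ∂μ, failuresAt L ε (orderStat (fun i => lifetime L ε i ω) r) ω =
        succVal (failureStates L ε ω) ⟨r - 1, by omega⟩ ∧
      (r : ℕ) ≤ succVal (failureStates L ε ω) ⟨r - 1, by omega⟩ ∧
      ∀ k, 1 ≤ k → k ≤ n →
        (orderStat (fun i => lifetime L ε i ω) r < orderStat (fun i => lifetime L ε i ω) k ↔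
          (succVal (failureStates L ε ω) ⟨r - 1, by omega⟩ : ℕ) < k) := by
  filter_upwards [hM.ae_goodPath] with ω hg
  obtain ⟨i, rfl⟩ : ∃ i, r = i + 1 := ⟨r - 1, by omega⟩
  have hi : (⟨i, by omega⟩ : Fin (n + 1)) < Fin.last n := hrn
  exact ⟨hg.failuresAt_orderStat hi, lt_succVal hg.last_mem_failureStates hi,
    fun k => hg.orderStat_lt_iff hi⟩

lemma measureReal_orderStat_lt (hM : IsModel μ L ε) {r k : ℕ} (hr : 1 ≤ r) (hrk : r < k)
    (hkn : k ≤ n) :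
    μ.real {ω | orderStat (fun i => lifetime L ε i ω) r <
        orderStat (fun i => lifetime L ε i ω) k} =
      jumpIntoSet μ (jumpChain L ε) (r - 1) r (k - 1) := by
  have h := hM.isRegenerative_failureStates.jumpIntoSet_eq hM.ae_jumpChain_eq
    (i := ⟨r - 1, by omega⟩) (j := r) (k := k - 1) (by dsimp only; omega)
    (by rw [Fin.lt_def, Fin.val_last]; dsimp only; omega)
  refine Eq.trans (measureReal_congr (eventuallyEq_set.2 ?_)) h.symm
  filter_upwards [hM.ae_orderStat hr (hrk.le.trans hkn)] with ω hω
  refine (hω.2.2 k (by omega) hkn).trans ?_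
  have := hω.2.1
  change _ ↔ r ≤ (succVal _ _ : ℕ) ∧ (succVal _ _ : ℕ) ≤ k - 1
  omega

lemma measureReal_orderStat_eq (hM : IsModel μ L ε) {r k : ℕ} (hr : 1 ≤ r) (hrk : r < k)
    (hkn : k ≤ n) :
    μ.real {ω | orderStat (fun i => lifetime L ε i ω) r =
        orderStat (fun i => lifetime L ε i ω) k} =
      jumpIntoSet μ (jumpChain L ε) (r - 1) k n := by
  have h := hM.isRegenerative_failureStates.jumpIntoSet_eq hM.ae_jumpChain_eq
    (i := ⟨r - 1, by omega⟩) (j := k) (k := n) (by dsimp only; omega)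
    (by rw [Fin.lt_def, Fin.val_last]; dsimp only; omega)
  refine Eq.trans (measureReal_congr (eventuallyEq_set.2 ?_)) h.symm
  filter_upwards [hM.ae_orderStat hr (hrk.le.trans hkn)] with ω hω
  have h1 := orderStat_mono (fun i => lifetime L ε i ω) hr hrk.le hkn
  have h2 := hω.2.2 k (by omega) hkn
  have h3 := Nat.lt_succ_iff.1 (succVal (failureStates L ε ω) ⟨r - 1, by omega⟩).isLt
  change _ ↔ k ≤ (succVal _ _ : ℕ) ∧ (succVal _ _ : ℕ) ≤ n
  rw [← not_lt, ← h2]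
  exact ⟨fun h => ⟨h.not_lt, h3⟩, fun h => h1.eq_of_not_lt h.1⟩

lemma measureReal_failuresAt_orderStat (hM : IsModel μ L ε) {r k : ℕ} (hr : 1 ≤ r) (hrk : r ≤ k)
    (hkn : k ≤ n) :
    μ.real {ω | (failuresAt L ε (orderStat (fun i => lifetime L ε i ω) r) ω : ℕ) = k} =
      jumpInto μ (jumpChain L ε) (r - 1) k := by
  have h := hM.isRegenerative_failureStates.jumpInto_eq hM.ae_jumpChain_eq
    (i := ⟨r - 1, by omega⟩) (j := ⟨k, by omega⟩) (by rw [Fin.lt_def]; dsimp only; omega)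
  refine Eq.trans (measureReal_congr (eventuallyEq_set.2 ?_)) h.symm
  filter_upwards [hM.ae_orderStat hr (hrk.trans hkn)] with ω hω
  simp only [hω.1, Fin.ext_iff]

lemma measureReal_failuresAt_orderStat_of_lt (hM : IsModel μ L ε) {r k : ℕ} (hr : 1 ≤ r)
    (hrn : r ≤ n) (hkr : k < r) :
    μ.real {ω | (failuresAt L ε (orderStat (fun i => lifetime L ε i ω) r) ω : ℕ) = k} = 0 := by
  rw [measureReal_def, measure_mono_null _ (ae_iff.1 (hM.ae_orderStat hr hrn)),
    ENNReal.toReal_zero]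
  rintro ω hω ⟨h1, h2, -⟩
  have hω' : (failuresAt L ε (orderStat (fun i => lifetime L ε i ω) r) ω : ℕ) = k := hω
  rw [h1] at hω'
  omega

end IsModel

end LFMO

end

/-! ### Assembly of the five claims -/

theorem lemma1 {Ω : Type*} [MeasurableSpace Ω] (μ : Measure Ω) [IsProbabilityMeasure μ]
    (n : ℕ) (hn : 1 ≤ n) (L : ℝ≥0 → Ω → ℝ) (ε : Fin n → Ω → ℝ) (hM : LFMO.IsModel μ L ε)
    (Ψ : ℝ → ℝ) (hΨ : Ψ = LFMO.laplaceExponent μ L)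
    (T : ℕ → Ω → ℝ≥0∞)
    (hT : T = fun k ω => LFMO.orderStat (fun i => LFMO.lifetime L ε i ω) k)
    (Nd : ℕ → Ω → Fin (n + 1)) (hNd : Nd = LFMO.jumpChain L ε) :
    -- 1. `N` is a continuous-time Markov chain with the given rates
    (LFMO.IsCTMC μ (LFMO.failures L ε) (LFMO.generator Ψ n) ∧
      (∀ i j : ℕ, i < j → j ≤ n →
        0 ≤ LFMO.lam Ψ (n - i) (j - i) ∧
        ((n - i).choose (j - i) : ℝ) * LFMO.lam Ψ (n - i) (j - i) =
          ∑ k ∈ Finset.Icc i j, (-1 : ℝ) ^ (j - k + 1) *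
            ((n.choose j : ℝ) * (j.choose k : ℝ) * (k.choose i : ℝ) / (n.choose i : ℝ)) *
            Ψ ((n - k : ℕ) : ℝ)) ∧
      -- given the failed set `A` at time `t`, the remaining lifetimes of the working components
      -- are governed by independent shocks, and the time until any shock that hits exactly
      -- `j - |A|` of them is exponential of rate `C(n-|A|,j-|A|) λ^{(n-|A|)}_{j-|A|}`
      (∀ (t : ℝ≥0) (A : Finset (Fin n)), μ {ω | LFMO.failedSet L ε t ω = A} ≠ 0 →
        (ProbabilityTheory.cond μ {ω | LFMO.failedSet L ε t ω = A}).map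
            (fun ω (a : {a : Fin n // a ∉ A}) => LFMO.lifetime L ε a.1 ω - (t : ℝ≥0∞)) =
          (LFMO.shockLaw Ψ A).map
            (fun e (a : {a : Fin n // a ∉ A}) =>
              ⨅ (V : LFMO.Shock A) (_ : a.1 ∈ V.1), e V) ∧
        ∀ j : ℕ, A.card < j → j ≤ n →
          HasLaw (fun e : LFMO.Shock A → ℝ≥0∞ =>
              ⨅ (V : LFMO.Shock A) (_ : V.1.card = j - A.card), e V)
            (LFMO.expLaw (((n - A.card).choose (j - A.card) : ℝ) *
              LFMO.lam Ψ (n - A.card) (j - A.card)))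
            (LFMO.shockLaw Ψ A))) ∧
    -- 2. the embedded chain
    ((∀ᵐ ω ∂μ, Nd 0 ω = 0) ∧
      LFMO.IsDTMC μ Nd (LFMO.absorbedMatrix Ψ n) ∧
      (∀ i j : ℕ, i < j → j ≤ n →
        0 < Ψ ((n - i : ℕ) : ℝ) ∧
        LFMO.transProb Ψ n i j =
          ∑ k ∈ Finset.Icc i j, (-1 : ℝ) ^ (j - k + 1) *
            ((n.choose j : ℝ) * (j.choose k : ℝ) * (k.choose i : ℝ) / (n.choose i : ℝ)) *
            (Ψ ((n - k : ℕ) : ℝ) / Ψ ((n - i : ℕ) : ℝ)))) ∧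
    -- 3. the recursion
    ((∀ j : ℕ, 0 < j → j ≤ n → LFMO.jumpInto μ Nd 0 j = LFMO.transProb Ψ n 0 j) ∧
      (∀ i j : ℕ, 1 ≤ i → i < j → j ≤ n →
        LFMO.jumpInto μ Nd i j =
          LFMO.jumpInto μ Nd (i - 1) j +
            LFMO.jumpInto μ Nd (i - 1) i * LFMO.transProb Ψ n i j) ∧
      (∀ i j : ℕ, i ≤ n → j ≤ i → LFMO.jumpInto μ Nd i j = 0) ∧
      (∀ i j k : ℕ, i < j → j ≤ k → k ≤ n →
        LFMO.jumpIntoSet μ Nd i j k = ∑ l ∈ Finset.Icc j k, LFMO.jumpInto μ Nd i l)) ∧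
    -- 4. the matrix-power formula
    ((∀ i j : Fin (n + 1), i < j →
        LFMO.jumpFrom μ Nd i j =
          ∑ l ∈ Finset.range ((i : ℕ) + 1),
            ((LFMO.transMatrix Ψ n) ^ l) 0 i * LFMO.transMatrix Ψ n i j) ∧
      (∀ i j : Fin (n + 1), j ≤ i → LFMO.jumpFrom μ Nd i j = 0) ∧
      (∀ i j : ℕ, i < j → j ≤ n →
        LFMO.jumpInto μ Nd i j = ∑ l ∈ Finset.range (i + 1), LFMO.jumpFrom μ Nd l j) ∧
      (∀ i j k : ℕ, i < j → j ≤ k → k ≤ n →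
        LFMO.jumpIntoSet μ Nd i j k =
          ∑ l₁ ∈ Finset.range (i + 1), ∑ l₂ ∈ Finset.Icc j k, LFMO.jumpFrom μ Nd l₁ l₂)) ∧
    -- 5. comparison of the order statistics, and the number of failed components at their times
    (∀ r k : ℕ, 1 ≤ r → r ≤ n → 1 ≤ k → k ≤ n →
      (r < k → μ.real {ω | T r ω < T k ω} = LFMO.jumpIntoSet μ Nd (r - 1) r (k - 1)) ∧
      (k ≤ r → μ.real {ω | T r ω < T k ω} = 0) ∧
      (r < k → μ.real {ω | T r ω = T k ω} = LFMO.jumpIntoSet μ Nd (r - 1) k n) ∧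
      (r = k → μ.real {ω | T r ω = T k ω} = 1) ∧
      (r ≤ k → μ.real {ω | (LFMO.failuresAt L ε (T r ω) ω : ℕ) = k} =
        LFMO.jumpInto μ Nd (r - 1) k) ∧
      (k < r → μ.real {ω | (LFMO.failuresAt L ε (T r ω) ω : ℕ) = k} = 0)) := by
  subst hΨ hT hNd
  have hR := hM.isRegenerative_failureStates
  have hX := hM.ae_jumpChain_eq
  refine ⟨⟨hM.isCTMC_failures, fun i j hij hjn =>
      ⟨hM.subordinator.lam_nonneg (by omega) (by omega), LFMO.choose_mul_lam_eq_sum _ hij hjn⟩,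
      fun t A hA => ⟨hM.map_cond_lifetime t A hA, fun j hAj hjn =>
        hM.subordinator.hasLaw_first_shock A (by omega) (by omega)⟩⟩,
    ⟨hX.mono fun ω h => h 0, hR.isDTMC hX hM.absorbedMatrix_nonneg hM.absorbedMatrix_row_sum,
      fun i j hij hjn => ⟨hM.subordinator.laplaceExponent_pos hM.nontrivial (by omega),
        LFMO.transProb_eq_sum _ hij hjn⟩⟩,
    ⟨fun j => hM.jumpInto_zero, fun i j => hM.jumpInto_recursion, fun i j _ hji => ?_,
      fun i j k => hR.jumpIntoSet_eq_sum hX⟩,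
    ⟨fun i j => hM.jumpFrom_eq_sum_pow, fun i j hji => ?_,
      fun i j => hR.jumpInto_eq_sum_jumpFrom hX, fun i j k hij hjk hkn => ?_⟩,
    fun r k hr hrn hk hkn => ⟨fun h => hM.measureReal_orderStat_lt hr h hkn, fun h => ?_,
      fun h => hM.measureReal_orderStat_eq hr h hkn, fun h => ?_,
      fun h => hM.measureReal_failuresAt_orderStat hr h hkn,
      hM.measureReal_failuresAt_orderStat_of_lt hr hrn⟩⟩
  · simp [LFMO.jumpInto, hji.not_gt]
  · have : ¬ (i : ℕ) < j := not_lt.2 hji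
    simp [LFMO.jumpFrom, this]
  · rw [hR.jumpIntoSet_eq_sum hX hij hjk hkn, Finset.sum_comm]
    refine Finset.sum_congr rfl fun l hl => ?_
    rw [Finset.mem_Icc] at hl
    exact hR.jumpInto_eq_sum_jumpFrom hX (by omega) (by omega)
  · simp [(LFMO.orderStat_mono (fun i => LFMO.lifetime L ε i _) hk h hrn).not_gt]
  · simp [h]
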